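/- Let \(\mathcal X\) be a set, \((\mathcal Y,\mathcal A)\) a measurable space and \(W:\mathcal X\to\mathcal P(\mathcal A)\) a channel, where \(\mathcal P(\mathcal A)\) is the set of probability measures on \(\mathcal A\). For \(\alpha>0\) and \(P,Q\in\mathcal P(\mathcal A)\), both absolutely continuous with respect to a measure \(\mu\), let \(D_\alpha(P\|Q)=\frac1{\alpha-1}\ln\int(\frac{dP}{d\mu})^\alpha(\frac{dQ}{d\mu})^{1-\alpha}d\mu\) for \(\alpha\ne1\) and let \(D_1(P\|Q)\) be the Kullback–Leibler divergence. If \(D_\alpha(P\|Q)<\infty\), let \(P_\alpha^{Q}\) be the tilted probability measure with \(\frac{dP_\alpha^{Q}}{d\mu}=e^{(1-\alpha)D_\alpha(P\|Q)}(\frac{dP}{d\mu})^\alpha(\frac{dQ}{d\mu})^{1-\alpha}\), and write \(W_\alpha^Q(x)=W(x)_\alpha^Q\). The order \(\alpha\) Augustin capacity is \(C_\alpha=\sup_p\inf_{Q\in\mathcal P(\mathcal A)}\sum_x p(x)D_\alpha(W(x)\|Q)\), the supremum being over the finitely supported probability mass functions \(p\) on \(\mathcal X\). If \(C_\alpha<\infty\),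 the order \(\alpha\) Augustin center \(q_\alpha\) is the (unique) probability measure with \(C_\alpha=\sup_p\sum_x p(x)D_\alpha(W(x)\|q_\alpha)\). The sphere packing exponent is \(E_{sp}(R,W)=\sup_{\alpha\in(0,1)}\frac{1-\alpha}{\alpha}(C_\alpha-R)\). Assume that there is a probability measure \(\nu\) with \(W(x)\ll\nu\) for all \(x\), and that \(W\) is Rényi symmetric: for each \(\alpha>0\) with \(C_\alpha<\infty\) there is a function \(G_\alpha:\mathbb R\to[0,1]\) such that \(W(x)\big(\{\frac{dW(x)}{d\nu}\le e^{s}\frac{dq_\alpha}{d\nu}\}\big)=G_\alpha(s)\) for all \(x\in\mathcal X\) and \(s\in\mathbb R\). Suppose that \(C_1<\infty\) and \(\lim_{\alpha\downarrow0}C_\alpha<R<C_1\). Then there is an order \(\alpha^*\in(0,1)\) such that \[R=D_1\big(W_{\alpha^*}^{q_{\alpha^*}}(x)\,\big\|\,q_{\alpha^*}\big)\qquad\text{for all }x\in\mathcal X,\tag{1}\] and every \(\alpha^*\in(0,1)\) satisfying (1) also satisfies \[E_{sp}(R,W)=D_1\big(W_{\alpha^*}^{q_{\alpha^*}}(x)\,\big\|\,W(x)\big)\qquad\text{for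 all }x\in\mathcal X.\] Furthermore, for every \(\alpha^*\in(0,1)\) satisfying (1): if either (a) for some input \(x\in\mathcal X\) one has \(W_{\alpha^*}^{q_{\alpha^*}}(x)\big(\{\frac{dW(x)}{d\nu}=\gamma\frac{dq_{\alpha^*}}{d\nu}\}\big)<1\) for all \(\gamma>0\) (by symmetry the choice of \(x\) is immaterial), or (b) there is a probability measure \(Q\) with \(q_\alpha=Q\) for all \(\alpha\in(0,1]\), then \(E_{sp}(\cdot,W)\) is finite near \(R\) and differentiable at \(R\), with \[\frac{\partial}{\partial R}E_{sp}(R,W)=\frac{\alpha^*-1}{\alpha^*}.\] -/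

import Mathlib

open MeasureTheory Set Filter Topology
open scoped ENNReal

noncomputable section

/-- The integral `∫ (dP/dμ)^α (dQ/dμ)^(1-α) dμ`, computed with the dominating measure `μ = P + Q`
(its value does not depend on the choice of the dominating measure). -/
def hellingerIntegral {Y : Type*} [MeasurableSpace Y] (α : ℝ) (P Q : Measure Y) : ℝ≥0∞ :=
  ∫⁻ y, (P.rnDeriv (P + Q) y) ^ α * (Q.rnDeriv (P + Q) y) ^ (1 - α) ∂(P + Q)

/-- The order `α` Rényi divergence `D_α(P‖Q)` between probability measures, for `α > 0`.
The order one divergence is the Kullback-Leibler divergence. -/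
def renyiDiv {Y : Type*} [MeasurableSpace Y] (α : ℝ) (P Q : Measure Y) : EReal :=
  if α = 1 then ((InformationTheory.klDiv P Q : ℝ≥0∞) : EReal)
  else (((α - 1)⁻¹ : ℝ) : EReal) * ENNReal.log (hellingerIntegral α P Q)

/-- The order `α` tilted probability measure between `P` and `Q`, whose density is
`exp ((1-α) D_α(P‖Q)) (dP/dμ)^α (dQ/dμ)^(1-α)` with respect to `μ = P + Q`.
It is meaningful when `D_α(P‖Q) < ∞`. -/
def tiltedMeasure {Y : Type*} [MeasurableSpace Y] (α : ℝ) (P Q : Measure Y) : Measure Y :=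
  (P + Q).withDensity fun y =>
    EReal.exp (((1 - α : ℝ) : EReal) * renyiDiv α P Q) *
      ((P.rnDeriv (P + Q) y) ^ α * (Q.rnDeriv (P + Q) y) ^ (1 - α))

/-- The order `α` conditional Rényi divergence `D_α(W‖Q|p) = ∑ x, p x * D_α(W x‖Q)` for a
finitely supported probability mass function `p` on the input set. -/
def condRenyiDiv {X Y : Type*} [MeasurableSpace Y] (α : ℝ) (W : X → ProbabilityMeasure Y)
    (Q : Measure Y) (p : Convexity.StdSimplex ℝ X) : EReal :=
  ∑ x ∈ p.weights.support, ((p.weights x : ℝ) : EReal) * renyiDiv α (W x : Measure Y) Q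

/-- The order `α` Augustin information for the input distribution `p`. -/
def augustinInfo {X Y : Type*} [MeasurableSpace Y] (α : ℝ) (W : X → ProbabilityMeasure Y)
    (p : Convexity.StdSimplex ℝ X) : EReal :=
  ⨅ Q : ProbabilityMeasure Y, condRenyiDiv α W (Q : Measure Y) p

/-- The order `α` Augustin capacity `C_α(W)`. -/
def augustinCapacity {X Y : Type*} [MeasurableSpace Y] (α : ℝ)
    (W : X → ProbabilityMeasure Y) : EReal :=
  ⨆ p : Convexity.StdSimplex ℝ X, augustinInfo α W p

/-- `q` is the order `α` Augustin center of `W`: the capacity `C_α(W)` is finite and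
`C_α(W) = sup_p D_α(W‖q|p)`. -/
def IsAugustinCenter {X Y : Type*} [MeasurableSpace Y] (α : ℝ)
    (W : X → ProbabilityMeasure Y) (q : ProbabilityMeasure Y) : Prop :=
  augustinCapacity α W < ⊤ ∧
    augustinCapacity α W = ⨆ p : Convexity.StdSimplex ℝ X, condRenyiDiv α W (q : Measure Y) p

/-- `W`, dominated by the probability measure `ν`, is Rényi symmetric: for every order `α > 0` of
finite capacity, with center `q`, the distribution function
`s ↦ W x {dW x/dν ≤ e^s dq/dν}` does not depend on the input `x`. -/
def IsRenyiSymmetric {X Y : Type*} [MeasurableSpace Y] (W : X → ProbabilityMeasure Y)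
    (ν : ProbabilityMeasure Y) : Prop :=
  (∀ x, (W x : Measure Y) ≪ (ν : Measure Y)) ∧
  ∀ α : ℝ, 0 < α → augustinCapacity α W < ⊤ →
    ∃ G : ℝ → unitInterval, ∀ q : ProbabilityMeasure Y, IsAugustinCenter α W q →
      ∀ (x : X) (s : ℝ),
        (W x : Measure Y) {y | (W x : Measure Y).rnDeriv (ν : Measure Y) y ≤
            ENNReal.ofReal (Real.exp s) * (q : Measure Y).rnDeriv (ν : Measure Y) y} =
          ENNReal.ofReal (G s : ℝ)

/-- The sphere packing exponent `sup_{α ∈ (0,1)} ((1-α)/α) (C_α(W) - R)`. -/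
def spherePackingExponent {X Y : Type*} [MeasurableSpace Y] (R : ℝ)
    (W : X → ProbabilityMeasure Y) : EReal :=
  ⨆ α ∈ Ioo (0 : ℝ) 1, (((1 - α) / α : ℝ) : EReal) * (augustinCapacity α W - (R : EReal))

end

/-! Write w for the density of W(x), q_α for the density of the center, and Φ_α(β) = log ∫ w^β
q_α^(1-β) dν. Symmetry at order α fixes the law of q_α/w under W(x), so Φ_α does not depend on x. It
is a cumulant generating function of log(w/q_α), hence convex on (0,1), and its slope d(α) at β = α
is the mean of log(w/q_α) under the tilted measure. In these terms D_1(tilted‖q_α) = α d(α) - Φ_α(α)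
=: g(α) and D_1(tilted‖W(x)) = (α-1) d(α) - Φ_α(α).

Using q_α as a competitor at order β, where by symmetry all its divergences are equal, gives (1-β)
C_β ≤ -Φ_α(β), with equality at β = α. The tangent to Φ_α at α, divided by β, becomes affine in 1/β:
(1-β) C_β / β ≤ -Φ_α(β)/β ≤ -Φ_α(α)/α + g(α) (1/β - 1/α). If g(α) = R, then (1-β)/β (C_β - R) is
maximal at β = α, and the maximum equals (α-1) d(α) - Φ_α(α). This is the formula for the exponent.

An order with g(α) = R comes from the intermediate value theorem: g ≤ C_α < R at small orders, and g
< R everywhere would give C_β ≤ R for all β < 1 and then C_1 ≤ R. Continuity of g rests on L¹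
continuity of the centers in the order (`exists_order_of_tangents`,
`IsCenterFamily.tendsto_densDist`).

For the derivative, condition (a) says that log(w/q_α) is not almost surely constant under the tilt,
so the tangent inequality is strict away from α. The maximizer at R is then unique and the supremum
is differentiable there (`conjugate_le_of_strict_tangent`). Condition (b) implies (a): otherwise Φ_α
would be affine and C_β constant on (0,1), contradicting lim C_α < R < C_1.

The centers are constructed by a finite minimax theorem (separation of convex sets) and a uniform
convexity estimate: the power mean of exponent 1-α of two nearly optimal densities has mass close to
one only if they are close in L¹. -/

/-- The integral `∫ w^α q^(1-α) dν` of two densities with respect to `ν`. -/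
noncomputable def hell {Y : Type*} [MeasurableSpace Y] (ν : Measure Y) (α : ℝ) (w q : Y → ℝ≥0∞) :
    ℝ≥0∞ :=
  ∫⁻ y, w y ^ α * q y ^ (1 - α) ∂ν

/-! ### Independence of the dominating measure -/

section BaseChange

variable {Y : Type*} [MeasurableSpace Y]

theorem rpow_mul_rpow_mul_self {α : ℝ} (h0 : 0 ≤ α) (h1 : α ≤ 1) (a b m : ℝ≥0∞) :
    m * (a ^ α * b ^ (1 - α)) = (a * m) ^ α * (b * m) ^ (1 - α) := by
  have hm : m = m ^ α * m ^ (1 - α) := by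
    rw [← ENNReal.rpow_add_of_nonneg _ _ h0 (by linarith)]; simp
  rw [ENNReal.mul_rpow_of_nonneg _ _ h0, ENNReal.mul_rpow_of_nonneg _ _ (by linarith : 0 ≤ 1 - α)]
  nth_rewrite 1 [hm]
  ring

theorem withDensity_rpow_mul_rpow_of_ac {α : ℝ} (h0 : 0 ≤ α) (h1 : α ≤ 1) (P Q μ l : Measure Y)
    [SigmaFinite P] [SigmaFinite Q] [SigmaFinite μ] [SigmaFinite l]
    (hP : P ≪ μ) (hQ : Q ≪ μ) (hμ : μ ≪ l) :
    μ.withDensity (fun y => P.rnDeriv μ y ^ α * Q.rnDeriv μ y ^ (1 - α)) =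
      l.withDensity (fun y => P.rnDeriv l y ^ α * Q.rnDeriv l y ^ (1 - α)) := by
  have key := withDensity_mul l (Measure.measurable_rnDeriv μ l)
    (g := fun y => P.rnDeriv μ y ^ α * Q.rnDeriv μ y ^ (1 - α)) (by fun_prop)
  rw [Measure.withDensity_rnDeriv_eq _ _ hμ] at key
  rw [← key]
  refine withDensity_congr_ae ?_
  filter_upwards [Measure.rnDeriv_mul_rnDeriv (κ := l) hP, Measure.rnDeriv_mul_rnDeriv (κ := l) hQ]
    with y h2 h3
  rw [Pi.mul_apply, rpow_mul_rpow_mul_self h0 h1, ← h2, ← h3]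
  rfl

theorem rnDeriv_eq_zero_or_of_mutuallySingular (P S ν l : Measure Y) [SigmaFinite P] [SigmaFinite S]
    [SigmaFinite l] (hP : P ≪ ν) (hS : S ⟂ₘ ν) :
    ∀ᵐ y ∂l, P.rnDeriv l y = 0 ∨ S.rnDeriv l y = 0 := by
  obtain ⟨t, ht, h1, h2⟩ := hS
  have hS0 : ∫⁻ y in t, S.rnDeriv l y ∂l = 0 :=
    le_antisymm ((Measure.setLIntegral_rnDeriv_le t).trans h1.le) bot_le
  have hP0 : ∫⁻ y in tᶜ, P.rnDeriv l y ∂l = 0 :=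
    le_antisymm ((Measure.setLIntegral_rnDeriv_le _).trans (hP h2).le) bot_le
  rw [lintegral_eq_zero_iff (by fun_prop), ] at hS0 hP0
  have a1 := (ae_restrict_iff' ht).1 hS0
  have a2 := (ae_restrict_iff' ht.compl).1 hP0
  filter_upwards [a1, a2] with y b1 b2
  by_cases hy : y ∈ t
  · exact Or.inr (b1 hy)
  · exact Or.inl (b2 hy)

/-- The part of `Q` singular to `ν` lives where the density of `P` vanishes, so the factor with
exponent `α > 0` kills it. What remains is the chain rule through `ν + Q`, the integrand being
homogeneous of degree one in the two densities. No domination of `Q` is needed, which matters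
because the infimum in the capacity runs over all `Q`. -/
theorem withDensity_rpow_mul_rpow {α : ℝ} (h0 : 0 < α) (h1 : α ≤ 1) (P Q ν : Measure Y)
    [IsFiniteMeasure P] [IsFiniteMeasure Q] [IsFiniteMeasure ν] (hP : P ≪ ν) :
    (P + Q).withDensity (fun y => P.rnDeriv (P + Q) y ^ α * Q.rnDeriv (P + Q) y ^ (1 - α)) =
      ν.withDensity (fun y => P.rnDeriv ν y ^ α * Q.rnDeriv ν y ^ (1 - α)) := by
  have hνl : ν ≪ ν + Q := Measure.AbsolutelyContinuous.rfl.add_right Q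
  have hQl : Q ≪ ν + Q := by rw [add_comm]; exact Measure.AbsolutelyContinuous.rfl.add_right ν
  have hPl := hP.trans hνl
  have hQP : Q ≪ P + Q := by rw [add_comm]; exact Measure.AbsolutelyContinuous.rfl.add_right P
  rw [withDensity_rpow_mul_rpow_of_ac h0.le h1 P Q (P + Q) (ν + Q)
    (Measure.AbsolutelyContinuous.rfl.add_right Q) hQP (Measure.AbsolutelyContinuous.add_left hPl hQl)]
  set A := ν.withDensity (Q.rnDeriv ν) with hA
  have : IsFiniteMeasure A := isFiniteMeasure_withDensity (Measure.lintegral_rnDeriv_lt_top _ _).ne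
  have hAν : A ≪ ν := withDensity_absolutelyContinuous _ _
  have e1 : (ν + Q).withDensity (fun y => P.rnDeriv (ν + Q) y ^ α * Q.rnDeriv (ν + Q) y ^ (1 - α))
      = (ν + Q).withDensity (fun y => P.rnDeriv (ν + Q) y ^ α * A.rnDeriv (ν + Q) y ^ (1 - α)) := by
    refine withDensity_congr_ae ?_
    have hdec := Measure.haveLebesgueDecomposition_add Q ν
    have hadd := Measure.rnDeriv_add (Q.singularPart ν) A (ν + Q)
    rw [← hdec] at hadd
    filter_upwards [hadd, rnDeriv_eq_zero_or_of_mutuallySingular P (Q.singularPart ν) ν (ν + Q) hP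
      (Measure.mutuallySingular_singularPart Q ν)] with y b1 b2
    rcases b2 with b2 | b2
    · simp [b2, h0]
    · rw [b1, Pi.add_apply, b2, zero_add]
  rw [e1, ← withDensity_rpow_mul_rpow_of_ac h0.le h1 P A ν (ν + Q) hP hAν hνl]
  refine withDensity_congr_ae ?_
  filter_upwards [Measure.rnDeriv_withDensity ν (Measure.measurable_rnDeriv Q ν)] with y hy
  rw [hy]

theorem hellingerIntegral_eq_hell {α : ℝ} (h0 : 0 < α) (h1 : α ≤ 1) (P Q ν : Measure Y)
    [IsFiniteMeasure P] [IsFiniteMeasure Q] [IsFiniteMeasure ν] (hP : P ≪ ν) :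
    hellingerIntegral α P Q = hell ν α (P.rnDeriv ν) (Q.rnDeriv ν) := by
  have h := congrArg (fun m : Measure Y => m univ) (withDensity_rpow_mul_rpow h0 h1 P Q ν hP)
  simpa [hellingerIntegral, hell, withDensity_apply] using h

theorem hell_congr {ν : Measure Y} {α : ℝ} {w w' q q' : Y → ℝ≥0∞} (hw : w =ᵐ[ν] w')
    (hq : q =ᵐ[ν] q') : hell ν α w q = hell ν α w' q' := by
  refine lintegral_congr_ae ?_
  filter_upwards [hw, hq] with y h1 h2
  rw [h1, h2]

theorem hellingerIntegral_withDensity {α : ℝ} (h0 : 0 < α) (h1 : α ≤ 1) (P ν : Measure Y)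
    [IsFiniteMeasure P] [IsFiniteMeasure ν] (hP : P ≪ ν) {q : Y → ℝ≥0∞} (hq : Measurable q)
    (hq1 : ∫⁻ y, q y ∂ν ≠ ∞) :
    hellingerIntegral α P (ν.withDensity q) = hell ν α (P.rnDeriv ν) q := by
  have : IsFiniteMeasure (ν.withDensity q) := isFiniteMeasure_withDensity hq1
  rw [hellingerIntegral_eq_hell h0 h1 P _ ν hP]
  exact hell_congr EventuallyEq.rfl (Measure.rnDeriv_withDensity ν hq)

theorem tiltedMeasure_eq_withDensity {α : ℝ} (h0 : 0 < α) (h1 : α ≤ 1) (P Q ν : Measure Y)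
    [IsFiniteMeasure P] [IsFiniteMeasure Q] [IsFiniteMeasure ν] (hP : P ≪ ν) :
    tiltedMeasure α P Q = EReal.exp (((1 - α : ℝ) : EReal) * renyiDiv α P Q) •
      ν.withDensity (fun y => P.rnDeriv ν y ^ α * Q.rnDeriv ν y ^ (1 - α)) := by
  rw [← withDensity_rpow_mul_rpow h0 h1 P Q ν hP, ← withDensity_smul _ (by fun_prop)]
  rfl

end BaseChange

/-! ### The Hellinger integral: monotonicity, concavity, L¹ continuity -/

section HellingerFunctional

variable {Y : Type*} [MeasurableSpace Y] {ν : Measure Y}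

theorem hell_swap (α : ℝ) (w q : Y → ℝ≥0∞) : hell ν α w q = hell ν (1 - α) q w := by
  simp [hell, mul_comm]

theorem hell_le_mul {α : ℝ} (h0 : 0 ≤ α) (h1 : α ≤ 1) {w q : Y → ℝ≥0∞} (hw : Measurable w)
    (hq : Measurable q) : hell ν α w q ≤ (∫⁻ y, w y ∂ν) ^ α * (∫⁻ y, q y ∂ν) ^ (1 - α) :=
  ENNReal.lintegral_mul_norm_pow_le hw.aemeasurable hq.aemeasurable h0 (by linarith) (by ring)

theorem hell_le_one {α : ℝ} (h0 : 0 ≤ α) (h1 : α ≤ 1) {w q : Y → ℝ≥0∞} (hw : Measurable w)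
    (hq : Measurable q) (hw1 : ∫⁻ y, w y ∂ν ≤ 1) (hq1 : ∫⁻ y, q y ∂ν ≤ 1) : hell ν α w q ≤ 1 :=
  (hell_le_mul h0 h1 hw hq).trans (mul_le_one' (ENNReal.rpow_le_one hw1 h0)
    (ENNReal.rpow_le_one hq1 (by linarith)))

theorem hell_mono {α : ℝ} (h1 : α ≤ 1) (w : Y → ℝ≥0∞) {q q' : Y → ℝ≥0∞} (h : ∀ y, q y ≤ q' y) :
    hell ν α w q ≤ hell ν α w q' :=
  lintegral_mono fun y => mul_le_mul' le_rfl (ENNReal.rpow_le_rpow (h y) (by linarith))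

theorem hell_smul_right {α : ℝ} (h1 : α ≤ 1) {w q : Y → ℝ≥0∞} (hw : Measurable w)
    (hq : Measurable q) (c : ℝ≥0∞) :
    hell ν α w (fun y => c * q y) = c ^ (1 - α) * hell ν α w q := by
  rw [hell, hell, ← lintegral_const_mul _ (by fun_prop)]
  refine lintegral_congr fun y => ?_
  rw [ENNReal.mul_rpow_of_nonneg _ _ (by linarith : 0 ≤ 1 - α)]
  ring

/-- Log-convexity of the Hellinger integral in the order, with one endpoint at order zero. -/
theorem hell_le_rpow_of_le {α β : ℝ} (hβ : 0 < β) (hβα : β ≤ α) (h1 : α ≤ 1) {w q : Y → ℝ≥0∞}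
    (hw : Measurable w) (hq : Measurable q) (hq1 : ∫⁻ y, q y ∂ν ≤ 1) :
    hell ν β w q ≤ hell ν α w q ^ (β / α) := by
  have hα : 0 < α := hβ.trans_le hβα
  have ht0 : 0 ≤ β / α := by positivity
  have ht1 : β / α ≤ 1 := (div_le_one hα).2 hβα
  have h := hell_le_mul (ν := ν) ht0 ht1 (w := fun y => w y ^ α * q y ^ (1 - α)) (q := q)
    (by fun_prop) hq
  calc hell ν β w q = hell ν (β / α) (fun y => w y ^ α * q y ^ (1 - α)) q := by
        refine lintegral_congr fun y => ?_
        rw [ENNReal.mul_rpow_of_nonneg _ _ ht0, ← ENNReal.rpow_mul, ← ENNReal.rpow_mul, mul_assoc,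
          ← ENNReal.rpow_add_of_nonneg _ _ (mul_nonneg (by linarith) ht0) (by linarith)]
        congr 2 <;> field_simp
        ring
    _ ≤ _ := h
    _ ≤ hell ν α w q ^ (β / α) * 1 := mul_le_mul' le_rfl (ENNReal.rpow_le_one hq1 (by linarith))
    _ = _ := mul_one _

theorem hell_le_rpow_of_ge {α β : ℝ} (hα : 0 ≤ α) (hαβ : α ≤ β) (hβ : β < 1) {w q : Y → ℝ≥0∞}
    (hw : Measurable w) (hq : Measurable q) (hw1 : ∫⁻ y, w y ∂ν ≤ 1) :
    hell ν β w q ≤ hell ν α w q ^ ((1 - β) / (1 - α)) := by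
  rw [hell_swap β, hell_swap α]
  exact hell_le_rpow_of_le (by linarith) (by linarith) (by linarith) hq hw hw1

theorem rpow_concave {r : ℝ} (h0 : 0 < r) (h1 : r ≤ 1) {c d : ℝ≥0∞} (hcd : c + d = 1)
    (a b : ℝ≥0∞) : c * a ^ r + d * b ^ r ≤ (c * a + d * b) ^ r := by
  have h := ENNReal.rpow_arith_mean_le_arith_mean2_rpow c d (a ^ r) (b ^ r) hcd
    (p := 1 / r) (by rw [le_div_iff₀ h0]; linarith)
  rw [← ENNReal.rpow_mul, ← ENNReal.rpow_mul, mul_one_div_cancel h0.ne', ENNReal.rpow_one,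
    ENNReal.rpow_one] at h
  calc c * a ^ r + d * b ^ r = ((c * a ^ r + d * b ^ r) ^ (1 / r)) ^ r := by
        rw [← ENNReal.rpow_mul, one_div_mul_cancel h0.ne', ENNReal.rpow_one]
    _ ≤ _ := ENNReal.rpow_le_rpow h h0.le

theorem hell_concave {α : ℝ} (h0 : 0 ≤ α) (h1 : α < 1) {c d : ℝ≥0∞} (hcd : c + d = 1)
    {w q q' : Y → ℝ≥0∞} (hw : Measurable w) (hq : Measurable q) (hq' : Measurable q') :
    c * hell ν α w q + d * hell ν α w q' ≤ hell ν α w (fun y => c * q y + d * q' y) := by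
  rw [hell, hell, hell, ← lintegral_const_mul _ (by fun_prop), ← lintegral_const_mul _ (by fun_prop),
    ← lintegral_add_left (by fun_prop)]
  refine lintegral_mono fun y => ?_
  calc _ = w y ^ α * (c * q y ^ (1 - α) + d * q' y ^ (1 - α)) := by ring
    _ ≤ _ := by
      gcongr
      exact rpow_concave (by linarith) (by linarith) hcd _ _

/-- The `L¹` distance of two densities. -/
noncomputable def densDist (ν : Measure Y) (q q' : Y → ℝ≥0∞) : ℝ≥0∞ :=
  ∫⁻ y, ‖(q y).toReal - (q' y).toReal‖ₑ ∂ν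

theorem densDist_comm (q q' : Y → ℝ≥0∞) : densDist ν q q' = densDist ν q' q := by
  refine lintegral_congr fun y => ?_
  rw [enorm_sub_rev]

theorem le_add_enorm_toReal_sub {a b : ℝ≥0∞} (ha : a ≠ ∞) :
    a ≤ b + ‖a.toReal - b.toReal‖ₑ := by
  by_cases hb : b = ∞
  · simp [hb]
  rw [Real.enorm_eq_ofReal_abs]
  nth_rewrite 1 [← ENNReal.ofReal_toReal ha]
  nth_rewrite 1 [← ENNReal.ofReal_toReal hb]
  rw [← ENNReal.ofReal_add (by positivity) (by positivity)]
  refine ENNReal.ofReal_le_ofReal ?_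
  linarith [le_abs_self (a.toReal - b.toReal)]

/-- Subadditivity of `t ^ (1 - α)` followed by Hölder's inequality: the Hellinger integral is Hölder
continuous in its second density, uniformly in the first. -/
theorem hell_le_add_densDist {α : ℝ} (h0 : 0 ≤ α) (h1 : α ≤ 1) {w q q' : Y → ℝ≥0∞}
    (hw : Measurable w) (hq : Measurable q) (hq' : Measurable q') (hw1 : ∫⁻ y, w y ∂ν ≤ 1)
    (hq1 : ∫⁻ y, q y ∂ν ≠ ∞) :
    hell ν α w q ≤ hell ν α w q' + densDist ν q q' ^ (1 - α) := by
  have hfin := ae_lt_top hq hq1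
  calc hell ν α w q
      ≤ ∫⁻ y, w y ^ α * q' y ^ (1 - α) + w y ^ α * ‖(q y).toReal - (q' y).toReal‖ₑ ^ (1 - α) ∂ν := by
        refine lintegral_mono_ae ?_
        filter_upwards [hfin] with y hy
        rw [← mul_add]
        gcongr
        exact (ENNReal.rpow_le_rpow (le_add_enorm_toReal_sub hy.ne) (by linarith)).trans
          (ENNReal.rpow_add_le_add_rpow _ _ (by linarith) (by linarith))
    _ = hell ν α w q' + hell ν α w (fun y => ‖(q y).toReal - (q' y).toReal‖ₑ) := by
        rw [lintegral_add_left (by fun_prop)]; rfl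
    _ ≤ _ := by
        gcongr
        refine (hell_le_mul h0 h1 hw (by fun_prop)).trans ?_
        calc _ ≤ 1 * densDist ν q q' ^ (1 - α) := by
              gcongr
              · exact ENNReal.rpow_le_one hw1 h0
              · rfl
          _ = _ := one_mul _

theorem tendsto_hell {ι : Type*} {l : Filter ι} {α : ℝ} (h0 : 0 ≤ α) (h1 : α < 1)
    {w q : Y → ℝ≥0∞} {u : ι → Y → ℝ≥0∞}
    (hw : Measurable w) (hq : Measurable q) (hu : ∀ i, Measurable (u i)) (hw1 : ∫⁻ y, w y ∂ν ≤ 1)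
    (hq1 : ∫⁻ y, q y ∂ν ≠ ∞) (hu1 : ∀ i, ∫⁻ y, u i y ∂ν ≠ ∞)
    (h : Tendsto (fun i => densDist ν (u i) q) l (𝓝 0)) :
    Tendsto (fun i => hell ν α w (u i)) l (𝓝 (hell ν α w q)) := by
  have hr : Tendsto (fun i => densDist ν (u i) q ^ (1 - α)) l (𝓝 0) := by
    have := (ENNReal.continuous_rpow_const (y := 1 - α)).tendsto 0 |>.comp h
    rwa [ENNReal.zero_rpow_of_pos (by linarith : 0 < 1 - α)] at this
  have hfin : hell ν α w q ≠ ∞ := by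
    refine ne_top_of_le_ne_top ?_ (hell_le_mul h0 h1.le hw hq)
    exact ENNReal.mul_ne_top (ENNReal.rpow_ne_top_of_nonneg h0 (ne_top_of_le_ne_top (by simp) hw1))
      (ENNReal.rpow_ne_top_of_nonneg (by linarith) hq1)
  refine tendsto_of_tendsto_of_tendsto_of_le_of_le
    (g := fun i => hell ν α w q - densDist ν (u i) q ^ (1 - α))
    (h := fun i => hell ν α w q + densDist ν (u i) q ^ (1 - α)) ?_ ?_ ?_ ?_
  · simpa using ENNReal.Tendsto.sub tendsto_const_nhds hr (Or.inl hfin)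
  · simpa using tendsto_const_nhds.add hr
  · intro i
    rw [tsub_le_iff_right]
    have := hell_le_add_densDist h0 h1.le hw hq (hu i) hw1 hq1
    rwa [densDist_comm] at this
  · intro i
    exact hell_le_add_densDist h0 h1.le hw (hu i) hq hw1 (hu1 i)

end HellingerFunctional

/-! ### Power means and uniform convexity -/

section PowerMean

/-- The power mean of exponent `r` of two numbers. -/
noncomputable def powMean (r : ℝ) (a b : ℝ≥0∞) : ℝ≥0∞ := ((a ^ r + b ^ r) / 2) ^ (1 / r)

@[fun_prop]
theorem measurable_powMean {Y : Type*} [MeasurableSpace Y] (r : ℝ) {f g : Y → ℝ≥0∞}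
    (hf : Measurable f) (hg : Measurable g) : Measurable fun y => powMean r (f y) (g y) := by
  unfold powMean; fun_prop

/-- This identity dictates the exponent `1 - α`: the Hellinger integral is exactly preserved on
average, while the mass of the mean drops strictly unless the densities agree. -/
theorem hell_powMean {Y : Type*} [MeasurableSpace Y] {ν : Measure Y} {α : ℝ} (h1 : α < 1)
    {w q q' : Y → ℝ≥0∞} (hw : Measurable w) (hq : Measurable q) :
    hell ν α w (fun y => powMean (1 - α) (q y) (q' y)) = (hell ν α w q + hell ν α w q') / 2 := by
  rw [hell, hell, hell, ← lintegral_add_left (by fun_prop), div_eq_mul_inv,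
    ← lintegral_mul_const' _ _ (by simp)]
  refine lintegral_congr fun y => ?_
  rw [powMean, ← ENNReal.rpow_mul, one_div_mul_cancel (by linarith : 1 - α ≠ 0), ENNReal.rpow_one,
    div_eq_mul_inv]
  ring

/-- Here `x` and `y` are the square roots of the numbers being averaged. Power means increase with
the exponent, and the right side is the mean of exponent 1/2. -/
theorem powMean_real_le_of_le_half {r x y : ℝ} (h0 : 0 < r) (h1 : r ≤ 1 / 2) (hx : 0 ≤ x)
    (hy : 0 ≤ y) :
    ((x ^ (2 * r) + y ^ (2 * r)) / 2) ^ (1 / r) ≤ ((x + y) / 2) ^ 2 := by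
  have hp : 1 ≤ 1 / (2 * r) := by rw [le_div_iff₀ (by positivity)]; linarith
  have h := (convexOn_rpow hp).2 (show x ^ (2 * r) ∈ Ici 0 from Real.rpow_nonneg hx _)
    (show y ^ (2 * r) ∈ Ici 0 from Real.rpow_nonneg hy _)
    (show (0 : ℝ) ≤ 1 / 2 by norm_num) (show (0 : ℝ) ≤ 1 / 2 by norm_num) (by norm_num)
  simp only [smul_eq_mul] at h
  rw [← Real.rpow_mul hx, ← Real.rpow_mul hy, mul_one_div_cancel (by positivity), Real.rpow_one,
    Real.rpow_one] at h
  have e : ((x ^ (2 * r) + y ^ (2 * r)) / 2) ^ (1 / r) =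
      ((1 / 2 * x ^ (2 * r) + 1 / 2 * y ^ (2 * r)) ^ (1 / (2 * r))) ^ 2 := by
    rw [← Real.rpow_natCast, ← Real.rpow_mul (by positivity)]
    congr 1
    · ring
    · field_simp; norm_num
  rw [e]
  refine pow_le_pow_left₀ (by positivity) (h.trans (by linarith)) 2

/-- Lyapunov's inequality on two points of weight 1/2: the exponent `1 + θ` interpolates between 2
and 1. -/
theorem add_rpow_le_rpow_mul_rpow {x y θ : ℝ} (h0 : 0 < θ) (h1 : θ < 1) (hx : 0 ≤ x)
    (hy : 0 ≤ y) :
    (x ^ (1 + θ) + y ^ (1 + θ)) / 2 ≤ ((x ^ 2 + y ^ 2) / 2) ^ θ * ((x + y) / 2) ^ (1 - θ) := by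
  have hpq : Real.HolderConjugate (1 / θ) (1 / (1 - θ)) := by
    refine ⟨?_, by positivity, by have := sub_pos.2 h1; positivity⟩
    simp
  have key := Real.inner_le_Lp_mul_Lq_of_nonneg (s := Finset.univ)
    (f := ![(x ^ 2 / 2) ^ θ, (y ^ 2 / 2) ^ θ]) (g := ![(x / 2) ^ (1 - θ), (y / 2) ^ (1 - θ)]) hpq
    (by intro i _; fin_cases i <;> simp <;> positivity)
    (by intro i _; fin_cases i <;> simp <;> positivity)
  have hs : 0 < 1 - θ := by linarith
  simp only [Fin.sum_univ_two, Matrix.cons_val_zero, Matrix.cons_val_one, one_div_one_div] at key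
  have e1 : ∀ z : ℝ, 0 ≤ z → (z ^ 2 / 2) ^ θ * (z / 2) ^ (1 - θ) = z ^ (1 + θ) / 2 := by
    intro z hz
    rw [Real.div_rpow (by positivity) (by norm_num), Real.div_rpow hz (by norm_num),
      ← Real.rpow_natCast, ← Real.rpow_mul hz, div_mul_div_comm, ← Real.rpow_add_of_nonneg hz
        (by positivity) hs.le, ← Real.rpow_add (by norm_num : (0:ℝ) < 2)]
    congr 2
    · push_cast; ring
    · simp
  rw [e1 x hx, e1 y hy] at key
  have e2 : ∀ z t : ℝ, 0 ≤ z → 0 < t → (z ^ t) ^ (1 / t) = z := by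
    intro z t hz ht
    rw [← Real.rpow_mul hz, mul_one_div_cancel ht.ne', Real.rpow_one]
  rw [e2 _ _ (by positivity) h0, e2 _ _ (by positivity) h0, e2 _ _ (by positivity) hs,
    e2 _ _ (by positivity) hs] at key
  convert key using 2 <;> ring_nf

/-- A quantitative gap between power mean and arithmetic mean. For `r ≤ 1/2` the mean of exponent
1/2 is an upper bound and its gap is exactly `(x - y)² / 4`. For `r > 1/2`, Lyapunov with `θ = 2r -
1` bounds the power mean by a geometric mean of `A` and `B`, and weighted AM-GM leaves the gap `(1 -
r) / r` times `(x - y)² / 4`. -/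
theorem powMean_real_le {r x y : ℝ} (h0 : 0 < r) (h1 : r < 1) (hx : 0 ≤ x) (hy : 0 ≤ y) :
    ((x ^ (2 * r) + y ^ (2 * r)) / 2) ^ (1 / r) + (1 - r) / 4 * (x - y) ^ 2 ≤
      (x ^ 2 + y ^ 2) / 2 := by
  have hid : ((x + y) / 2) ^ 2 + 1 / 4 * (x - y) ^ 2 = (x ^ 2 + y ^ 2) / 2 := by ring
  rcases le_or_gt r (1 / 2) with h | h
  · have := powMean_real_le_of_le_half h0 h hx hy
    nlinarith [sq_nonneg (x - y)]
  · have hθ := add_rpow_le_rpow_mul_rpow (θ := 2 * r - 1) (by linarith) (by linarith) hx hy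
    set A := (x ^ 2 + y ^ 2) / 2 with hA
    set B := ((x + y) / 2) ^ 2 with hB
    have hA0 : 0 ≤ A := by positivity
    have hB0 : 0 ≤ B := by positivity
    have h3 : ((x ^ (2 * r) + y ^ (2 * r)) / 2) ^ (1 / r) ≤
        A ^ ((2 * r - 1) / r) * B ^ ((1 - r) / r) := by
      have e : (x ^ (2 * r) + y ^ (2 * r)) / 2 ≤ A ^ (2 * r - 1) * ((x + y) / 2) ^ (2 * (1 - r)) := by
        convert hθ using 3 <;> ring_nf
      refine (Real.rpow_le_rpow (by positivity) e (by positivity)).trans (le_of_eq ?_)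
      rw [Real.mul_rpow (by positivity) (by positivity), ← Real.rpow_mul hA0, Real.rpow_mul
        (by positivity : 0 ≤ (x + y) / 2), ← Real.rpow_mul (by positivity), Real.rpow_two,
        mul_one_div, mul_one_div]
    have h4 := Real.geom_mean_le_arith_mean2_weighted (w₁ := (2 * r - 1) / r)
      (w₂ := (1 - r) / r) (by apply div_nonneg <;> linarith) (by apply div_nonneg <;> linarith)
      hA0 hB0 (by field_simp; ring)
    have h5 : B = A - 1 / 4 * (x - y) ^ 2 := by linarith
    have h6 : (2 * r - 1) / r * A + (1 - r) / r * B = A - (1 - r) / r * (1 / 4 * (x - y) ^ 2) := by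
      rw [h5]; field_simp; ring
    have h7 : 1 - r ≤ (1 - r) / r := by
      rw [le_div_iff₀ h0]; nlinarith
    nlinarith [sq_nonneg (x - y)]

theorem powMean_add_le {r : ℝ} (h0 : 0 < r) (h1 : r < 1) {a b : ℝ≥0∞} (ha : a ≠ ∞) (hb : b ≠ ∞) :
    powMean r a b + ENNReal.ofReal ((1 - r) / 4) *
      ENNReal.ofReal ((√a.toReal - √b.toReal) ^ 2) ≤ (a + b) / 2 := by
  have key := powMean_real_le h0 h1 (Real.sqrt_nonneg a.toReal) (Real.sqrt_nonneg b.toReal)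
  have e : ∀ c : ℝ≥0∞, √c.toReal ^ (2 * r) = c.toReal ^ r := by
    intro c
    rw [Real.rpow_mul (Real.sqrt_nonneg _), Real.rpow_two, Real.sq_sqrt ENNReal.toReal_nonneg]
  rw [e, e, Real.sq_sqrt ENNReal.toReal_nonneg, Real.sq_sqrt ENNReal.toReal_nonneg] at key
  have h := ENNReal.ofReal_le_ofReal key
  have hr : (0:ℝ) ≤ (1 - r) / 4 := by linarith
  rw [ENNReal.ofReal_add (by positivity) (by positivity), ENNReal.ofReal_mul hr,
    ← ENNReal.ofReal_rpow_of_nonneg (by positivity) (by positivity),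
    ENNReal.ofReal_div_of_pos (y := 2) (by norm_num),
    ENNReal.ofReal_div_of_pos (y := 2) (by norm_num),
    ENNReal.ofReal_add (by positivity) (by positivity),
    ENNReal.ofReal_add (by positivity) (by positivity),
    ← ENNReal.ofReal_rpow_of_nonneg (by positivity) h0.le,
    ← ENNReal.ofReal_rpow_of_nonneg (by positivity) h0.le,
    ENNReal.ofReal_toReal ha, ENNReal.ofReal_toReal hb] at h
  simpa [powMean] using h

variable {Y : Type*} [MeasurableSpace Y] {ν : Measure Y}

theorem lintegral_powMean_add_le {r : ℝ} (h0 : 0 < r) (h1 : r < 1) {q q' : Y → ℝ≥0∞}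
    (hq : Measurable q) (hq' : Measurable q') (hq1 : ∫⁻ y, q y ∂ν = 1)
    (hq1' : ∫⁻ y, q' y ∂ν = 1) :
    ∫⁻ y, powMean r (q y) (q' y) ∂ν + ENNReal.ofReal ((1 - r) / 4) *
      ∫⁻ y, ENNReal.ofReal ((√(q y).toReal - √(q' y).toReal) ^ 2) ∂ν ≤ 1 := by
  rw [← lintegral_const_mul _ (by fun_prop), ← lintegral_add_left (by fun_prop)]
  calc _ ≤ ∫⁻ y, (q y + q' y) / 2 ∂ν := by
        refine lintegral_mono_ae ?_
        filter_upwards [ae_lt_top hq (by simp [hq1]), ae_lt_top hq' (by simp [hq1'])] with y a b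
        exact powMean_add_le h0 h1 a.ne b.ne
    _ = 1 := by
        simp_rw [div_eq_mul_inv]
        rw [lintegral_mul_const' _ _ (by simp), lintegral_add_left hq, hq1, hq1',
          one_add_one_eq_two, ENNReal.mul_inv_cancel (by simp) (by simp)]

/-- Factor the difference as (√q - √q')(√q + √q') and apply Cauchy–Schwarz; the second factor has
squared norm at most 4. -/
theorem densDist_le_rpow {q q' : Y → ℝ≥0∞}
    (hq : Measurable q) (hq' : Measurable q') (hq1 : ∫⁻ y, q y ∂ν = 1)
    (hq1' : ∫⁻ y, q' y ∂ν = 1) :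
    densDist ν q q' ≤
      2 * (∫⁻ y, ENNReal.ofReal ((√(q y).toReal - √(q' y).toReal) ^ 2) ∂ν) ^ (1 / 2 : ℝ) := by
  have hsum : ∫⁻ y, ENNReal.ofReal ((√(q y).toReal + √(q' y).toReal) ^ 2) ∂ν ≤ 4 := by
    calc _ ≤ ∫⁻ y, 2 * (q y + q' y) ∂ν := by
          refine lintegral_mono_ae ?_
          filter_upwards [ae_lt_top hq (by simp [hq1]), ae_lt_top hq' (by simp [hq1'])] with y a b
          have : (√(q y).toReal + √(q' y).toReal) ^ 2 ≤ 2 * ((q y).toReal + (q' y).toReal) := by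
            nlinarith [sq_nonneg (√(q y).toReal - √(q' y).toReal),
              Real.sq_sqrt (ENNReal.toReal_nonneg (a := q y)),
              Real.sq_sqrt (ENNReal.toReal_nonneg (a := q' y))]
          refine (ENNReal.ofReal_le_ofReal this).trans (le_of_eq ?_)
          rw [ENNReal.ofReal_mul (by norm_num), ENNReal.ofReal_add (by positivity) (by positivity),
            ENNReal.ofReal_toReal a.ne, ENNReal.ofReal_toReal b.ne]
          simp
      _ = 4 := by
          rw [lintegral_const_mul _ (by fun_prop), lintegral_add_left hq, hq1, hq1']
          norm_num
  have h := ENNReal.lintegral_mul_norm_pow_le (μ := ν)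
    (f := fun y => ENNReal.ofReal ((√(q y).toReal - √(q' y).toReal) ^ 2))
    (g := fun y => ENNReal.ofReal ((√(q y).toReal + √(q' y).toReal) ^ 2))
    (p := 1 / 2) (q := 1 / 2) (by fun_prop) (by fun_prop) (by norm_num) (by norm_num) (by norm_num)
  calc densDist ν q q' = ∫⁻ y, ENNReal.ofReal ((√(q y).toReal - √(q' y).toReal) ^ 2) ^ (1 / 2 : ℝ) *
        ENNReal.ofReal ((√(q y).toReal + √(q' y).toReal) ^ 2) ^ (1 / 2 : ℝ) ∂ν := by
        refine lintegral_congr fun y => ?_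
        rw [ENNReal.ofReal_rpow_of_nonneg (by positivity) (by norm_num),
          ENNReal.ofReal_rpow_of_nonneg (by positivity) (by norm_num), ← Real.sqrt_eq_rpow,
          ← Real.sqrt_eq_rpow, Real.sqrt_sq_eq_abs, Real.sqrt_sq_eq_abs,
          ← ENNReal.ofReal_mul (by positivity), ← abs_mul, Real.enorm_eq_ofReal_abs]
        congr 2
        nlinarith [Real.sq_sqrt (ENNReal.toReal_nonneg (a := q y)),
              Real.sq_sqrt (ENNReal.toReal_nonneg (a := q' y))]
    _ ≤ _ := h
    _ ≤ _ := by
        rw [mul_comm]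
        gcongr
        calc _ ≤ (4 : ℝ≥0∞) ^ (1 / 2 : ℝ) := ENNReal.rpow_le_rpow hsum (by norm_num)
          _ = 2 := by
            rw [show (4 : ℝ≥0∞) = 2 ^ (2 : ℝ) by norm_num, ← ENNReal.rpow_mul]
            norm_num

/-- Two probability densities whose power mean has almost full mass are close in `L¹`. -/
theorem densDist_le_of_le_lintegral_powMean {α δ : ℝ} (h0 : 0 < α) (h1 : α < 1)
    {q q' : Y → ℝ≥0∞} (hq : Measurable q) (hq' : Measurable q') (hq1 : ∫⁻ y, q y ∂ν = 1)
    (hq1' : ∫⁻ y, q' y ∂ν = 1)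
    (h : ENNReal.ofReal (1 - δ) ≤ ∫⁻ y, powMean (1 - α) (q y) (q' y) ∂ν) :
    densDist ν q q' ≤ ENNReal.ofReal (4 * √(δ / α)) := by
  have h2 := lintegral_powMean_add_le (r := 1 - α) (by linarith) (by linarith) hq hq' hq1 hq1'
  have h3 := densDist_le_rpow hq hq' hq1 hq1'
  set I := ∫⁻ y, ENNReal.ofReal ((√(q y).toReal - √(q' y).toReal) ^ 2) ∂ν
  set Z := ∫⁻ y, powMean (1 - α) (q y) (q' y) ∂ν
  rw [sub_sub_cancel] at h2
  have hItop : I ≠ ∞ := by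
    intro hI
    rw [hI, ENNReal.mul_top (by simpa using by positivity)] at h2
    simp at h2
  have hZ1 : Z ≤ 1 := le_self_add.trans h2
  have hZtop : Z ≠ ∞ := ne_top_of_le_ne_top (by simp) hZ1
  have hr : I.toReal ≤ 4 * δ / α := by
    have a1 := ENNReal.toReal_mono (by simp) h2
    rw [ENNReal.toReal_add hZtop (ENNReal.mul_ne_top (by simp) hItop), ENNReal.toReal_mul,
      ENNReal.toReal_ofReal (by positivity), ENNReal.toReal_one] at a1
    have a2 : 1 - δ ≤ Z.toReal := (ENNReal.ofReal_le_iff_le_toReal hZtop).1 h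
    rw [le_div_iff₀ h0]
    nlinarith
  refine h3.trans ?_
  rw [← ENNReal.ofReal_toReal hItop, ENNReal.ofReal_rpow_of_nonneg (by positivity) (by norm_num),
    ← Real.sqrt_eq_rpow, show (2 : ℝ≥0∞) = ENNReal.ofReal 2 by simp,
    ← ENNReal.ofReal_mul (by norm_num)]
  refine ENNReal.ofReal_le_ofReal ?_
  calc 2 * √I.toReal ≤ 2 * √(4 * δ / α) := by gcongr
    _ = 4 * √(δ / α) := by
      rw [mul_div_assoc, Real.sqrt_mul (by norm_num), show (4 : ℝ) = 2 ^ 2 by norm_num,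
        Real.sqrt_sq (by norm_num)]
      ring

end PowerMean

/-! ### Rényi divergences of order below one -/

section RenyiDivergence

variable {Y : Type*} [MeasurableSpace Y]

theorem renyiDiv_eq_coe {α : ℝ} (h1 : α < 1) {P Q : Measure Y}
    (h : hellingerIntegral α P Q ≠ 0) (h' : hellingerIntegral α P Q ≠ ∞) :
    renyiDiv α P Q = ((-Real.log (hellingerIntegral α P Q).toReal / (1 - α) : ℝ) : EReal) := by
  rw [renyiDiv, if_neg h1.ne, ENNReal.log_pos_real h h', ← EReal.coe_mul, EReal.coe_eq_coe_iff]
  have : α - 1 ≠ 0 := by linarith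
  have : 1 - α ≠ 0 := by linarith
  field_simp
  ring

theorem renyiDiv_eq_top {α : ℝ} (h1 : α < 1) {P Q : Measure Y}
    (h : hellingerIntegral α P Q = 0) : renyiDiv α P Q = ⊤ := by
  rw [renyiDiv, if_neg h1.ne, h, ENNReal.log_zero, EReal.coe_mul_bot_of_neg]
  exact inv_lt_zero.2 (by linarith)

/-- Replaces an extended-real bound by a lower bound on the Hellinger integral, with the infinite
divergence included. Levels of densities are expressed in this form from here on. -/
theorem renyiDiv_le_iff {α c : ℝ} (h1 : α < 1) {P Q : Measure Y}
    (h' : hellingerIntegral α P Q ≠ ∞) :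
    renyiDiv α P Q ≤ (c : EReal) ↔
      ENNReal.ofReal (Real.exp (-((1 - α) * c))) ≤ hellingerIntegral α P Q := by
  by_cases h : hellingerIntegral α P Q = 0
  · simp [renyiDiv_eq_top h1 h, h, Real.exp_pos]
  · rw [renyiDiv_eq_coe h1 h h', EReal.coe_le_coe_iff, ENNReal.ofReal_le_iff_le_toReal h',
      div_le_iff₀ (by linarith), ← Real.le_log_iff_exp_le (ENNReal.toReal_pos h h')]
    constructor <;> intro <;> linarith

theorem hellingerIntegral_le_one {α : ℝ} (h0 : 0 ≤ α) (h1 : α ≤ 1) (P Q : Measure Y)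
    [IsProbabilityMeasure P] [IsProbabilityMeasure Q] : hellingerIntegral α P Q ≤ 1 :=
  hell_le_one h0 h1 (Measure.measurable_rnDeriv _ _) (Measure.measurable_rnDeriv _ _)
    ((Measure.lintegral_rnDeriv_le).trans (by simp)) ((Measure.lintegral_rnDeriv_le).trans (by simp))

theorem renyiDiv_nonneg {α : ℝ} (h0 : 0 ≤ α) (h1 : α < 1) (P Q : Measure Y)
    [IsProbabilityMeasure P] [IsProbabilityMeasure Q] : 0 ≤ renyiDiv α P Q := by
  have hle := hellingerIntegral_le_one h0 h1.le P Q
  by_cases h : hellingerIntegral α P Q = 0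
  · simp [renyiDiv_eq_top h1 h]
  · rw [renyiDiv_eq_coe h1 h (ne_top_of_le_ne_top (by simp) hle), ← EReal.coe_zero,
      EReal.coe_le_coe_iff]
    have : Real.log (hellingerIntegral α P Q).toReal ≤ 0 :=
      Real.log_nonpos (by positivity) (ENNReal.toReal_mono (by simp) hle)
    apply div_nonneg <;> linarith

end RenyiDivergence

/-! ### Elementary bounds on the capacity and the center -/

section Capacity

theorem EReal.coe_finsetSum {ι : Type*} (s : Finset ι) (f : ι → ℝ) :
    ((∑ i ∈ s, f i : ℝ) : EReal) = ∑ i ∈ s, (f i : EReal) :=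
  map_sum (⟨⟨Real.toEReal, EReal.coe_zero⟩, EReal.coe_add⟩ : ℝ →+ EReal) f s

variable {X Y : Type*} [MeasurableSpace Y] {W : X → ProbabilityMeasure Y}

theorem condRenyiDiv_le {α c : ℝ} {Q : Measure Y} {p : Convexity.StdSimplex ℝ X}
    (h : ∀ x ∈ p.weights.support, renyiDiv α (W x : Measure Y) Q ≤ (c : EReal)) :
    condRenyiDiv α W Q p ≤ (c : EReal) := by
  calc condRenyiDiv α W Q p ≤ ∑ x ∈ p.weights.support, ((p.weights x * c : ℝ) : EReal) := by
        refine Finset.sum_le_sum fun x hx => ?_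
        rw [EReal.coe_mul]
        exact mul_le_mul_of_nonneg_left (h x hx) (by exact_mod_cast p.weights_nonneg x)
    _ = ((∑ x ∈ p.weights.support, p.weights x * c : ℝ) : EReal) := by
        rw [EReal.coe_finsetSum]
    _ = c := by
        rw [← Finset.sum_mul]
        have := p.total
        rw [Finsupp.sum] at this
        rw [this, one_mul]

theorem renyiDiv_le_iSup_condRenyiDiv (α : ℝ) (Q : Measure Y) (x : X) :
    renyiDiv α (W x : Measure Y) Q ≤ ⨆ p, condRenyiDiv α W Q p := by
  refine le_trans (le_of_eq ?_) (le_iSup _ (Convexity.StdSimplex.single x))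
  have : (Convexity.StdSimplex.single x : Convexity.StdSimplex ℝ X).weights.support = {x} := by
    simp [Convexity.StdSimplex.single]
  rw [condRenyiDiv, this]
  simp [Convexity.StdSimplex.single]

theorem augustinCapacity_le_iSup_condRenyiDiv (α : ℝ) (Q : ProbabilityMeasure Y) :
    augustinCapacity α W ≤ ⨆ p, condRenyiDiv α W (Q : Measure Y) p :=
  iSup_mono fun _ => iInf_le _ Q

theorem augustinCapacity_le {α c : ℝ} (Q : ProbabilityMeasure Y)
    (h : ∀ x, renyiDiv α (W x : Measure Y) (Q : Measure Y) ≤ (c : EReal)) :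
    augustinCapacity α W ≤ (c : EReal) :=
  (augustinCapacity_le_iSup_condRenyiDiv α Q).trans (iSup_le fun _ => condRenyiDiv_le fun x _ => h x)

theorem IsAugustinCenter.renyiDiv_le {α : ℝ} {q : ProbabilityMeasure Y}
    (h : IsAugustinCenter α W q) (x : X) :
    renyiDiv α (W x : Measure Y) (q : Measure Y) ≤ augustinCapacity α W :=
  h.2 ▸ renyiDiv_le_iSup_condRenyiDiv α _ x

theorem isAugustinCenter_of_renyiDiv_le {α c : ℝ} {q : ProbabilityMeasure Y}
    (hc : augustinCapacity α W = (c : EReal))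
    (h : ∀ x, renyiDiv α (W x : Measure Y) (q : Measure Y) ≤ (c : EReal)) :
    IsAugustinCenter α W q :=
  ⟨hc ▸ EReal.coe_lt_top c, le_antisymm (augustinCapacity_le_iSup_condRenyiDiv α q)
    (hc ▸ iSup_le fun _ => condRenyiDiv_le fun x _ => h x)⟩

theorem condRenyiDiv_nonneg {α : ℝ} {Q : Measure Y} (p : Convexity.StdSimplex ℝ X)
    (h : ∀ x, 0 ≤ renyiDiv α (W x : Measure Y) Q) :
    0 ≤ condRenyiDiv α W Q p :=
  Finset.sum_nonneg fun x _ => mul_nonneg (by exact_mod_cast p.weights_nonneg x) (h x)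

theorem augustinCapacity_nonneg [Nonempty X] {α : ℝ} (h0 : 0 ≤ α) (h1 : α < 1) :
    0 ≤ augustinCapacity α W := by
  obtain ⟨x⟩ := ‹Nonempty X›
  exact le_iSup_of_le (Convexity.StdSimplex.single x) (le_iInf fun Q =>
    condRenyiDiv_nonneg _ fun x => renyiDiv_nonneg h0 h1 _ _)

/-- If the conditional divergence is small then so is each divergence on the support. -/
theorem renyiDiv_lt_top_of_condRenyiDiv_lt_top {α : ℝ} {Q : Measure Y}
    {p : Convexity.StdSimplex ℝ X} (h : ∀ x, 0 ≤ renyiDiv α (W x : Measure Y) Q)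
    (hp : condRenyiDiv α W Q p < ⊤) {x : X} (hx : x ∈ p.weights.support) :
    renyiDiv α (W x : Measure Y) Q < ⊤ := by
  by_contra hcon
  rw [not_lt_top_iff] at hcon
  have hle : ((p.weights x : ℝ) : EReal) * renyiDiv α (W x : Measure Y) Q ≤ condRenyiDiv α W Q p :=
    Finset.single_le_sum (f := fun x => ((p.weights x : ℝ) : EReal) * renyiDiv α (W x : Measure Y) Q)
      (fun x _ => mul_nonneg (by exact_mod_cast p.weights_nonneg x) (h x)) hx
  have hpos : 0 < p.weights x := lt_of_le_of_ne (p.weights_nonneg x) (Ne.symm (by simpa using hx))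
  rw [hcon, EReal.coe_mul_top_of_pos hpos] at hle
  exact absurd hp (not_lt.2 hle)

end Capacity

/-! ### Probability densities and the finite minimax alternative -/

section ProbDensity

variable {Y : Type*} [MeasurableSpace Y] {ν : Measure Y}

/-- `q` is the density of a probability measure with respect to `ν`. -/
def IsProbDensity (ν : Measure Y) (q : Y → ℝ≥0∞) : Prop :=
  Measurable q ∧ ∫⁻ y, q y ∂ν = 1

namespace IsProbDensity

variable {q q' : Y → ℝ≥0∞}

theorem isProbabilityMeasure (h : IsProbDensity ν q) : IsProbabilityMeasure (ν.withDensity q) :=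
  ⟨by rw [withDensity_apply _ MeasurableSet.univ, Measure.restrict_univ, h.2]⟩

theorem lintegral_ne_top (h : IsProbDensity ν q) : ∫⁻ y, q y ∂ν ≠ ∞ := by simp [h.2]

theorem rnDeriv {P : Measure Y} [IsProbabilityMeasure P] [SigmaFinite ν] (h : P ≪ ν) :
    IsProbDensity ν (P.rnDeriv ν) :=
  ⟨Measure.measurable_rnDeriv _ _, by rw [Measure.lintegral_rnDeriv h]; simp⟩

theorem mix (h : IsProbDensity ν q) (h' : IsProbDensity ν q') {c d : ℝ≥0∞} (hcd : c + d = 1) :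
    IsProbDensity ν fun y => c * q y + d * q' y := by
  refine ⟨(h.1.const_mul c).add (h'.1.const_mul d), ?_⟩
  rw [lintegral_add_left (h.1.const_mul c), lintegral_const_mul _ h.1, lintegral_const_mul _ h'.1,
    h.2, h'.2, mul_one, mul_one, hcd]

theorem hell_le_one {α : ℝ} (h0 : 0 ≤ α) (h1 : α ≤ 1) (h : IsProbDensity ν q)
    (h' : IsProbDensity ν q') : hell ν α q q' ≤ 1 :=
  _root_.hell_le_one h0 h1 h.1 h'.1 h.2.le h'.2.le

theorem hell_ne_top {α : ℝ} (h0 : 0 ≤ α) (h1 : α ≤ 1) (h : IsProbDensity ν q)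
    (h' : IsProbDensity ν q') : hell ν α q q' ≠ ∞ :=
  ne_top_of_le_ne_top (by simp) (h.hell_le_one h0 h1 h')

theorem hell_self {α : ℝ} (h0 : 0 ≤ α) (h1 : α ≤ 1) (h : IsProbDensity ν q) :
    hell ν α q q = 1 := by
  rw [hell, ← h.2]
  refine lintegral_congr fun y => ?_
  rw [← ENNReal.rpow_add_of_nonneg _ _ h0 (by linarith)]
  simp

end IsProbDensity

theorem exists_isProbDensity_ge [IsProbabilityMeasure ν] {q : Y → ℝ≥0∞} (hq : Measurable q)
    (hq1 : ∫⁻ y, q y ∂ν ≤ 1) : ∃ q', IsProbDensity ν q' ∧ ∀ y, q y ≤ q' y := by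
  refine ⟨fun y => q y + (1 - ∫⁻ y, q y ∂ν), ⟨hq.add_const _, ?_⟩, fun y => le_self_add⟩
  rw [lintegral_add_left hq, lintegral_const, measure_univ, mul_one, add_tsub_cancel_of_le hq1]

theorem exists_isProbDensity_hell_pos [IsProbabilityMeasure ν] {ι : Type*} [Fintype ι] [Nonempty ι]
    {α : ℝ} (h0 : 0 ≤ α) (h1 : α ≤ 1) {w : ι → Y → ℝ≥0∞} (hw : ∀ i, IsProbDensity ν (w i)) :
    ∃ q, IsProbDensity ν q ∧ ∀ i, hell ν α (w i) q ≠ 0 := by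
  have hn : (Fintype.card ι : ℝ≥0∞) ≠ 0 := by simp
  refine ⟨fun y => (Fintype.card ι : ℝ≥0∞)⁻¹ * ∑ i, w i y,
    ⟨(Finset.measurable_fun_sum _ fun i _ => (hw i).1).const_mul _, ?_⟩, fun i => ?_⟩
  · rw [lintegral_const_mul _ (Finset.measurable_fun_sum _ fun i _ => (hw i).1),
      lintegral_finsetSum _ fun i _ => (hw i).1]
    simp only [(hw _).2, Finset.sum_const, Finset.card_univ, nsmul_eq_mul, mul_one]
    exact ENNReal.inv_mul_cancel hn (by simp)
  · have hle : hell ν α (w i) (fun y => (Fintype.card ι : ℝ≥0∞)⁻¹ * w i y) ≤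
        hell ν α (w i) (fun y => (Fintype.card ι : ℝ≥0∞)⁻¹ * ∑ i, w i y) :=
      hell_mono h1 _ fun y => mul_le_mul' le_rfl
        (Finset.single_le_sum (f := fun i => w i y) (fun _ _ => zero_le) (Finset.mem_univ i))
    rw [hell_smul_right h1 (hw i).1 (hw i).1, (hw i).hell_self h0 h1, mul_one] at hle
    refine (lt_of_lt_of_le ?_ hle).ne'
    exact ENNReal.rpow_pos (by simp) (by simp)

/-- Minimax by separation. Let `T` be the vectors lying strictly below some vector of log-Hellinger
integrals. It is open, and convex because the Hellinger integral is concave in the density and exp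
is convex. If the constant vector `a` is outside `T`, a separating functional has nonnegative
coefficients, and normalizing them gives the weights. -/
theorem exists_isProbDensity_or_weights [IsProbabilityMeasure ν] {ι : Type*} [Fintype ι] [Nonempty ι]
    {α : ℝ} (h0 : 0 ≤ α) (h1 : α < 1) {w : ι → Y → ℝ≥0∞} (hw : ∀ i, IsProbDensity ν (w i)) (a : ℝ) :
    (∃ q, IsProbDensity ν q ∧ ∀ i, ENNReal.ofReal (Real.exp a) < hell ν α (w i) q) ∨
    ∃ p : ι → ℝ, (∀ i, 0 ≤ p i) ∧ ∑ i, p i = 1 ∧ ∀ q, IsProbDensity ν q →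
      (∀ i, p i ≠ 0 → hell ν α (w i) q ≠ 0) →
      ∑ i, p i * Real.log (hell ν α (w i) q).toReal ≤ a := by
  classical
  let T : Set (ι → ℝ) := {v | ∃ q, IsProbDensity ν q ∧
    ∀ i, ENNReal.ofReal (Real.exp (v i)) < hell ν α (w i) q}
  have hTopen : IsOpen T := by
    have : T = ⋃ (q) (_ : IsProbDensity ν q), ⋂ i,
        {v : ι → ℝ | ENNReal.ofReal (Real.exp (v i)) < hell ν α (w i) q} := by
      ext v; simp [T]
    rw [this]
    refine isOpen_iUnion fun q => isOpen_iUnion fun _ => isOpen_iInter_of_finite fun i => ?_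
    exact isOpen_lt (ENNReal.continuous_ofReal.comp (by fun_prop)) continuous_const
  have hTconv : Convex ℝ T := by
    rintro v ⟨q, hq, hv⟩ v' ⟨q', hq', hv'⟩ b d hb hd hbd
    have hbd' : ENNReal.ofReal b + ENNReal.ofReal d = 1 := by
      rw [← ENNReal.ofReal_add hb hd, hbd, ENNReal.ofReal_one]
    refine ⟨_, hq.mix hq' hbd', fun i => ?_⟩
    refine lt_of_lt_of_le ?_ (hell_concave h0 h1 hbd' (hw i).1 hq.1 hq'.1)
    have hc := convexOn_exp.2 (mem_univ (v i)) (mem_univ (v' i)) hb hd hbd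
    refine (ENNReal.ofReal_le_ofReal hc).trans_lt ?_
    simp only [smul_eq_mul]
    rw [ENNReal.ofReal_add (by positivity) (by positivity), ENNReal.ofReal_mul hb,
      ENNReal.ofReal_mul hd]
    rcases hb.eq_or_lt with rfl | hb'
    · have : d = 1 := by linarith
      subst this
      simpa using hv' i
    · refine ENNReal.add_lt_add_of_lt_of_le (ENNReal.mul_ne_top (by simp) (by simp)) ?_ ?_
      · exact ENNReal.mul_lt_mul_right (by simpa using hb') (by simp) (hv i)
      · exact mul_le_mul' le_rfl (hv' i).le
  have hmem : ∀ q, IsProbDensity ν q → (∀ i, hell ν α (w i) q ≠ 0) → ∀ η : ℝ, 0 < η →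
      (fun i => Real.log (hell ν α (w i) q).toReal - η) ∈ T := by
    intro q hq hpos η hη
    refine ⟨q, hq, fun i => ?_⟩
    have hfin := (hw i).hell_ne_top h0 h1.le hq
    have htr := ENNReal.toReal_pos (hpos i) hfin
    rw [ENNReal.ofReal_lt_iff_lt_toReal (Real.exp_pos _).le hfin, Real.exp_sub, Real.exp_log htr]
    exact div_lt_self htr (Real.one_lt_exp_iff.2 hη)
  by_cases hmemT : (fun _ => a : ι → ℝ) ∈ T
  · exact Or.inl hmemT
  right
  obtain ⟨f, hf⟩ := geometric_hahn_banach_open_point hTconv hTopen hmemT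
  obtain ⟨q₀, hq₀, hpos₀⟩ := exists_isProbDensity_hell_pos h0 h1.le hw
  have hfsum : ∀ v : ι → ℝ, f v = ∑ i, v i * f (Pi.single i 1) := by
    intro v
    conv_lhs => rw [pi_eq_sum_univ' v]
    simp [map_sum]
  -- `T` is closed under decreasing a coordinate, so a negative coefficient would make `f` unbounded
  -- above on `T`. The value of `t` used below is the one at which `f` would reach `f a`.
  have hnn : ∀ i, 0 ≤ f (Pi.single i 1) := by
    intro i
    by_contra! hneg
    obtain ⟨q₁, hq₁, hv₁⟩ := hmem q₀ hq₀ hpos₀ 1 one_pos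
    set v₁ : ι → ℝ := fun i => Real.log (hell ν α (w i) q₀).toReal - 1
    have hT : ∀ t : ℝ, 0 ≤ t → v₁ - t • Pi.single i 1 ∈ T := by
      intro t ht
      refine ⟨q₁, hq₁, fun j => lt_of_le_of_lt ?_ (hv₁ j)⟩
      gcongr
      simp only [Pi.sub_apply, Pi.smul_apply, smul_eq_mul]
      have : (0:ℝ) ≤ (Pi.single i 1 : ι → ℝ) j := by
        by_cases hij : j = i
        · subst hij; simp
        · simp [hij]
      nlinarith
    have h2 : ∀ t : ℝ, 0 ≤ t → f v₁ - t * f (Pi.single i 1) < f fun _ => a := by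
      intro t ht
      have := hf _ (hT t ht)
      rwa [map_sub, map_smul, smul_eq_mul] at this
    have hA := h2 0 le_rfl
    have h3 := h2 ((f (fun _ => a) - f v₁) / -f (Pi.single i 1))
      (div_nonneg (by linarith) (by linarith))
    have : (f (fun _ => a) - f v₁) / -f (Pi.single i 1) * f (Pi.single i 1) =
      -(f (fun _ => a) - f v₁) := by
      rw [div_neg, neg_mul, div_mul_cancel₀ _ hneg.ne]
    linarith
  set S := ∑ i, f (Pi.single i 1) with hS
  have hSpos : 0 < S := by
    refine lt_of_le_of_ne (Finset.sum_nonneg fun i _ => hnn i) fun h => ?_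
    have hz := (Finset.sum_eq_zero_iff_of_nonneg fun i _ => hnn i).1 h.symm
    have := hf _ (hmem q₀ hq₀ hpos₀ 1 one_pos)
    rw [hfsum, hfsum fun _ => a, Finset.sum_eq_zero, Finset.sum_eq_zero] at this
    · exact lt_irrefl _ this
    · intro i hi; simp [hz i hi]
    · intro i hi; simp [hz i hi]
  refine ⟨fun i => f (Pi.single i 1) / S, fun i => div_nonneg (hnn i) hSpos.le, ?_, ?_⟩
  · rw [← Finset.sum_div, div_self hSpos.ne']
  intro q hq hpos
  -- At indices of weight zero the Hellinger integral of `q` may vanish. Mixing in a fraction `δ` of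
  -- `q₀` makes every coordinate positive and costs at most `log (1 - δ)`.
  have step : ∀ δ : ℝ, 0 < δ → δ < 1 →
      ∑ i, f (Pi.single i 1) / S * Real.log (hell ν α (w i) q).toReal ≤ a - Real.log (1 - δ) := by
    intro δ hδ hδ1
    have hcd : ENNReal.ofReal (1 - δ) + ENNReal.ofReal δ = 1 := by
      rw [← ENNReal.ofReal_add (by linarith) hδ.le]; simp
    set u := fun y => ENNReal.ofReal (1 - δ) * q y + ENNReal.ofReal δ * q₀ y with hu
    have hud : IsProbDensity ν u := hq.mix hq₀ hcd
    have hconc := fun i => hell_concave (ν := ν) h0 h1 hcd (hw i).1 hq.1 hq₀.1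
    have hupos : ∀ i, hell ν α (w i) u ≠ 0 := by
      intro i hi
      have h4 := (hconc i).trans hi.le
      simp only [nonpos_iff_eq_zero, add_eq_zero, mul_eq_zero, ENNReal.ofReal_eq_zero] at h4
      rcases h4.2 with h5 | h5
      · linarith
      · exact hpos₀ i h5
    have h6 : ∀ η : ℝ, 0 < η →
        ∑ i, f (Pi.single i 1) / S * Real.log (hell ν α (w i) u).toReal ≤ a + η := by
      intro η hη
      have h7 := hf _ (hmem u hud hupos η hη)
      rw [hfsum, hfsum fun _ => a, ← Finset.mul_sum, ← hS] at h7
      have h8 : ∑ i, (Real.log (hell ν α (w i) u).toReal - η) * f (Pi.single i 1) =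
          S * ∑ i, f (Pi.single i 1) / S * Real.log (hell ν α (w i) u).toReal - η * S := by
        rw [Finset.mul_sum, hS, Finset.mul_sum, ← Finset.sum_sub_distrib]
        refine Finset.sum_congr rfl fun i _ => ?_
        rw [← hS]
        field_simp
      rw [h8] at h7
      nlinarith
    have h9 : ∑ i, f (Pi.single i 1) / S * (Real.log (hell ν α (w i) q).toReal + Real.log (1 - δ)) ≤
        ∑ i, f (Pi.single i 1) / S * Real.log (hell ν α (w i) u).toReal := by
      refine Finset.sum_le_sum fun i _ => ?_
      by_cases hp : f (Pi.single i 1) / S = 0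
      · simp [hp]
      have hqi := hpos i hp
      have htr := ENNReal.toReal_pos hqi ((hw i).hell_ne_top h0 h1.le hq)
      refine mul_le_mul_of_nonneg_left ?_ (div_nonneg (hnn i) hSpos.le)
      rw [← Real.log_mul htr.ne' (by linarith)]
      refine Real.log_le_log (mul_pos htr (by linarith)) ?_
      have h10 := ENNReal.toReal_mono ((hw i).hell_ne_top h0 h1.le hud) (le_self_add.trans (hconc i))
      rw [ENNReal.toReal_mul, ENNReal.toReal_ofReal (by linarith)] at h10
      linarith
    have h11 : ∑ i, f (Pi.single i 1) / S * (Real.log (hell ν α (w i) q).toReal + Real.log (1 - δ)) =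
        ∑ i, f (Pi.single i 1) / S * Real.log (hell ν α (w i) q).toReal + Real.log (1 - δ) := by
      simp_rw [mul_add]
      rw [Finset.sum_add_distrib, ← Finset.sum_mul, ← Finset.sum_div, div_self hSpos.ne', one_mul]
    have h12 := le_of_forall_pos_le_add h6
    linarith
  have hlim : Tendsto (fun δ : ℝ => a - Real.log (1 - δ)) (𝓝[>] 0) (𝓝 a) := by
    have hc : ContinuousAt (fun δ : ℝ => a - Real.log (1 - δ)) 0 := by
      refine continuousAt_const.sub (ContinuousAt.log (by fun_prop) (by norm_num))
    have := hc.tendsto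
    simp only [sub_zero, Real.log_one] at this
    exact this.mono_left nhdsWithin_le_nhds
  refine ge_of_tendsto hlim ?_
  filter_upwards [Ioo_mem_nhdsGT (show (0:ℝ) < 1 by norm_num)] with δ hδ using step δ hδ.1 hδ.2

end ProbDensity

/-! ### L¹ limits and closeness of nearly optimal densities -/

section L1Limits

variable {Y : Type*} [MeasurableSpace Y] {ν : Measure Y}

theorem densDist_triangle {q q' q'' : Y → ℝ≥0∞} (hq : Measurable q) (hq' : Measurable q') :
    densDist ν q q'' ≤ densDist ν q q' + densDist ν q' q'' := by
  rw [densDist, densDist, densDist, ← lintegral_add_left (by fun_prop)]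
  refine lintegral_mono fun y => ?_
  calc _ = ‖((q y).toReal - (q' y).toReal) + ((q' y).toReal - (q'' y).toReal)‖ₑ := by
        rw [sub_add_sub_cancel]
    _ ≤ _ := enorm_add_le _ _

theorem lintegral_le_add_densDist {q q' : Y → ℝ≥0∞} (hq : ∀ᵐ y ∂ν, q y ≠ ∞)
    (hq' : Measurable q') : ∫⁻ y, q y ∂ν ≤ ∫⁻ y, q' y ∂ν + densDist ν q q' := by
  rw [densDist, ← lintegral_add_left hq']
  refine lintegral_mono_ae ?_
  filter_upwards [hq] with y hy using le_add_enorm_toReal_sub hy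

theorem exists_tendsto_densDist {u : ℕ → Y → ℝ≥0∞} (hu : ∀ n, IsProbDensity ν (u n))
    {B : ℕ → ℝ≥0∞} (hB : Tendsto B atTop (𝓝 0))
    (h : ∀ n m, n ≤ m → densDist ν (u n) (u m) ≤ B n) :
    ∃ q, IsProbDensity ν q ∧ Tendsto (fun n => densDist ν (u n) q) atTop (𝓝 0) := by
  have hmem : ∀ n, MemLp (fun y => (u n y).toReal) 1 ν := fun n =>
    memLp_one_iff_integrable.2 (integrable_toReal_of_lintegral_ne_top (hu n).1.aemeasurable
      (hu n).lintegral_ne_top)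
  have hed : ∀ n m, edist ((hmem n).toLp) ((hmem m).toLp) = densDist ν (u n) (u m) := by
    intro n m
    rw [Lp.edist_toLp_toLp, eLpNorm_one_eq_lintegral_enorm]
    rfl
  have hcau : CauchySeq fun n => (hmem n).toLp := by
    rw [EMetric.cauchySeq_iff]
    intro ε hε
    obtain ⟨N, hN⟩ := ((tendsto_order.1 hB).2 (ε / 2) (ENNReal.half_pos hε.ne')).exists
    refine ⟨N, fun m hm n hn => ?_⟩
    calc _ ≤ edist ((hmem m).toLp) ((hmem N).toLp) + edist ((hmem N).toLp) ((hmem n).toLp) :=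
          edist_triangle _ _ _
      _ < ε / 2 + ε / 2 := by
          rw [edist_comm, hed, hed]
          exact ENNReal.add_lt_add ((h N m hm).trans_lt hN) ((h N n hn).trans_lt hN)
      _ = ε := ENNReal.add_halves ε
  obtain ⟨g, hg⟩ := cauchySeq_tendsto_of_complete hcau
  have hgm : Measurable g := (Lp.stronglyMeasurable g).measurable
  have hlim : Tendsto (fun n => densDist ν (u n) fun y => ENNReal.ofReal (g y)) atTop (𝓝 0) := by
    have h0 : Tendsto (fun n => edist ((hmem n).toLp) g) atTop (𝓝 0) :=
      tendsto_iff_edist_tendsto_0.1 hg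
    refine tendsto_of_tendsto_of_tendsto_of_le_of_le tendsto_const_nhds h0 (fun _ => zero_le)
      fun n => ?_
    simp only
    rw [Lp.edist_def, eLpNorm_one_eq_lintegral_enorm]
    refine lintegral_mono_ae ?_
    filter_upwards [(hmem n).coeFn_toLp] with y hy
    -- The L¹ limit `g` is replaced by its positive part; since `u n` is nonnegative, this does not
    -- increase the distance.
    rw [Pi.sub_apply, hy, Real.enorm_eq_ofReal_abs, Real.enorm_eq_ofReal_abs]
    refine ENNReal.ofReal_le_ofReal ?_
    rw [ENNReal.toReal_ofReal']
    have := ENNReal.toReal_nonneg (a := u n y)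
    rcases le_total (g y) 0 with h1 | h1
    · rw [max_eq_right h1, abs_of_nonneg (by linarith), abs_of_nonneg (by linarith)]; linarith
    · rw [max_eq_left h1]
  have hmq : Measurable fun y => ENNReal.ofReal (g y) := hgm.ennreal_ofReal
  refine ⟨_, ⟨hmq, le_antisymm ?_ ?_⟩, hlim⟩
  · have : Tendsto (fun n => 1 + densDist ν (u n) fun y => ENNReal.ofReal (g y)) atTop (𝓝 1) := by
      simpa using tendsto_const_nhds.add hlim
    refine ge_of_tendsto' this fun n => ?_
    rw [densDist_comm]
    exact (lintegral_le_add_densDist (by simp) (hu n).1).trans_eq (by rw [(hu n).2])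
  · have : Tendsto (fun n => ∫⁻ y, ENNReal.ofReal (g y) ∂ν +
        densDist ν (u n) fun y => ENNReal.ofReal (g y)) atTop
        (𝓝 (∫⁻ y, ENNReal.ofReal (g y) ∂ν)) := by
      simpa using tendsto_const_nhds.add hlim
    refine ge_of_tendsto' this fun n => ?_
    refine (hu n).2.symm.trans_le (lintegral_le_add_densDist ?_ hmq)
    filter_upwards [ae_lt_top (hu n).1 (hu n).lintegral_ne_top] with y hy using hy.ne

/-- By homogeneity, normalizing a density of mass `Z` changes its divergence level by `log Z`, an
improvement when `Z < 1`. -/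
theorem exp_le_hell_inv_mul {α u : ℝ} (h1 : α < 1) {w m : Y → ℝ≥0∞} (hw : Measurable w)
    (hm : Measurable m) {Z : ℝ≥0∞} (hZ0 : Z ≠ 0) (hZtop : Z ≠ ∞)
    (h : ENNReal.ofReal (Real.exp (-((1 - α) * u))) ≤ hell ν α w m) :
    ENNReal.ofReal (Real.exp (-((1 - α) * (u + Real.log Z.toReal)))) ≤
      hell ν α w fun y => Z⁻¹ * m y := by
  have hZr := ENNReal.toReal_pos hZ0 hZtop
  rw [hell_smul_right h1.le hw hm]
  calc _ = Z⁻¹ ^ (1 - α) * ENNReal.ofReal (Real.exp (-((1 - α) * u))) := by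
        rw [mul_add, neg_add, add_comm, Real.exp_add, ENNReal.ofReal_mul (Real.exp_pos _).le,
          ENNReal.inv_rpow, ← ENNReal.rpow_neg]
        congr 1
        nth_rewrite 2 [← ENNReal.ofReal_toReal hZtop]
        rw [ENNReal.ofReal_rpow_of_pos hZr, Real.rpow_def_of_pos hZr]
        ring_nf
    _ ≤ _ := mul_le_mul' le_rfl h

theorem lintegral_ne_zero_of_exp_le_hell {α u : ℝ} (h0 : 0 ≤ α) (h1 : α < 1) {w m : Y → ℝ≥0∞}
    (hw : Measurable w) (hm : Measurable m)
    (h : ENNReal.ofReal (Real.exp (-((1 - α) * u))) ≤ hell ν α w m) : ∫⁻ y, m y ∂ν ≠ 0 := by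
  intro hz
  have h2 := h.trans (hell_le_mul h0 h1.le hw hm)
  rw [hz, ENNReal.zero_rpow_of_pos (by linarith), mul_zero] at h2
  simp only [nonpos_iff_eq_zero, ENNReal.ofReal_eq_zero] at h2
  exact absurd h2 (not_le.2 (Real.exp_pos _))

/-- Two densities that are nearly optimal for a near-optimal set of inputs are close. -/
theorem densDist_le_of_levels {X : Type*} {α l u : ℝ} (h0 : 0 < α) (h1 : α < 1) {w : X → Y → ℝ≥0∞}
    (hw : ∀ x, IsProbDensity ν (w x)) {S : Finset X}
    (hS : ∀ q, IsProbDensity ν q → ∀ c' : ℝ,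
      (∀ x ∈ S, ENNReal.ofReal (Real.exp (-((1 - α) * c'))) ≤ hell ν α (w x) q) → l ≤ c')
    {q q' : Y → ℝ≥0∞} (hq : IsProbDensity ν q) (hq' : IsProbDensity ν q')
    (hqS : ∀ x ∈ S, ENNReal.ofReal (Real.exp (-((1 - α) * u))) ≤ hell ν α (w x) q)
    (hqS' : ∀ x ∈ S, ENNReal.ofReal (Real.exp (-((1 - α) * u))) ≤ hell ν α (w x) q') :
    densDist ν q q' ≤ ENNReal.ofReal (4 * √((u - l) / α)) := by
  refine densDist_le_of_le_lintegral_powMean h0 h1 hq.1 hq'.1 hq.2 hq'.2 ?_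
  set m := fun y => powMean (1 - α) (q y) (q' y) with hm
  have hmm : Measurable m := measurable_powMean _ hq.1 hq'.1
  set Z := ∫⁻ y, m y ∂ν with hZ
  have hZ1 : Z ≤ 1 := le_self_add.trans
    (lintegral_powMean_add_le (r := 1 - α) (by linarith) (by linarith) hq.1 hq'.1 hq.2 hq'.2)
  have hZtop : Z ≠ ∞ := ne_top_of_le_ne_top (by simp) hZ1
  have hlev : ∀ x ∈ S, ENNReal.ofReal (Real.exp (-((1 - α) * u))) ≤ hell ν α (w x) m := by
    intro x hx
    rw [hm, hell_powMean h1 (hw x).1 hq.1, ENNReal.le_div_iff_mul_le (by simp) (by simp), mul_two]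
    exact add_le_add (hqS x hx) (hqS' x hx)
  have hSne : S.Nonempty := by
    by_contra hne
    rw [Finset.not_nonempty_iff_eq_empty] at hne
    have := hS q hq (l - 1) (by simp [hne])
    linarith
  have hZ0 : Z ≠ 0 := by
    obtain ⟨x, hx⟩ := hSne
    exact lintegral_ne_zero_of_exp_le_hell h0.le h1 (hw x).1 hmm (hlev x hx)
  have hdens : IsProbDensity ν fun y => Z⁻¹ * m y :=
    ⟨hmm.const_mul _, by rw [lintegral_const_mul _ hmm, ← hZ, ENNReal.inv_mul_cancel hZ0 hZtop]⟩
  have hZr := ENNReal.toReal_pos hZ0 hZtop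
  -- The normalized power mean has level `u + log Z`, which cannot beat `l`. Hence `Z ≥ exp (l - u)
  -- ≥ 1 - (u - l)`: almost full mass, as the uniform convexity estimate requires.
  have h3 := hS _ hdens (u + Real.log Z.toReal) fun x hx =>
    exp_le_hell_inv_mul h1 (hw x).1 hmm hZ0 hZtop (hlev x hx)
  rw [← ENNReal.ofReal_toReal hZtop]
  refine ENNReal.ofReal_le_ofReal ?_
  have h4 : l - u ≤ Real.log Z.toReal := by linarith
  have h5 := (Real.le_log_iff_exp_le hZr).1 h4
  linarith [Real.add_one_le_exp (l - u)]

end L1Limits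

/-! ### Existence of the Augustin center -/

section AugustinCenter

variable {X Y : Type*} [MeasurableSpace Y] {W : X → ProbabilityMeasure Y} {ν : Measure Y}
  [IsProbabilityMeasure ν]

/-- The probability measure with density `q`. -/
noncomputable def IsProbDensity.toProb {q : Y → ℝ≥0∞} (h : IsProbDensity ν q) :
    ProbabilityMeasure Y :=
  ⟨ν.withDensity q, h.isProbabilityMeasure⟩

theorem renyiDiv_toProb_le_iff {α c : ℝ} (h0 : 0 < α) (h1 : α < 1) {P : Measure Y}
    [IsProbabilityMeasure P] (hP : P ≪ ν) {q : Y → ℝ≥0∞} (hq : IsProbDensity ν q) :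
    renyiDiv α P (hq.toProb : Measure Y) ≤ (c : EReal) ↔
      ENNReal.ofReal (Real.exp (-((1 - α) * c))) ≤ hell ν α (P.rnDeriv ν) q := by
  have e : hellingerIntegral α P (hq.toProb : Measure Y) = hell ν α (P.rnDeriv ν) q :=
    hellingerIntegral_withDensity h0 h1.le P ν hP hq.1 hq.lintegral_ne_top
  rw [renyiDiv_le_iff h1 ?_, e]
  rw [e]
  exact (IsProbDensity.rnDeriv hP).hell_ne_top h0.le h1.le hq

/-- In the finite alternative, the weights would form an input distribution of Augustin information
at least `c`. So the other case holds, and one density serves all inputs of `F`. -/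
theorem exists_isProbDensity_of_augustinCapacity_lt (hW : ∀ x, (W x : Measure Y) ≪ ν) {α c : ℝ}
    (h0 : 0 < α) (h1 : α < 1) (hc : augustinCapacity α W < (c : EReal)) (F : Finset X) :
    ∃ q, IsProbDensity ν q ∧ ∀ x ∈ F, ENNReal.ofReal (Real.exp (-((1 - α) * c))) ≤
      hell ν α ((W x : Measure Y).rnDeriv ν) q := by
  classical
  rcases F.eq_empty_or_nonempty with rfl | hF
  · exact ⟨fun _ => 1, ⟨measurable_const, by simp⟩, by simp⟩
  have : Nonempty F := hF.to_subtype
  have hw : ∀ x, IsProbDensity ν ((W x : Measure Y).rnDeriv ν) := fun x => IsProbDensity.rnDeriv (hW x)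
  rcases exists_isProbDensity_or_weights h0.le h1 (fun x : F => hw x) (-((1 - α) * c)) with
    ⟨q, hq, hlt⟩ | ⟨p, hp0, hp1, hp⟩
  · exact ⟨q, hq, fun x hx => (hlt ⟨x, hx⟩).le⟩
  exfalso
  set f : X → ℝ := fun x => if h : x ∈ F then p ⟨x, h⟩ else 0 with hf
  have hfF : ∀ x : F, f x = p x := fun x => by simp [hf]
  let wt : X →₀ ℝ := Finsupp.onFinset F f fun x hx => by
    by_contra hxF
    simp [hf, hxF] at hx
  have hsupp : wt.support ⊆ F := Finsupp.support_onFinset_subset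
  have hsum : ∀ g : X → ℝ, ∑ x ∈ wt.support, wt x * g x = ∑ x : F, p x * g x := by
    intro g
    rw [Finset.sum_subset hsupp (fun x _ hx => by simp [Finsupp.notMem_support_iff.1 hx]),
      ← Finset.sum_coe_sort]
    exact Finset.sum_congr rfl fun x _ => by rw [← hfF]; rfl
  let s : Convexity.StdSimplex ℝ X :=
    { weights := wt
      nonneg := fun x => by
        change 0 ≤ f x
        by_cases hx : x ∈ F
        · simp [hf, hx, hp0]
        · simp [hf, hx]
      total := by
        have := hsum fun _ => 1
        simp only [mul_one, hp1] at this
        exact this }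
  have hs : augustinInfo α W s < (c : EReal) := (le_iSup _ s).trans_lt hc
  obtain ⟨Q, hQ⟩ := iInf_lt_iff.1 hs
  -- `Q` may have a part singular to `ν`. Its density is topped up to mass one, which only increases
  -- the Hellinger integrals.
  obtain ⟨q, hq, hle⟩ := exists_isProbDensity_ge (ν := ν)
    (Measure.measurable_rnDeriv (Q : Measure Y) ν) (Measure.lintegral_rnDeriv_le.trans (by simp))
  have hH : ∀ x, hellingerIntegral α (W x : Measure Y) Q ≤ hell ν α ((W x : Measure Y).rnDeriv ν) q :=
    fun x => by
      rw [hellingerIntegral_eq_hell h0 h1.le _ _ ν (hW x)]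
      exact hell_mono h1.le _ hle
  have hHtop : ∀ x, hellingerIntegral α (W x : Measure Y) Q ≠ ∞ := fun x =>
    ne_top_of_le_ne_top (by simp) (hellingerIntegral_le_one h0.le h1.le _ _)
  have hH0 : ∀ x ∈ wt.support, hellingerIntegral α (W x : Measure Y) Q ≠ 0 := by
    intro x hx h
    have := renyiDiv_lt_top_of_condRenyiDiv_lt_top (p := s)
      (fun x => renyiDiv_nonneg h0.le h1 (W x : Measure Y) (Q : Measure Y))
      (hQ.trans (EReal.coe_lt_top c)) hx
    rw [renyiDiv_eq_top h1 h] at this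
    exact lt_irrefl _ this
  have h3 := hp q hq fun x hx => by
    have hx' : (x : X) ∈ wt.support := by
      rw [Finsupp.mem_support_iff]
      change f x ≠ 0
      rwa [hfF]
    exact fun h => hH0 x hx' (le_antisymm ((hH x).trans h.le) bot_le)
  rw [← hsum fun x => Real.log (hell ν α ((W x : Measure Y).rnDeriv ν) q).toReal] at h3
  have h4 : condRenyiDiv α W (Q : Measure Y) s = ((∑ x ∈ wt.support,
      wt x * (-Real.log (hellingerIntegral α (W x : Measure Y) Q).toReal / (1 - α)) : ℝ) : EReal) := by
    rw [EReal.coe_finsetSum]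
    refine Finset.sum_congr rfl fun x hx => ?_
    rw [EReal.coe_mul, renyiDiv_eq_coe h1 (hH0 x hx) (hHtop x)]
  rw [h4, EReal.coe_lt_coe_iff] at hQ
  have h5 : ∑ x ∈ wt.support, wt x * (-Real.log (hellingerIntegral α (W x : Measure Y) Q).toReal /
      (1 - α)) = -(∑ x ∈ wt.support, wt x * Real.log (hellingerIntegral α (W x : Measure Y) Q).toReal)
      / (1 - α) := by
    rw [← Finset.sum_neg_distrib, Finset.sum_div]
    exact Finset.sum_congr rfl fun x _ => by ring
  rw [h5, div_lt_iff₀ (by linarith)] at hQ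
  have h6 : ∑ x ∈ wt.support, wt x * Real.log (hellingerIntegral α (W x : Measure Y) Q).toReal ≤
      ∑ x ∈ wt.support, wt x * Real.log (hell ν α ((W x : Measure Y).rnDeriv ν) q).toReal := by
    refine Finset.sum_le_sum fun x hx => mul_le_mul_of_nonneg_left ?_ (s.nonneg x)
    refine Real.log_le_log (ENNReal.toReal_pos (hH0 x hx) (hHtop x)) ?_
    exact ENNReal.toReal_mono ((hw x).hell_ne_top h0.le h1.le hq) (hH x)
  linarith

theorem exists_finset_of_lt_augustinCapacity (hW : ∀ x, (W x : Measure Y) ≪ ν) {α c : ℝ}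
    (h0 : 0 < α) (h1 : α < 1) (hc : (c : EReal) < augustinCapacity α W) :
    ∃ S : Finset X, ∀ q, IsProbDensity ν q → ∀ c' : ℝ,
      (∀ x ∈ S, ENNReal.ofReal (Real.exp (-((1 - α) * c'))) ≤
        hell ν α ((W x : Measure Y).rnDeriv ν) q) → c ≤ c' := by
  obtain ⟨p, hp⟩ := lt_iSup_iff.1 hc
  refine ⟨p.weights.support, fun q hq c' h => ?_⟩
  have h2 : augustinInfo α W p ≤ (c' : EReal) :=
    (iInf_le _ hq.toProb).trans (condRenyiDiv_le fun x hx =>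
      (renyiDiv_toProb_le_iff h0 h1 (hW x) hq).2 (h x hx))
  exact_mod_cast (hp.trans_le h2).le

/-- Existence of the Augustin center for an order in `(0, 1)`. -/
theorem exists_isProbDensity_center (hW : ∀ x, (W x : Measure Y) ≪ ν) {α C : ℝ}
    (h0 : 0 < α) (h1 : α < 1) (hC : augustinCapacity α W = (C : EReal)) :
    ∃ q, IsProbDensity ν q ∧ ∀ x, ENNReal.ofReal (Real.exp (-((1 - α) * C))) ≤
      hell ν α ((W x : Measure Y).rnDeriv ν) q := by
  classical
  have hw : ∀ x, IsProbDensity ν ((W x : Measure Y).rnDeriv ν) := fun x => IsProbDensity.rnDeriv (hW x)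
  set ε : ℕ → ℝ := fun n => 1 / ((n : ℝ) + 1) with hε
  have hεpos : ∀ n, 0 < ε n := fun n => by positivity
  have hεmono : ∀ n m, n ≤ m → ε m ≤ ε n := fun n m h => one_div_le_one_div_of_le (by positivity)
    (by have : (n : ℝ) ≤ m := by exact_mod_cast h
        linarith)
  have hεlim : Tendsto ε atTop (𝓝 0) := tendsto_one_div_add_atTop_nhds_zero_nat
  have hlow : ∀ n, ((C - ε n : ℝ) : EReal) < augustinCapacity α W := fun n => by
    rw [hC, EReal.coe_lt_coe_iff]; linarith [hεpos n]
  have hup : ∀ n, augustinCapacity α W < ((C + ε n : ℝ) : EReal) := fun n => by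
    rw [hC, EReal.coe_lt_coe_iff]; linarith [hεpos n]
  choose S hS using fun n => exists_finset_of_lt_augustinCapacity hW h0 h1 (hlow n)
  -- Unions make the sets nested: for `n ≤ m`, both `u n` and `u m` are nearly optimal on `S n`,
  -- which makes the sequence Cauchy.
  let F : ℕ → Finset X := fun n => (Finset.range (n + 1)).biUnion S
  have hSF : ∀ n m, n ≤ m → S n ⊆ F m := fun n m h =>
    Finset.subset_biUnion_of_mem S (Finset.mem_range.2 (by omega))
  choose u hu huF using fun n => exists_isProbDensity_of_augustinCapacity_lt hW h0 h1 (hup n) (F n)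
  have hlev : ∀ n m (q : Y → ℝ≥0∞) (x : X), n ≤ m → ENNReal.ofReal
      (Real.exp (-((1 - α) * (C + ε m)))) ≤ hell ν α ((W x : Measure Y).rnDeriv ν) q →
      ENNReal.ofReal (Real.exp (-((1 - α) * (C + ε n)))) ≤
        hell ν α ((W x : Measure Y).rnDeriv ν) q := by
    intro n m q x h h'
    refine le_trans (ENNReal.ofReal_le_ofReal (Real.exp_le_exp.2 ?_)) h'
    have := hεmono n m h
    have := mul_le_mul_of_nonneg_left this (by linarith : 0 ≤ 1 - α)
    linarith
  let B : ℕ → ℝ≥0∞ := fun n => ENNReal.ofReal (4 * √((C + ε n - (C - ε n)) / α))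
  have hB : Tendsto B atTop (𝓝 0) := by
    have h2 : Continuous fun t : ℝ => ENNReal.ofReal (4 * √((C + t - (C - t)) / α)) :=
      ENNReal.continuous_ofReal.comp (by fun_prop)
    have := (h2.tendsto 0).comp hεlim
    rwa [add_zero, sub_zero, sub_self, zero_div, Real.sqrt_zero, mul_zero, ENNReal.ofReal_zero]
      at this
  obtain ⟨q, hq, hlim⟩ := exists_tendsto_densDist hu hB fun n m h =>
    densDist_le_of_levels h0 h1 hw (hS n) (hu n) (hu m)
      (fun x hx => huF n x (hSF n n le_rfl hx))
      (fun x hx => hlev n m _ x h (huF m x (hSF n m h hx)))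
  refine ⟨q, hq, fun x => ?_⟩
  -- The sequence `u` need not be good at the given `x`. A second sequence that also takes `x` into
  -- account stays close to `u`, hence has the same limit `q`, and its level at `x` passes to the
  -- limit.
  choose v hv hvF using fun n =>
    exists_isProbDensity_of_augustinCapacity_lt hW h0 h1 (hup n) (insert x (F n))
  have hvlim : Tendsto (fun n => densDist ν (v n) q) atTop (𝓝 0) := by
    refine tendsto_of_tendsto_of_tendsto_of_le_of_le tendsto_const_nhds
      (by simpa using hB.add hlim) (fun _ => zero_le) fun n => ?_
    refine (densDist_triangle (hv n).1 (hu n).1).trans (add_le_add ?_ le_rfl)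
    exact densDist_le_of_levels h0 h1 hw (hS n) (hv n) (hu n)
      (fun y hy => hvF n y (Finset.mem_insert_of_mem (hSF n n le_rfl hy)))
      (fun y hy => huF n y (hSF n n le_rfl hy))
  have hH := tendsto_hell h0.le h1 (hw x).1 hq.1 (fun n => (hv n).1) (hw x).2.le
    hq.lintegral_ne_top (fun n => (hv n).lintegral_ne_top) hvlim
  have hE : Tendsto (fun n => ENNReal.ofReal (Real.exp (-((1 - α) * (C + ε n))))) atTop
      (𝓝 (ENNReal.ofReal (Real.exp (-((1 - α) * C))))) := by
    have h2 : Continuous fun t : ℝ => ENNReal.ofReal (Real.exp (-((1 - α) * (C + t)))) :=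
      ENNReal.continuous_ofReal.comp (by fun_prop)
    have := (h2.tendsto 0).comp hεlim
    simpa [Function.comp_def] using this
  exact le_of_tendsto_of_tendsto' hE hH fun n => hvF n x (Finset.mem_insert_self _ _)

end AugustinCenter

/-! ### Comparison of order one with orders below one -/

section OrderOne

variable {Y : Type*} [MeasurableSpace Y]

theorem hellingerIntegral_eq_lintegral_rnDeriv {α : ℝ} (h0 : 0 < α) (h1 : α ≤ 1) {P Q : Measure Y}
    [IsProbabilityMeasure P] [IsProbabilityMeasure Q] (h : P ≪ Q) :
    hellingerIntegral α P Q = ∫⁻ y, P.rnDeriv Q y ^ α ∂Q := by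
  rw [hellingerIntegral_eq_hell h0 h1 P Q Q h]
  refine lintegral_congr_ae ?_
  filter_upwards [Measure.rnDeriv_self Q] with y hy
  rw [hy, ENNReal.one_rpow, mul_one]

/-- The tangent bound `1 + t ≤ exp t` at `t = -(1 - α) (log r - K)`. With `K` the Kullback–Leibler
divergence and `r` the likelihood ratio, the correction integrates to zero, which is Jensen's
inequality in `renyiDiv_le_renyiDiv_one`. -/
theorem rpow_ge_tangent {α K r : ℝ} (h0 : 0 < α) (hr : 0 ≤ r) :
    Real.exp (-((1 - α) * K)) * (r - (1 - α) * (r * Real.log r - K * r)) ≤ r ^ α := by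
  rcases hr.eq_or_lt with rfl | hr
  · simp [Real.zero_rpow h0.ne']
  have e : r ^ α = Real.exp (-((1 - α) * K)) * (r * Real.exp (-((1 - α) * (Real.log r - K)))) := by
    nth_rewrite 2 [← Real.exp_log hr]
    rw [Real.rpow_def_of_pos hr, ← Real.exp_add, ← Real.exp_add]
    ring_nf
  rw [e]
  refine mul_le_mul_of_nonneg_left ?_ (Real.exp_pos _).le
  have := Real.add_one_le_exp (-((1 - α) * (Real.log r - K)))
  nlinarith

theorem renyiDiv_one_eq_integral_llr {P Q : Measure Y} [IsProbabilityMeasure P]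
    [IsProbabilityMeasure Q] (hac : P ≪ Q) (hint : Integrable (llr P Q) P) :
    renyiDiv 1 P Q = ((∫ y, llr P Q y ∂P : ℝ) : EReal) := by
  rw [renyiDiv, if_pos rfl, ← InformationTheory.toReal_klDiv_of_measure_eq hac (by simp),
    EReal.coe_ennreal_toReal (InformationTheory.klDiv_ne_top hac hint)]

theorem renyiDiv_le_renyiDiv_one {α : ℝ} (h0 : 0 < α) (h1 : α < 1) (P Q : Measure Y)
    [IsProbabilityMeasure P] [IsProbabilityMeasure Q] : renyiDiv α P Q ≤ renyiDiv 1 P Q := by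
  by_cases htop : InformationTheory.klDiv P Q = ∞
  · simp [renyiDiv, htop]
  obtain ⟨hac, hint⟩ := InformationTheory.klDiv_ne_top_iff.1 htop
  set K := ∫ y, llr P Q y ∂P with hK
  have e1 : renyiDiv 1 P Q = (K : EReal) := renyiDiv_one_eq_integral_llr hac hint
  have hle := hellingerIntegral_le_one h0.le h1.le P Q
  have hfin := ne_top_of_le_ne_top (by simp) hle
  rw [e1, renyiDiv_le_iff h1 hfin, ENNReal.ofReal_le_iff_le_toReal hfin]
  rw [hellingerIntegral_eq_lintegral_rnDeriv h0 h1.le hac] at hfin ⊢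
  have hm : Measurable fun y => P.rnDeriv Q y ^ α := by fun_prop
  rw [← integral_toReal hm.aemeasurable (ae_lt_top hm hfin)]
  have i1 : Integrable (fun y => (P.rnDeriv Q y).toReal) Q := Measure.integrable_toReal_rnDeriv
  have i2 : Integrable (fun y => (P.rnDeriv Q y).toReal * Real.log (P.rnDeriv Q y).toReal) Q :=
    (integrable_rnDeriv_smul_iff hac).2 hint
  have i3 : Integrable (fun y => (P.rnDeriv Q y).toReal * Real.log (P.rnDeriv Q y).toReal -
      K * (P.rnDeriv Q y).toReal) Q := i2.sub (i1.const_mul K)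
  have e2 : ∫ y, (P.rnDeriv Q y).toReal * Real.log (P.rnDeriv Q y).toReal ∂Q = K :=
    integral_rnDeriv_smul hac
  have e3 : ∫ y, (P.rnDeriv Q y).toReal ∂Q = 1 := by
    rw [Measure.integral_toReal_rnDeriv hac]; simp
  calc Real.exp (-((1 - α) * K)) = ∫ y, Real.exp (-((1 - α) * K)) * ((P.rnDeriv Q y).toReal -
        (1 - α) * ((P.rnDeriv Q y).toReal * Real.log (P.rnDeriv Q y).toReal -
          K * (P.rnDeriv Q y).toReal)) ∂Q := by
        rw [integral_const_mul, integral_sub i1 (i3.const_mul _),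
          integral_const_mul, integral_sub i2 (i1.const_mul K), integral_const_mul, e2, e3]
        ring
    _ ≤ _ := by
        refine integral_mono ((i1.sub (i3.const_mul _)).const_mul _)
          (integrable_toReal_of_lintegral_ne_top hm.aemeasurable hfin) fun y => ?_
        simp only
        rw [← ENNReal.toReal_rpow]
        exact rpow_ge_tangent h0 ENNReal.toReal_nonneg

/-- The Hellinger integral sees only the set where `q` is nonzero, so by Hölder it is at most the
`P`-measure of that set to the power `β`. Letting `β → 1` shows that the set has full `P`-measure.
-/
theorem absolutelyContinuous_of_hell_ge {ν P : Measure Y} [IsProbabilityMeasure ν]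
    [IsProbabilityMeasure P] (hP : P ≪ ν) {q : Y → ℝ≥0∞} (hq : IsProbDensity ν q) {R : ℝ}
    (h : ∀ β ∈ Ioo (0 : ℝ) 1, ENNReal.ofReal (Real.exp (-((1 - β) * R))) ≤
      hell ν β (P.rnDeriv ν) q) : P ≪ ν.withDensity q := by
  have hw := IsProbDensity.rnDeriv hP
  set w := P.rnDeriv ν with hwdef
  set A : Set Y := {y | q y ≠ 0} with hA
  have hAm : MeasurableSet A := hq.1 (measurableSet_singleton 0).compl
  have hPA : ∀ s, P s = ν.withDensity w s := fun s => by rw [Measure.withDensity_rnDeriv_eq _ _ hP]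
  have hle : ∀ β ∈ Ioo (0 : ℝ) 1, ENNReal.ofReal (Real.exp (-((1 - β) * R))) ≤ P A ^ β := by
    intro β hβ
    refine (h β hβ).trans ?_
    calc hell ν β w q = hell ν β (A.indicator w) q := by
          refine lintegral_congr fun y => ?_
          by_cases hy : y ∈ A
          · rw [indicator_of_mem hy]
          · have : q y = 0 := by simpa [hA] using hy
            simp [this, ENNReal.zero_rpow_of_pos (show 0 < 1 - β by linarith [hβ.2])]
      _ ≤ (∫⁻ y, A.indicator w y ∂ν) ^ β * (∫⁻ y, q y ∂ν) ^ (1 - β) :=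
          hell_le_mul hβ.1.le hβ.2.le (hw.1.indicator hAm) hq.1
      _ = P A ^ β := by
          rw [hq.2, ENNReal.one_rpow, mul_one, lintegral_indicator hAm, hPA, withDensity_apply _ hAm]
  have hPA1 : 1 ≤ P A := by
    have l1 : Tendsto (fun β : ℝ => ENNReal.ofReal (Real.exp (-((1 - β) * R)))) (𝓝[<] 1) (𝓝 1) := by
      have hc : Continuous fun β : ℝ => ENNReal.ofReal (Real.exp (-((1 - β) * R))) :=
        ENNReal.continuous_ofReal.comp (by fun_prop)
      have := hc.tendsto 1
      simp only [sub_self, zero_mul, neg_zero, Real.exp_zero, ENNReal.ofReal_one] at this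
      exact this.mono_left nhdsWithin_le_nhds
    have hPAtop : P A ≠ ∞ := measure_ne_top _ _
    have l2 : Tendsto (fun β : ℝ => P A ^ β) (𝓝[<] 1) (𝓝 (P A)) := by
      have hc : ContinuousAt (fun β : ℝ => P A ^ β) 1 := by
        lift P A to NNReal using hPAtop with a
        have hev : (fun β : ℝ => (a : ℝ≥0∞) ^ β) =ᶠ[𝓝 1] fun β => ((a ^ β : NNReal) : ℝ≥0∞) := by
          filter_upwards [lt_mem_nhds (show (0:ℝ) < 1 by norm_num)] with β hβ
          rw [ENNReal.coe_rpow_of_nonneg _ hβ.le]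
        refine ContinuousAt.congr ?_ hev.symm
        refine ENNReal.continuous_coe.continuousAt.comp ?_
        exact (NNReal.continuousAt_rpow (Or.inr one_pos)).comp (continuousAt_const.prodMk continuousAt_id)
      have := hc.tendsto
      rw [ENNReal.rpow_one] at this
      exact this.mono_left nhdsWithin_le_nhds
    refine le_of_tendsto_of_tendsto l1 l2 ?_
    filter_upwards [Ioo_mem_nhdsLT (show (0:ℝ) < 1 by norm_num)] with β hβ using hle β hβ
  have hPAc : P Aᶜ = 0 := by
    rw [measure_compl hAm (measure_ne_top _ _), measure_univ]
    exact tsub_eq_zero_of_le hPA1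
  refine Measure.AbsolutelyContinuous.mk fun s hs hQ => ?_
  have h1 : ν (s ∩ A) = 0 := by
    rw [withDensity_apply _ hs, lintegral_eq_zero_iff hq.1, EventuallyEq, ae_restrict_iff' hs] at hQ
    refine measure_mono_null ?_ (ae_iff.1 hQ)
    rintro y ⟨hy, hyA⟩
    simp only [mem_ofPred_eq, Classical.not_imp]
    exact ⟨hy, hyA⟩
  refine le_antisymm ?_ bot_le
  calc P s ≤ P (s ∩ A) + P Aᶜ := by
        refine (measure_mono ?_).trans (measure_union_le _ _)
        intro y hy
        by_cases hyA : y ∈ A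
        · exact Or.inl ⟨hy, hyA⟩
        · exact Or.inr hyA
    _ = 0 := by rw [hP h1, hPAc, add_zero]

theorem klFun_approx_nonneg {t r : ℝ} (ht : 0 < t) (ht1 : t < 1) (hr : 0 ≤ r) :
    0 ≤ (r - r ^ (1 - t)) / t + 1 - r := by
  have h := Real.geom_mean_le_arith_mean2_weighted (w₁ := 1 - t) (w₂ := t) (by linarith) ht.le hr
    zero_le_one (by ring)
  rw [Real.one_rpow, mul_one, mul_one] at h
  have : 1 - r ≥ -((r - r ^ (1 - t)) / t) := by
    rw [ge_iff_le, ← neg_div, div_le_iff₀ ht]; nlinarith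
  linarith

theorem tendsto_klFun_approx {r : ℝ} (hr : 0 ≤ r) :
    Tendsto (fun t : ℝ => (r - r ^ (1 - t)) / t + 1 - r) (𝓝[>] 0)
      (𝓝 (InformationTheory.klFun r)) := by
  have h1 : Tendsto (fun t : ℝ => (r - r ^ (1 - t)) / t) (𝓝[>] 0) (𝓝 (r * Real.log r)) := by
    rcases hr.eq_or_lt with rfl | hr
    · refine (tendsto_congr' ?_).2 (show Tendsto (fun _ : ℝ => (0:ℝ)) _ _ by simp)
      filter_upwards [Ioo_mem_nhdsGT (show (0:ℝ) < 1 by norm_num)] with t ht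
      rw [Real.zero_rpow (by linarith [ht.2])]
      simp
    · have hd : HasDerivAt (fun t : ℝ => -r ^ (1 - t)) (r * Real.log r) 0 := by
        have h2 : HasDerivAt (fun t : ℝ => 1 - t) (-1) 0 := by
          simpa using (hasDerivAt_id (0:ℝ)).const_sub 1
        have := (h2.const_rpow hr).fun_neg
        simpa [mul_comm] using this
      have h3 := hd.tendsto_slope.mono_left (nhdsGT_le_nhdsNE 0)
      refine h3.congr fun t => ?_
      simp [slope_def_field]
      ring
  have := (h1.add_const 1).sub_const r
  rwa [InformationTheory.klFun]

/-- Fatou's lemma. With `t = 1 - β`, the nonnegative functions `(r - r ^ (1 - t)) / t + 1 - r`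
converge to `klFun r` as `t → 0`, and each integrates to (1 - Hellinger integral) / t, at most `R`.
-/
theorem renyiDiv_one_le_of_hell_ge {ν P : Measure Y} [IsProbabilityMeasure ν]
    [IsProbabilityMeasure P] (hP : P ≪ ν) {q : Y → ℝ≥0∞} (hq : IsProbDensity ν q) {R : ℝ}
    (h : ∀ β ∈ Ioo (0 : ℝ) 1, ENNReal.ofReal (Real.exp (-((1 - β) * R))) ≤
      hell ν β (P.rnDeriv ν) q) : renyiDiv 1 P (ν.withDensity q) ≤ (R : EReal) := by
  have hac := absolutelyContinuous_of_hell_ge hP hq h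
  have hprob := hq.isProbabilityMeasure
  set Q := ν.withDensity q
  set r : Y → ℝ := fun y => (P.rnDeriv Q y).toReal with hr
  have hrm : Measurable r := by fun_prop
  have i1 : Integrable r Q := Measure.integrable_toReal_rnDeriv
  have e1 : ∫ y, r y ∂Q = 1 := by
    rw [hr, Measure.integral_toReal_rnDeriv hac]; simp
  have hbound : ∀ t ∈ Ioo (0:ℝ) 1,
      ∫⁻ y, ENNReal.ofReal ((r y - r y ^ (1 - t)) / t + 1 - r y) ∂Q ≤ ENNReal.ofReal R := by
    intro t ht
    have hb : (1 - t) ∈ Ioo (0:ℝ) 1 := ⟨by linarith [ht.2], by linarith [ht.1]⟩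
    have hH := h _ hb
    have hle := hellingerIntegral_le_one hb.1.le hb.2.le P Q
    have hfin := ne_top_of_le_ne_top (by simp) hle
    have e2 : hellingerIntegral (1 - t) P Q = hell ν (1 - t) (P.rnDeriv ν) q :=
      hellingerIntegral_withDensity hb.1 hb.2.le P ν hP hq.1 hq.lintegral_ne_top
    rw [← e2, ENNReal.ofReal_le_iff_le_toReal hfin] at hH
    rw [hellingerIntegral_eq_lintegral_rnDeriv hb.1 hb.2.le hac] at hH hfin
    have hm : Measurable fun y => P.rnDeriv Q y ^ (1 - t) := by fun_prop
    rw [← integral_toReal hm.aemeasurable (ae_lt_top hm hfin)] at hH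
    have i2 := integrable_toReal_of_lintegral_ne_top hm.aemeasurable hfin
    simp only [← ENNReal.toReal_rpow] at hH i2
    have i4 : Integrable (fun y => (r y - r y ^ (1 - t)) / t) Q := (i1.sub i2).div_const t
    have i5 : Integrable (fun y => (r y - r y ^ (1 - t)) / t + 1) Q := i4.add (integrable_const 1)
    have i3 : Integrable (fun y => (r y - r y ^ (1 - t)) / t + 1 - r y) Q := i5.sub i1
    rw [← ofReal_integral_eq_lintegral_ofReal i3
      (Eventually.of_forall fun y => klFun_approx_nonneg ht.1 ht.2 ENNReal.toReal_nonneg)]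
    refine ENNReal.ofReal_le_ofReal ?_
    have e3 : ∫ y, ((r y - r y ^ (1 - t)) / t + 1 - r y) ∂Q =
        (1 - ∫ y, r y ^ (1 - t) ∂Q) / t := by
      rw [integral_sub i5 i1, integral_add i4 (integrable_const 1), integral_div,
        integral_sub i1 i2, e1]
      simp [r]
    refine e3.trans_le ?_
    rw [div_le_iff₀ ht.1]
    have := Real.add_one_le_exp (-((1 - (1 - t)) * R))
    linarith
  have hkl : InformationTheory.klDiv P Q ≤ ENNReal.ofReal R := by
    rw [InformationTheory.klDiv_eq_lintegral_klFun_of_ac hac]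
    set t : ℕ → ℝ := fun n => 1 / ((n : ℝ) + 1 + 1) with ht
    have htm : ∀ n, t n ∈ Ioo (0:ℝ) 1 := fun n => ⟨by positivity, by
      rw [ht]; simp only; rw [div_lt_one (by positivity)]; have : (0:ℝ) ≤ n := by positivity
      linarith⟩
    have htl : Tendsto t atTop (𝓝[>] 0) := by
      refine tendsto_nhdsWithin_iff.2 ⟨?_, Eventually.of_forall fun n => (htm n).1⟩
      have := (tendsto_add_atTop_iff_nat 1).2 (tendsto_one_div_add_atTop_nhds_zero_nat (𝕜 := ℝ))
      refine this.congr fun n => ?_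
      simp [ht]
    calc ∫⁻ y, ENNReal.ofReal (InformationTheory.klFun (P.rnDeriv Q y).toReal) ∂Q
        = ∫⁻ y, liminf (fun n => ENNReal.ofReal ((r y - r y ^ (1 - t n)) / t n + 1 - r y)) atTop ∂Q := by
          refine lintegral_congr fun y => ?_
          refine (Tendsto.liminf_eq ?_).symm
          exact (ENNReal.continuous_ofReal.tendsto _).comp
            ((tendsto_klFun_approx ENNReal.toReal_nonneg).comp htl)
      _ ≤ liminf (fun n => ∫⁻ y, ENNReal.ofReal ((r y - r y ^ (1 - t n)) / t n + 1 - r y) ∂Q) atTop :=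
          lintegral_liminf_le fun n => by fun_prop
      _ ≤ liminf (fun _ : ℕ => ENNReal.ofReal R) atTop :=
          liminf_le_liminf (Eventually.of_forall fun n => hbound _ (htm n))
      _ = ENNReal.ofReal R := liminf_const _
  have hR : 0 ≤ R := by
    have h2 := (h (1 / 2) ⟨by norm_num, by norm_num⟩).trans
      ((IsProbDensity.rnDeriv hP).hell_le_one (by norm_num) (by norm_num) hq)
    rw [← ENNReal.ofReal_one, ENNReal.ofReal_le_ofReal_iff zero_le_one, Real.exp_le_one_iff] at h2
    linarith
  rw [renyiDiv, if_pos rfl]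
  calc ((InformationTheory.klDiv P Q : ℝ≥0∞) : EReal) ≤ ((ENNReal.ofReal R : ℝ≥0∞) : EReal) :=
        EReal.coe_ennreal_le_coe_ennreal_iff.2 hkl
    _ = R := by rw [EReal.coe_ennreal_ofReal, max_eq_left hR]

end OrderOne

/-! ### Dependence of capacity and center on the order -/

section CenterFamily

variable {X Y : Type*} [MeasurableSpace Y] {W : X → ProbabilityMeasure Y} {ν : Measure Y}
  [IsProbabilityMeasure ν]

theorem augustinCapacity_le_augustinCapacity_one {α : ℝ} (h0 : 0 < α) (h1 : α < 1) :
    augustinCapacity α W ≤ augustinCapacity 1 W := by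
  refine iSup_mono fun p => iInf_mono fun Q => Finset.sum_le_sum fun x _ => ?_
  exact mul_le_mul_of_nonneg_left (renyiDiv_le_renyiDiv_one h0 h1 _ _)
    (by exact_mod_cast p.weights_nonneg x)

theorem coe_toReal_augustinCapacity [Nonempty X] (hfin : augustinCapacity 1 W < ⊤) {α : ℝ}
    (hα : α ∈ Ioo (0 : ℝ) 1) :
    (((augustinCapacity α W).toReal : ℝ) : EReal) = augustinCapacity α W := by
  refine EReal.coe_toReal ?_ ?_
  · exact ((augustinCapacity_le_augustinCapacity_one hα.1 hα.2).trans_lt hfin).ne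
  · exact (EReal.bot_lt_zero.trans_le (augustinCapacity_nonneg hα.1.le hα.2)).ne'

omit [IsProbabilityMeasure ν] in
theorem exp_le_hell_of_le_order {α β c : ℝ} (h0 : 0 < α) (hαβ : α ≤ β) (h1 : β < 1)
    {w q : Y → ℝ≥0∞} (hw : IsProbDensity ν w) (hq : IsProbDensity ν q)
    (h : ENNReal.ofReal (Real.exp (-((1 - β) * c))) ≤ hell ν β w q) :
    ENNReal.ofReal (Real.exp (-((1 - α) * c))) ≤ hell ν α w q := by
  have h2 := h.trans (hell_le_rpow_of_ge h0.le hαβ h1 hw.1 hq.1 hw.2.le)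
  have hs : 0 < (1 - β) / (1 - α) := div_pos (by linarith) (by linarith)
  have ha : 1 - α ≠ 0 := by linarith
  have hb : 1 - β ≠ 0 := by linarith
  have e : ENNReal.ofReal (Real.exp (-((1 - β) * c))) =
      ENNReal.ofReal (Real.exp (-((1 - α) * c))) ^ ((1 - β) / (1 - α)) := by
    rw [ENNReal.ofReal_rpow_of_pos (Real.exp_pos _), ← Real.exp_mul]
    congr 2
    field_simp
  rw [e] at h2
  exact (ENNReal.rpow_le_rpow_iff hs).1 h2

-- While the divergence increases with the order, (1-α)/α times it decreases. Together the two
-- monotonicities yield continuity of the capacity.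
omit [IsProbabilityMeasure ν] in
theorem exp_le_hell_of_ge_order {α β c : ℝ} (h0 : 0 < α) (hαβ : α ≤ β) (h1 : β < 1)
    {w q : Y → ℝ≥0∞} (hw : IsProbDensity ν w) (hq : IsProbDensity ν q)
    (h : ENNReal.ofReal (Real.exp (-((1 - α) * c))) ≤ hell ν α w q) :
    ENNReal.ofReal (Real.exp (-((1 - β) * (β * (1 - α) / (α * (1 - β)) * c)))) ≤ hell ν β w q := by
  have hβ : 0 < β := h0.trans_le hαβ
  have h2 := h.trans (hell_le_rpow_of_le h0 hαβ h1.le hw.1 hq.1 hq.2.le)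
  have hb : 1 - β ≠ 0 := by linarith
  have e : ENNReal.ofReal (Real.exp (-((1 - α) * c))) =
      ENNReal.ofReal (Real.exp (-((1 - β) * (β * (1 - α) / (α * (1 - β)) * c)))) ^ (α / β) := by
    rw [ENNReal.ofReal_rpow_of_pos (Real.exp_pos _), ← Real.exp_mul]
    congr 2
    field_simp
  rw [e] at h2
  exact (ENNReal.rpow_le_rpow_iff (by positivity)).1 h2

theorem augustinCapacity_le_of_hell_ge (hW : ∀ x, (W x : Measure Y) ≪ ν) {α c : ℝ} (h0 : 0 < α)
    (h1 : α < 1) {q : Y → ℝ≥0∞} (hq : IsProbDensity ν q)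
    (h : ∀ x, ENNReal.ofReal (Real.exp (-((1 - α) * c))) ≤
      hell ν α ((W x : Measure Y).rnDeriv ν) q) : augustinCapacity α W ≤ (c : EReal) :=
  augustinCapacity_le hq.toProb fun x => (renyiDiv_toProb_le_iff h0 h1 (hW x) hq).2 (h x)

/-- A family of densities of Augustin centers, together with the capacities, for the orders in
`(0, 1)`. -/
structure IsCenterFamily (W : X → ProbabilityMeasure Y) (ν : Measure Y) (c : ℝ → ℝ)
    (q : ℝ → Y → ℝ≥0∞) : Prop where
  ac : ∀ x, (W x : Measure Y) ≪ ν
  cap : ∀ α ∈ Ioo (0 : ℝ) 1, augustinCapacity α W = (c α : EReal)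
  dens : ∀ α ∈ Ioo (0 : ℝ) 1, IsProbDensity ν (q α)
  level : ∀ α ∈ Ioo (0 : ℝ) 1, ∀ x, ENNReal.ofReal (Real.exp (-((1 - α) * c α))) ≤
    hell ν α ((W x : Measure Y).rnDeriv ν) (q α)

theorem exists_isCenterFamily [Nonempty X] (hW : ∀ x, (W x : Measure Y) ≪ ν)
    (hfin : augustinCapacity 1 W < ⊤) :
    ∃ q, IsCenterFamily W ν (fun α => (augustinCapacity α W).toReal) q := by
  have h : ∀ α, ∃ q, α ∈ Ioo (0 : ℝ) 1 → IsProbDensity ν q ∧ ∀ x,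
      ENNReal.ofReal (Real.exp (-((1 - α) * (augustinCapacity α W).toReal))) ≤
        hell ν α ((W x : Measure Y).rnDeriv ν) q := by
    intro α
    by_cases hα : α ∈ Ioo (0 : ℝ) 1
    · obtain ⟨q, hq⟩ := exists_isProbDensity_center hW hα.1 hα.2
        (coe_toReal_augustinCapacity hfin hα).symm
      exact ⟨q, fun _ => hq⟩
    · exact ⟨0, fun h => absurd h hα⟩
  choose q hq using h
  exact ⟨q, hW, fun α hα => (coe_toReal_augustinCapacity hfin hα).symm, fun α hα => (hq α hα).1,
    fun α hα => (hq α hα).2⟩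

namespace IsCenterFamily

variable {c : ℝ → ℝ} {q : ℝ → Y → ℝ≥0∞} (h : IsCenterFamily W ν c q)
include h

theorem monotoneOn : MonotoneOn c (Ioo 0 1) := by
  intro α hα β hβ hαβ
  have := augustinCapacity_le_of_hell_ge h.ac hα.1 hα.2 (h.dens β hβ) fun x =>
    exp_le_hell_of_le_order hα.1 hαβ hβ.2 (IsProbDensity.rnDeriv (h.ac x)) (h.dens β hβ)
      (h.level β hβ x)
  rw [h.cap α hα] at this
  exact_mod_cast this

theorem le_mul {α β : ℝ} (hα : α ∈ Ioo (0 : ℝ) 1) (hβ : β ∈ Ioo (0 : ℝ) 1) (hαβ : α ≤ β) :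
    c β ≤ β * (1 - α) / (α * (1 - β)) * c α := by
  have := augustinCapacity_le_of_hell_ge h.ac hβ.1 hβ.2 (h.dens α hα) fun x =>
    exp_le_hell_of_ge_order hα.1 hαβ hβ.2 (IsProbDensity.rnDeriv (h.ac x)) (h.dens α hα)
      (h.level α hα x)
  rw [h.cap β hβ] at this
  exact_mod_cast this

omit [IsProbabilityMeasure ν] in
theorem nonneg [Nonempty X] {α : ℝ} (hα : α ∈ Ioo (0 : ℝ) 1) : 0 ≤ c α := by
  have := augustinCapacity_nonneg (W := W) hα.1.le hα.2
  rw [h.cap α hα] at this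
  exact_mod_cast this

/-- `monotoneOn` and `le_mul` squeeze `c β` between `c α` and `ρ β * c α`, where `ρ` is continuous
with `ρ α = 1`. -/
theorem continuousAt [Nonempty X] {α : ℝ} (hα : α ∈ Ioo (0 : ℝ) 1) : ContinuousAt c α := by
  have hα0 : α ≠ 0 := hα.1.ne'
  have hα1 : 1 - α ≠ 0 := by linarith [hα.2]
  set ρ : ℝ → ℝ := fun β => β * (1 - α) / (α * (1 - β)) with hρ
  have hρc : ContinuousAt ρ α := by
    refine ContinuousAt.div (by fun_prop) (by fun_prop) (by positivity)
  have hρ1 : ρ α = 1 := by simp only [hρ]; field_simp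
  have l1 : Tendsto (fun β => min (c α) (ρ β * c α)) (𝓝 α) (𝓝 (c α)) := by
    have := Tendsto.min (tendsto_const_nhds (x := c α)) (hρc.mul_const (c α)).tendsto
    rwa [hρ1, one_mul, min_self] at this
  have l2 : Tendsto (fun β => max (c α) (ρ β * c α)) (𝓝 α) (𝓝 (c α)) := by
    have := Tendsto.max (tendsto_const_nhds (x := c α)) (hρc.mul_const (c α)).tendsto
    rwa [hρ1, one_mul, max_self] at this
  refine tendsto_of_tendsto_of_tendsto_of_le_of_le' l1 l2 ?_ ?_
  all_goals
    filter_upwards [Ioo_mem_nhds hα.1 hα.2] with β hβ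
    have hβ1 : 0 < 1 - β := by linarith [hβ.2]
    have hα1' : 0 < 1 - α := by linarith [hα.2]
    have hα' := hα.1
    have hβ' := hβ.1
  · rcases le_total α β with hle | hle
    · exact (min_le_left _ _).trans (h.monotoneOn hα hβ hle)
    · refine (min_le_right _ _).trans ?_
      have h2 := h.le_mul hβ hα hle
      calc ρ β * c α ≤ ρ β * (α * (1 - β) / (β * (1 - α)) * c β) :=
            mul_le_mul_of_nonneg_left h2 (by positivity)
        _ = c β := by simp only [hρ]; field_simp
  · rcases le_total α β with hle | hle
    · exact (h.le_mul hα hβ hle).trans (le_max_right _ _)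
    · exact (h.monotoneOn hβ hα hle).trans (le_max_left _ _)

theorem densDist_le_of_level {α u : ℝ} (hα : α ∈ Ioo (0 : ℝ) 1) {q₁ q₂ : Y → ℝ≥0∞}
    (hq₁ : IsProbDensity ν q₁) (hq₂ : IsProbDensity ν q₂)
    (h₁ : ∀ x, ENNReal.ofReal (Real.exp (-((1 - α) * u))) ≤
      hell ν α ((W x : Measure Y).rnDeriv ν) q₁)
    (h₂ : ∀ x, ENNReal.ofReal (Real.exp (-((1 - α) * u))) ≤
      hell ν α ((W x : Measure Y).rnDeriv ν) q₂) :
    densDist ν q₁ q₂ ≤ ENNReal.ofReal (4 * √((u - c α) / α)) := by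
  have key : ∀ ε : ℝ, 0 < ε →
      densDist ν q₁ q₂ ≤ ENNReal.ofReal (4 * √((u - (c α - ε)) / α)) := by
    intro ε hε
    obtain ⟨S, hS⟩ := exists_finset_of_lt_augustinCapacity (W := W) h.ac hα.1 hα.2 (c := c α - ε)
      (by rw [h.cap α hα, EReal.coe_lt_coe_iff]; linarith)
    exact densDist_le_of_levels hα.1 hα.2 (fun x => IsProbDensity.rnDeriv (ν := ν) (h.ac x)) hS
      hq₁ hq₂ (fun x _ => h₁ x) (fun x _ => h₂ x)
  have hc : Continuous fun ε : ℝ => ENNReal.ofReal (4 * √((u - (c α - ε)) / α)) :=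
    ENNReal.continuous_ofReal.comp (by fun_prop)
  have hl := (hc.tendsto 0).mono_left (nhdsWithin_le_nhds (s := Ioi 0))
  rw [sub_zero] at hl
  refine ge_of_tendsto hl ?_
  filter_upwards [self_mem_nhdsWithin] with ε hε using key ε hε

/-- Since the divergence increases with the order, the center of the larger order `β` has level `c
β` already at order `α`. Both densities are therefore nearly optimal at order `α` when the
capacities are close. -/
theorem densDist_le {α β : ℝ} (hα : α ∈ Ioo (0 : ℝ) 1) (hβ : β ∈ Ioo (0 : ℝ) 1) (hαβ : α ≤ β)
    {u : ℝ} (hu : c β ≤ u) :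
    densDist ν (q α) (q β) ≤ ENNReal.ofReal (4 * √((u - c α) / α)) := by
  have hmono : ∀ t : ℝ, t ≤ u → ENNReal.ofReal (Real.exp (-((1 - α) * u))) ≤
      ENNReal.ofReal (Real.exp (-((1 - α) * t))) := by
    intro t ht
    refine ENNReal.ofReal_le_ofReal (Real.exp_le_exp.2 ?_)
    have := mul_le_mul_of_nonneg_left ht (by linarith [hα.2] : 0 ≤ 1 - α)
    linarith
  exact h.densDist_le_of_level hα (h.dens α hα) (h.dens β hβ)
    (fun x => (hmono _ ((h.monotoneOn hα hβ hαβ).trans hu)).trans (h.level α hα x))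
    (fun x => (hmono _ hu).trans (exp_le_hell_of_le_order hα.1 hαβ hβ.2
      (IsProbDensity.rnDeriv (h.ac x)) (h.dens β hβ) (h.level β hβ x)))

/-- Uniqueness of the Augustin center, at the level of densities. -/
theorem ae_eq_of_level {α : ℝ} (hα : α ∈ Ioo (0 : ℝ) 1) {q' : Y → ℝ≥0∞}
    (hq' : IsProbDensity ν q') (h' : ∀ x, ENNReal.ofReal (Real.exp (-((1 - α) * c α))) ≤
      hell ν α ((W x : Measure Y).rnDeriv ν) q') : q' =ᵐ[ν] q α := by
  have h0 := h.densDist_le_of_level hα hq' (h.dens α hα) h' (h.level α hα)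
  rw [sub_self, zero_div, Real.sqrt_zero, mul_zero, ENNReal.ofReal_zero, nonpos_iff_eq_zero] at h0
  have hm1 := hq'.1
  have hm2 := (h.dens α hα).1
  rw [densDist, lintegral_eq_zero_iff (by fun_prop)] at h0
  filter_upwards [h0, ae_lt_top hm1 hq'.lintegral_ne_top,
    ae_lt_top hm2 (h.dens α hα).lintegral_ne_top] with y h1 h2 h3
  rw [Pi.zero_apply, enorm_eq_zero, sub_eq_zero] at h1
  exact (ENNReal.toReal_eq_toReal_iff' h2.ne h3.ne).1 h1

theorem tendsto_densDist [Nonempty X] {α : ℝ} (hα : α ∈ Ioo (0 : ℝ) 1) :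
    Tendsto (fun β => densDist ν (q β) (q α)) (𝓝 α) (𝓝 0) := by
  have hc := h.continuousAt hα
  have l1 : Tendsto (fun β => ENNReal.ofReal (4 * √((c β - c α) / α)) +
      ENNReal.ofReal (4 * √((c α - c β) / β))) (𝓝 α) (𝓝 0) := by
    have c1 : ContinuousAt (fun β => 4 * √((c β - c α) / α)) α :=
      continuousAt_const.mul ((hc.sub continuousAt_const).div_const α).sqrt
    have c2 : ContinuousAt (fun β => 4 * √((c α - c β) / β)) α :=
      continuousAt_const.mul ((continuousAt_const.sub hc).div continuousAt_id hα.1.ne').sqrt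
    have := (ENNReal.tendsto_ofReal c1.tendsto).add (ENNReal.tendsto_ofReal c2.tendsto)
    simpa using this
  refine tendsto_of_tendsto_of_tendsto_of_le_of_le' tendsto_const_nhds l1
    (Eventually.of_forall fun _ => zero_le) ?_
  filter_upwards [Ioo_mem_nhds hα.1 hα.2] with β hβ
  rcases le_total α β with hle | hle
  · rw [densDist_comm]
    exact (h.densDist_le hα hβ hle le_rfl).trans le_self_add
  · exact (h.densDist_le hβ hα hle le_rfl).trans le_add_self

theorem tendsto_hell [Nonempty X] {α : ℝ} (hα : α ∈ Ioo (0 : ℝ) 1) {β : ℝ}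
    (hβ : β ∈ Ioo (0 : ℝ) 1) {w : Y → ℝ≥0∞} (hw : IsProbDensity ν w) :
    Tendsto (fun γ => hell ν β w (q γ)) (𝓝 α) (𝓝 (hell ν β w (q α))) := by
  -- Outside (0,1) nothing is known about `q γ`; the patched family consists of densities at every
  -- index.
  set u : ℝ → Y → ℝ≥0∞ := fun γ => if γ ∈ Ioo (0 : ℝ) 1 then q γ else q α with hu
  have hev : ∀ᶠ γ in 𝓝 α, u γ = q γ := by
    filter_upwards [Ioo_mem_nhds hα.1 hα.2] with γ hγ
    simp only [hu]
    rw [if_pos hγ]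
  have hud : ∀ γ, IsProbDensity ν (u γ) := by
    intro γ
    by_cases hγ : γ ∈ Ioo (0 : ℝ) 1
    · simp only [hu, if_pos hγ]; exact h.dens γ hγ
    · simp only [hu, if_neg hγ]; exact h.dens α hα
  have hlim := (h.tendsto_densDist hα).congr' (f₂ := fun γ => densDist ν (u γ) (q α))
    (by filter_upwards [hev] with γ hγ; rw [hγ])
  refine (_root_.tendsto_hell hβ.1.le hβ.2 hw.1 (h.dens α hα).1 (fun γ => (hud γ).1) hw.2.le
    (h.dens α hα).lintegral_ne_top (fun γ => (hud γ).lintegral_ne_top) hlim).congr' ?_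
  filter_upwards [hev] with γ hγ
  rw [hγ]

/-- The capacity of order one is at most any common bound for the capacities of smaller orders. -/
theorem augustinCapacity_one_le [Nonempty X] {R : ℝ} (hR : ∀ α ∈ Ioo (0 : ℝ) 1, c α ≤ R) :
    augustinCapacity 1 W ≤ (R : EReal) := by
  set a : ℕ → ℝ := fun n => 1 - 1 / ((n : ℝ) + 1 + 1) with ha
  have ham : ∀ n, a n ∈ Ioo (0 : ℝ) 1 := fun n => by
    have h1 : (0 : ℝ) < n + 1 + 1 := by positivity
    have h2 : 1 / ((n : ℝ) + 1 + 1) < 1 := by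
      rw [div_lt_one h1]; linarith [(Nat.cast_nonneg n : (0 : ℝ) ≤ n)]
    have h3 : 0 < 1 / ((n : ℝ) + 1 + 1) := by positivity
    exact ⟨by simp only [ha]; linarith, by simp only [ha]; linarith⟩
  have hamono : Monotone a := fun n m hnm => by
    simp only [ha]
    have : (n : ℝ) ≤ m := by exact_mod_cast hnm
    have := one_div_le_one_div_of_le (by positivity : (0 : ℝ) < n + 1 + 1)
      (by linarith : (n : ℝ) + 1 + 1 ≤ m + 1 + 1)
    linarith
  have halim : Tendsto a atTop (𝓝 1) := by
    have := (tendsto_add_atTop_iff_nat 1).2 (tendsto_one_div_add_atTop_nhds_zero_nat (𝕜 := ℝ))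
    have := this.const_sub 1
    simpa [ha] using this
  have hcmono : Monotone fun n => c (a n) := fun n m hnm =>
    h.monotoneOn (ham n) (ham m) (hamono hnm)
  have hbdd : BddAbove (range fun n => c (a n)) := ⟨R, by rintro _ ⟨n, rfl⟩; exact hR _ (ham n)⟩
  set s := ⨆ n, c (a n) with hs
  have hsl : Tendsto (fun n => c (a n)) atTop (𝓝 s) := tendsto_atTop_ciSup hcmono hbdd
  have hcs : ∀ n, c (a n) ≤ s := fun n => le_ciSup hbdd n
  have hB : Tendsto (fun n => ENNReal.ofReal (4 * √((s - c (a n)) / a n))) atTop (𝓝 0) := by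
    have l1 := ((hsl.const_sub s).div halim one_ne_zero)
    have l2 := (Real.continuous_sqrt.tendsto _).comp l1
    have l3 := ENNReal.tendsto_ofReal (l2.const_mul 4)
    simpa using l3
  obtain ⟨Q, hQ, hlim⟩ := exists_tendsto_densDist (fun n => h.dens (a n) (ham n)) hB
    fun n m hnm => h.densDist_le (ham n) (ham m) (hamono hnm) (hcs m)
  have hw := fun x => IsProbDensity.rnDeriv (ν := ν) (h.ac x)
  -- The L¹ limit `Q` of the centers along orders tending to 1 is the order-one competitor: at each
  -- fixed `β < 1` it inherits the level `R`.
  refine augustinCapacity_le hQ.toProb fun x => renyiDiv_one_le_of_hell_ge (h.ac x) hQ fun β hβ => ?_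
  have hH := _root_.tendsto_hell hβ.1.le hβ.2 (hw x).1 hQ.1 (fun n => (h.dens (a n) (ham n)).1)
    (hw x).2.le hQ.lintegral_ne_top (fun n => (h.dens (a n) (ham n)).lintegral_ne_top) hlim
  refine ge_of_tendsto hH ?_
  filter_upwards [halim.eventually (lt_mem_nhds hβ.2)] with n hn
  refine le_trans (ENNReal.ofReal_le_ofReal (Real.exp_le_exp.2 ?_))
    (exp_le_hell_of_le_order hβ.1 hn.le (ham n).2 (hw x) (h.dens (a n) (ham n))
      (h.level (a n) (ham n) x))
  have := mul_le_mul_of_nonneg_left (hR _ (ham n)) (by linarith [hβ.2] : 0 ≤ 1 - β)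
  linarith

end IsCenterFamily

end CenterFamily

/-! ### Symmetry determines the Hellinger integrals -/

section Symmetry

variable {Y : Type*} [MeasurableSpace Y] {ν : Measure Y} [IsProbabilityMeasure ν]

theorem hell_eq_lintegral_div {β : ℝ} (h0 : 0 < β) (h1 : β < 1) {P : Measure Y}
    [IsProbabilityMeasure P] (hP : P ≪ ν) {q : Y → ℝ≥0∞} (hq : Measurable q) :
    hell ν β (P.rnDeriv ν) q = ∫⁻ y, (q y / P.rnDeriv ν y) ^ (1 - β) ∂P := by
  have hm : Measurable fun y => (q y / P.rnDeriv ν y) ^ (1 - β) := by fun_prop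
  rw [← lintegral_rnDeriv_mul hP hm.aemeasurable]
  refine lintegral_congr_ae ?_
  filter_upwards [Measure.rnDeriv_lt_top P ν] with y hy
  by_cases hw : P.rnDeriv ν y = 0
  · simp [hw, h0]
  have e : P.rnDeriv ν y ^ β = P.rnDeriv ν y * P.rnDeriv ν y ^ (-(1 - β)) := by
    nth_rewrite 2 [← ENNReal.rpow_one (P.rnDeriv ν y)]
    rw [← ENNReal.rpow_add _ _ hw hy.ne]
    ring_nf
  rw [ENNReal.div_rpow_of_nonneg _ _ (by linarith), e, ENNReal.rpow_neg, div_eq_mul_inv]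
  ring

/-- The ratio is taken as `q / w` because `w` is positive and finite almost surely under `P`, so no
0/0 or ∞/∞ arises. The symmetry events are then its tails. -/
theorem map_div_rnDeriv_eq {P P' : Measure Y} [IsProbabilityMeasure P] [IsProbabilityMeasure P']
    (hP : P ≪ ν) (hP' : P' ≪ ν) {q : Y → ℝ≥0∞} (hq : Measurable q) (hq1 : ∫⁻ y, q y ∂ν ≠ ∞)
    (h : ∀ s : ℝ, P {y | P.rnDeriv ν y ≤ ENNReal.ofReal (Real.exp s) * q y} =
      P' {y | P'.rnDeriv ν y ≤ ENNReal.ofReal (Real.exp s) * q y}) :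
    P.map (fun y => q y / P.rnDeriv ν y) = P'.map fun y => q y / P'.rnDeriv ν y := by
  have hm : Measurable fun y => q y / P.rnDeriv ν y := by fun_prop
  have hm' : Measurable fun y => q y / P'.rnDeriv ν y := by fun_prop
  have : IsProbabilityMeasure (P.map fun y => q y / P.rnDeriv ν y) :=
    Measure.isProbabilityMeasure_map hm.aemeasurable
  -- The tail at level `t` is the symmetry event with `s = -log t`. The levels 0 and ∞ correspond to
  -- no real `s` and have probability 1 and 0.
  have key : ∀ (P : Measure Y) [IsProbabilityMeasure P], P ≪ ν → ∀ t : ℝ≥0∞,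
      P ((fun y => q y / P.rnDeriv ν y) ⁻¹' Ici t) =
        if t = 0 then 1 else if t = ∞ then 0 else
          P {y | P.rnDeriv ν y ≤ ENNReal.ofReal (Real.exp (-Real.log t.toReal)) * q y} := by
    intro P _ hP t
    by_cases ht0 : t = 0
    · simp [ht0]
    have hpos : ∀ᵐ y ∂P, 0 < P.rnDeriv ν y := Measure.rnDeriv_pos hP
    have hlt : ∀ᵐ y ∂P, P.rnDeriv ν y < ∞ := hP.ae_le (Measure.rnDeriv_lt_top P ν)
    have hqlt : ∀ᵐ y ∂P, q y < ∞ := hP.ae_le (ae_lt_top hq hq1)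
    by_cases htt : t = ∞
    · rw [if_neg ht0, if_pos htt, htt]
      rw [measure_eq_zero_iff_ae_notMem]
      filter_upwards [hpos, hqlt] with y h1 h2
      simp only [mem_preimage, mem_Ici, top_le_iff]
      exact (ENNReal.div_lt_top h2.ne h1.ne').ne
    · rw [if_neg ht0, if_neg htt]
      refine measure_congr ?_
      filter_upwards [hpos, hlt] with y h1 h2
      refine propext ?_
      have htr := ENNReal.toReal_pos ht0 htt
      have e : ENNReal.ofReal (Real.exp (-Real.log t.toReal)) = t⁻¹ := by
        rw [Real.exp_neg, Real.exp_log htr, ENNReal.ofReal_inv_of_pos htr,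
          ENNReal.ofReal_toReal htt]
      change t ≤ q y / P.rnDeriv ν y ↔ P.rnDeriv ν y ≤ _ * q y
      rw [e, ENNReal.le_div_iff_mul_le (Or.inl h1.ne') (Or.inl h2.ne), mul_comm t⁻¹,
        ← div_eq_mul_inv, ENNReal.le_div_iff_mul_le (Or.inl ht0) (Or.inl htt), mul_comm]
  refine Measure.ext_of_Ici _ _ fun t => ?_
  rw [Measure.map_apply hm measurableSet_Ici, Measure.map_apply hm' measurableSet_Ici, key P hP,
    key P' hP', h]

theorem hell_eq_of_forall_measure_eq {β : ℝ} (h0 : 0 < β) (h1 : β < 1) {P P' : Measure Y}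
    [IsProbabilityMeasure P] [IsProbabilityMeasure P'] (hP : P ≪ ν) (hP' : P' ≪ ν) {q : Y → ℝ≥0∞}
    (hq : Measurable q) (hq1 : ∫⁻ y, q y ∂ν ≠ ∞)
    (h : ∀ s : ℝ, P {y | P.rnDeriv ν y ≤ ENNReal.ofReal (Real.exp s) * q y} =
      P' {y | P'.rnDeriv ν y ≤ ENNReal.ofReal (Real.exp s) * q y}) :
    hell ν β (P.rnDeriv ν) q = hell ν β (P'.rnDeriv ν) q := by
  have hm : Measurable fun z : ℝ≥0∞ => z ^ (1 - β) := by fun_prop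
  rw [hell_eq_lintegral_div h0 h1 hP hq, hell_eq_lintegral_div h0 h1 hP' hq]
  have e1 := lintegral_map (μ := P) hm (g := fun y => q y / P.rnDeriv ν y) (by fun_prop)
  have e2 := lintegral_map (μ := P') hm (g := fun y => q y / P'.rnDeriv ν y) (by fun_prop)
  rw [← e1, ← e2, map_div_rnDeriv_eq hP hP' hq hq1 h]

end Symmetry

/-! ### Tilted measures and the cumulant generating function -/

section Tilting

open ProbabilityTheory

variable {Y : Type*} [MeasurableSpace Y] {ν : Measure Y}

/-- The logarithm of the ratio of two densities. -/
noncomputable def logRatio (w q : Y → ℝ≥0∞) (y : Y) : ℝ := Real.log ((w y).toReal / (q y).toReal)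

@[fun_prop]
theorem measurable_logRatio {w q : Y → ℝ≥0∞} (hw : Measurable w) (hq : Measurable q) :
    Measurable (logRatio w q) := by
  unfold logRatio; fun_prop

/-- The restriction of the measure with density `q` to the set where `w` does not vanish. -/
noncomputable def suppMeasure (ν : Measure Y) (w q : Y → ℝ≥0∞) : Measure Y :=
  ν.withDensity ({y | w y ≠ 0}.indicator q)

/-- The logarithm of the Hellinger integral. -/
noncomputable def logHell (ν : Measure Y) (w q : Y → ℝ≥0∞) (β : ℝ) : ℝ :=
  Real.log (hell ν β w q).toReal

theorem ofReal_exp_mul_logRatio {a b : ℝ≥0∞} (ha0 : a ≠ 0) (ha : a ≠ ∞) (hb0 : b ≠ 0) (hb : b ≠ ∞)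
    (β : ℝ) :
    ENNReal.ofReal (Real.exp (β * Real.log (a.toReal / b.toReal))) = a ^ β * b ^ (-β) := by
  have ha' := ENNReal.toReal_pos ha0 ha
  have hb' := ENNReal.toReal_pos hb0 hb
  nth_rewrite 2 [← ENNReal.ofReal_toReal ha]
  nth_rewrite 2 [← ENNReal.ofReal_toReal hb]
  rw [ENNReal.ofReal_rpow_of_pos ha', ENNReal.ofReal_rpow_of_pos hb',
    ← ENNReal.ofReal_mul (by positivity), Real.rpow_def_of_pos ha', Real.rpow_def_of_pos hb',
    ← Real.exp_add, Real.log_div ha'.ne' hb'.ne']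
  ring_nf

namespace IsProbDensity

variable {w q : Y → ℝ≥0∞} (hw : IsProbDensity ν w) (hq : IsProbDensity ν q)
include hw hq

theorem measurable_indicator : Measurable ({y | w y ≠ 0}.indicator q) :=
  hq.1.indicator (hw.1 (measurableSet_singleton 0).compl)

/-- Makes the Hellinger integral a moment generating function. Restricting to the support of `w`
corrects the convention `Real.log 0 = 0`, by which the exponential would be 1 where `w` vanishes;
zeros of `q` are already null. -/
theorem withDensity_exp_logRatio {β : ℝ} (h0 : 0 < β) (h1 : β < 1) :
    (suppMeasure ν w q).withDensity (fun y => ENNReal.ofReal (Real.exp (β * logRatio w q y))) =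
      ν.withDensity fun y => w y ^ β * q y ^ (1 - β) := by
  have hX := measurable_logRatio hw.1 hq.1
  rw [suppMeasure, ← withDensity_mul _ (hw.measurable_indicator hq) (by fun_prop)]
  refine withDensity_congr_ae ?_
  filter_upwards [ae_lt_top hw.1 hw.lintegral_ne_top, ae_lt_top hq.1 hq.lintegral_ne_top]
    with y hwy hqy
  rw [Pi.mul_apply]
  by_cases hw0 : w y = 0
  · simp [hw0, h0]
  by_cases hq0 : q y = 0
  · simp [hq0, h1, hw0]
  rw [indicator_of_mem (show y ∈ {y | w y ≠ 0} from hw0), logRatio,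
    ofReal_exp_mul_logRatio hw0 hwy.ne hq0 hqy.ne, sub_eq_add_neg, ENNReal.rpow_add _ _ hq0 hqy.ne,
    ENNReal.rpow_one]
  ring

theorem lintegral_exp_logRatio {β : ℝ} (h0 : 0 < β) (h1 : β < 1) :
    ∫⁻ y, ENNReal.ofReal (Real.exp (β * logRatio w q y)) ∂(suppMeasure ν w q) = hell ν β w q := by
  have := congrArg (fun m : Measure Y => m univ) (hw.withDensity_exp_logRatio hq h0 h1)
  simpa [withDensity_apply, hell] using this

theorem integrable_exp_logRatio {β : ℝ} (h0 : 0 < β) (h1 : β < 1) :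
    Integrable (fun y => Real.exp (β * logRatio w q y)) (suppMeasure ν w q) := by
  have hX := measurable_logRatio hw.1 hq.1
  refine ⟨by fun_prop, ?_⟩
  rw [hasFiniteIntegral_iff_ofReal (Eventually.of_forall fun y => (Real.exp_pos _).le),
    hw.lintegral_exp_logRatio hq h0 h1]
  exact (hw.hell_ne_top h0.le h1.le hq).lt_top

theorem mgf_logRatio {β : ℝ} (h0 : 0 < β) (h1 : β < 1) :
    mgf (logRatio w q) (suppMeasure ν w q) β = (hell ν β w q).toReal := by
  have hX := measurable_logRatio hw.1 hq.1
  rw [mgf, integral_eq_lintegral_of_nonneg_ae (Eventually.of_forall fun y => (Real.exp_pos _).le)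
    (by fun_prop), hw.lintegral_exp_logRatio hq h0 h1]

theorem mem_interior_integrableExpSet {β : ℝ} (h0 : 0 < β) (h1 : β < 1) :
    β ∈ interior (integrableExpSet (logRatio w q) (suppMeasure ν w q)) :=
  mem_interior.2 ⟨Ioo 0 1, fun _ ht => hw.integrable_exp_logRatio hq ht.1 ht.2, isOpen_Ioo, h0, h1⟩

/-- Being the integral of a positive function, the Hellinger integral vanishes only if `suppMeasure`
is zero, a condition free of the order. -/
theorem hell_pos_iff {α β : ℝ} (hα : α ∈ Ioo (0 : ℝ) 1) (hβ : β ∈ Ioo (0 : ℝ) 1)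
    (h : hell ν α w q ≠ 0) : hell ν β w q ≠ 0 := by
  rw [← hw.lintegral_exp_logRatio hq hα.1 hα.2] at h
  rw [← hw.lintegral_exp_logRatio hq hβ.1 hβ.2]
  have hX := measurable_logRatio hw.1 hq.1
  contrapose! h
  rw [lintegral_eq_zero_iff (by fun_prop)] at h ⊢
  filter_upwards [h] with y hy
  simp only [Pi.zero_apply, ENNReal.ofReal_eq_zero] at hy
  exact absurd hy (not_le.2 (Real.exp_pos _))

theorem cgf_logRatio {β : ℝ} (h0 : 0 < β) (h1 : β < 1) :
    cgf (logRatio w q) (suppMeasure ν w q) β = logHell ν w q β := by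
  rw [cgf, hw.mgf_logRatio hq h0 h1, logHell]

/-- The tilted probability measure of order `α`, as an exponential tilt. -/
theorem tilted_eq_withDensity {α : ℝ} (h0 : 0 < α) (h1 : α < 1) (h : hell ν α w q ≠ 0) :
    (suppMeasure ν w q).tilted (fun y => α * logRatio w q y) =
      (hell ν α w q)⁻¹ • ν.withDensity fun y => w y ^ α * q y ^ (1 - α) := by
  have hX := measurable_logRatio hw.1 hq.1
  have hfin := hw.hell_ne_top h0.le h1.le hq
  have hpos := ENNReal.toReal_pos h hfin
  rw [← hw.withDensity_exp_logRatio hq h0 h1, ← withDensity_smul _ (by fun_prop), Measure.tilted]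
  congr 1
  ext y
  have e := hw.mgf_logRatio hq h0 h1
  rw [mgf] at e
  rw [e, ENNReal.ofReal_div_of_pos hpos, ENNReal.ofReal_toReal hfin, Pi.smul_apply, smul_eq_mul,
    div_eq_mul_inv, mul_comm]

theorem isProbabilityMeasure_tilted {α : ℝ} (h0 : 0 < α) (h1 : α < 1) (h : hell ν α w q ≠ 0) :
    IsProbabilityMeasure ((suppMeasure ν w q).tilted fun y => α * logRatio w q y) := by
  have : NeZero (suppMeasure ν w q) := ⟨fun h0' => h (by
    rw [← hw.lintegral_exp_logRatio hq h0 h1, h0', lintegral_zero_measure])⟩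
  exact MeasureTheory.isProbabilityMeasure_tilted (hw.integrable_exp_logRatio hq h0 h1)

theorem ae_tilted {α : ℝ} (h0 : 0 < α) (h1 : α < 1) (h : hell ν α w q ≠ 0) :
    ∀ᵐ y ∂((suppMeasure ν w q).tilted fun y => α * logRatio w q y),
      w y ≠ 0 ∧ w y ≠ ∞ ∧ q y ≠ 0 ∧ q y ≠ ∞ := by
  rw [hw.tilted_eq_withDensity hq h0 h1 h]
  refine Measure.ae_smul_measure ?_ _
  have hwm := hw.1
  have hqm := hq.1
  rw [ae_withDensity_iff (by fun_prop)]
  filter_upwards [ae_lt_top hw.1 hw.lintegral_ne_top, ae_lt_top hq.1 hq.lintegral_ne_top]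
    with y hwy hqy hne
  refine ⟨fun h2 => hne ?_, hwy.ne, fun h2 => hne ?_, hqy.ne⟩
  · simp [h2, h0]
  · simp [h2, h1]

theorem integrable_logRatio_tilted {α : ℝ} (h0 : 0 < α) (h1 : α < 1) :
    Integrable (logRatio w q) ((suppMeasure ν w q).tilted fun y => α * logRatio w q y) :=
  memLp_one_iff_integrable.1 (by
    exact_mod_cast memLp_tilted_mul (hw.mem_interior_integrableExpSet hq h0 h1) 1)

theorem hasDerivAt_logHell {α : ℝ} (h0 : 0 < α) (h1 : α < 1) :
    HasDerivAt (logHell ν w q)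
      (∫ y, logRatio w q y ∂((suppMeasure ν w q).tilted fun y => α * logRatio w q y)) α := by
  have hint := hw.mem_interior_integrableExpSet hq h0 h1
  rw [integral_tilted_mul_self hint]
  refine ((analyticAt_cgf hint).differentiableAt.hasDerivAt).congr_of_eventuallyEq ?_
  filter_upwards [Ioo_mem_nhds h0 h1] with β hβ
  rw [hw.cgf_logRatio hq hβ.1 hβ.2]

theorem integral_exp_tilted {α β : ℝ} (h0 : 0 < α) (h1 : α < 1) (hβ0 : 0 < β) (hβ1 : β < 1) :
    Integrable (fun y => Real.exp ((β - α) * logRatio w q y))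
      ((suppMeasure ν w q).tilted fun y => α * logRatio w q y) ∧
    ∫ y, Real.exp ((β - α) * logRatio w q y)
      ∂((suppMeasure ν w q).tilted fun y => α * logRatio w q y) =
      (hell ν β w q).toReal / (hell ν α w q).toReal := by
  have e : ∀ y, Real.exp (α * logRatio w q y) * Real.exp ((β - α) * logRatio w q y) =
      Real.exp (β * logRatio w q y) := fun y => by rw [← Real.exp_add]; ring_nf
  constructor
  · rw [integrable_tilted_iff (hw.integrable_exp_logRatio hq h0 h1)]
    simpa only [smul_eq_mul, e] using hw.integrable_exp_logRatio hq hβ0 hβ1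
  · rw [integral_tilted_mul_eq_mgf, hw.mgf_logRatio hq h0 h1, ← hw.mgf_logRatio hq hβ0 hβ1, mgf,
      ← integral_div]
    refine integral_congr_ae (Eventually.of_forall fun y => ?_)
    simp only [smul_eq_mul]
    rw [← e y]
    ring

/-- The tangent inequality for the convex function `logHell`. -/
theorem logHell_ge_tangent {α β : ℝ} (h0 : 0 < α) (h1 : α < 1) (hβ0 : 0 < β) (hβ1 : β < 1)
    (h : hell ν α w q ≠ 0) :
    logHell ν w q α +
      (∫ y, logRatio w q y ∂((suppMeasure ν w q).tilted fun y => α * logRatio w q y)) * (β - α) ≤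
        logHell ν w q β ∧
    (β ≠ α → logHell ν w q α +
      (∫ y, logRatio w q y ∂((suppMeasure ν w q).tilted fun y => α * logRatio w q y)) * (β - α) =
        logHell ν w q β →
      ∀ᵐ y ∂((suppMeasure ν w q).tilted fun y => α * logRatio w q y), logRatio w q y =
        ∫ y, logRatio w q y ∂((suppMeasure ν w q).tilted fun y => α * logRatio w q y)) := by
  have hprob := hw.isProbabilityMeasure_tilted hq h0 h1 h
  obtain ⟨i1, e1⟩ := hw.integral_exp_tilted hq h0 h1 hβ0 hβ1
  have i2 := hw.integrable_logRatio_tilted hq h0 h1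
  set v := (suppMeasure ν w q).tilted fun y => α * logRatio w q y
  set E := ∫ y, logRatio w q y ∂v with hE
  -- Jensen's inequality by the tangent of exp at the mean `k`, kept in pointwise form so that the
  -- case of equality can be read off.
  set k := (β - α) * E with hk
  have hHα := ENNReal.toReal_pos h (hw.hell_ne_top h0.le h1.le hq)
  have hHβ := ENNReal.toReal_pos (hw.hell_pos_iff hq ⟨h0, h1⟩ ⟨hβ0, hβ1⟩ h)
    (hw.hell_ne_top hβ0.le hβ1.le hq)
  have i4 : Integrable (fun y => (β - α) * logRatio w q y - k) v :=
    (i2.const_mul (β - α)).sub (integrable_const k)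
  have i3 : Integrable (fun y => Real.exp k * ((β - α) * logRatio w q y - k + 1)) v :=
    (i4.add (integrable_const 1)).const_mul (Real.exp k)
  have e3 : ∫ y, Real.exp k * ((β - α) * logRatio w q y - k + 1) ∂v = Real.exp k := by
    rw [integral_const_mul, integral_add i4 (integrable_const 1),
      integral_sub (i2.const_mul (β - α)) (integrable_const k), integral_const_mul, ← hE, ← hk]
    simp
  have hpt : ∀ y, Real.exp k * ((β - α) * logRatio w q y - k + 1) ≤
      Real.exp ((β - α) * logRatio w q y) := by
    intro y
    have : Real.exp ((β - α) * logRatio w q y) =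
        Real.exp k * Real.exp ((β - α) * logRatio w q y - k) := by
      rw [← Real.exp_add]; ring_nf
    rw [this]
    exact mul_le_mul_of_nonneg_left (Real.add_one_le_exp _) (Real.exp_pos _).le
  have hdiff : logHell ν w q β - logHell ν w q α =
      Real.log ((hell ν β w q).toReal / (hell ν α w q).toReal) := by
    rw [Real.log_div hHβ.ne' hHα.ne', logHell, logHell]
  have hle : Real.exp k ≤ (hell ν β w q).toReal / (hell ν α w q).toReal := by
    rw [← e3, ← e1]
    exact integral_mono i3 i1 hpt
  constructor
  · have := (Real.le_log_iff_exp_le (div_pos hHβ hHα)).2 hle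
    rw [hk] at this
    linarith
  · intro hne heq
    have hk' : k = Real.log ((hell ν β w q).toReal / (hell ν α w q).toReal) := by
      rw [← hdiff, hk]; linarith
    have hkexp : Real.exp k = (hell ν β w q).toReal / (hell ν α w q).toReal := by
      rw [hk', Real.exp_log (div_pos hHβ hHα)]
    -- Equal integrals turn the pointwise tangent bound into an almost sure equality, and `1 + t =
    -- exp t` only at `t = 0`.
    have hae := (integral_eq_iff_of_ae_le i3 i1 (Eventually.of_forall hpt)).1
      (by rw [e3, e1, hkexp])
    filter_upwards [hae] with y hy
    by_contra hcon
    have hne' : (β - α) * logRatio w q y - k ≠ 0 := by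
      rw [hk, ← mul_sub]
      exact mul_ne_zero (sub_ne_zero.2 hne) (sub_ne_zero.2 hcon)
    have h2 := Real.add_one_lt_exp hne'
    have h3 : Real.exp ((β - α) * logRatio w q y) =
        Real.exp k * Real.exp ((β - α) * logRatio w q y - k) := by
      rw [← Real.exp_add]; ring_nf
    rw [h3] at hy
    have := mul_left_cancel₀ (Real.exp_pos k).ne' hy
    linarith

end IsProbDensity

theorem renyiDiv_one_withDensity {Q v : Measure Y} [IsProbabilityMeasure Q] [IsProbabilityMeasure v]
    {f : Y → ℝ≥0∞} (hf : Measurable f) (hv : v = Q.withDensity f) {g : Y → ℝ}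
    (hg : Integrable g v) (hfg : ∀ᵐ y ∂v, Real.log (f y).toReal = g y) :
    renyiDiv 1 v Q = ((∫ y, g y ∂v : ℝ) : EReal) := by
  have hac : v ≪ Q := hv ▸ withDensity_absolutelyContinuous _ _
  have hllr : llr v Q =ᵐ[v] g := by
    have h2 : v.rnDeriv Q =ᵐ[Q] f := by
      rw [hv]; exact Measure.rnDeriv_withDensity Q hf
    filter_upwards [hac.ae_le h2, hfg] with y h3 h4
    rw [llr, h3, h4]
  rw [renyiDiv_one_eq_integral_llr hac (hg.congr hllr.symm), integral_congr_ae hllr]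

namespace IsProbDensity

variable {w q : Y → ℝ≥0∞} (hw : IsProbDensity ν w) (hq : IsProbDensity ν q)
include hw hq

/-- The tilt has log-density `α * logRatio - logHell` relative to `q`; relative to `w`, in the
companion statement, `α` becomes `α - 1`. -/
theorem renyiDiv_one_tilted_right {α : ℝ} (h0 : 0 < α) (h1 : α < 1) (h : hell ν α w q ≠ 0) :
    renyiDiv 1 ((suppMeasure ν w q).tilted fun y => α * logRatio w q y) (ν.withDensity q) =
      ((α * (∫ y, logRatio w q y ∂((suppMeasure ν w q).tilted fun y => α * logRatio w q y)) -
        logHell ν w q α : ℝ) : EReal) := by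
  have hprob := hw.isProbabilityMeasure_tilted hq h0 h1 h
  have := hq.isProbabilityMeasure
  have i2 := hw.integrable_logRatio_tilted hq h0 h1
  have hae := hw.ae_tilted hq h0 h1 h
  have hX := measurable_logRatio hw.1 hq.1
  have hHα := ENNReal.toReal_pos h (hw.hell_ne_top h0.le h1.le hq)
  have hS : MeasurableSet {y | w y ≠ 0} := hw.1 (measurableSet_singleton 0).compl
  have hfm : Measurable ({y | w y ≠ 0}.indicator fun y => ENNReal.ofReal
      (Real.exp (α * logRatio w q y) / (hell ν α w q).toReal)) :=
    Measurable.indicator (by fun_prop) hS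
  have hv : (suppMeasure ν w q).tilted (fun y => α * logRatio w q y) =
      (ν.withDensity q).withDensity ({y | w y ≠ 0}.indicator fun y => ENNReal.ofReal
        (Real.exp (α * logRatio w q y) / (hell ν α w q).toReal)) := by
    rw [← withDensity_mul _ hq.1 hfm, Measure.tilted, suppMeasure,
      ← withDensity_mul _ (hw.measurable_indicator hq) (by fun_prop)]
    have e := hw.mgf_logRatio hq h0 h1
    rw [mgf, suppMeasure] at e
    rw [e]
    congr 1
    ext y
    by_cases hy : w y = 0 <;> simp [hy]
  rw [renyiDiv_one_withDensity hfm hv (g := fun y => α * logRatio w q y - logHell ν w q α)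
    ((i2.const_mul α).sub (integrable_const _)), integral_sub (i2.const_mul α) (integrable_const _),
    integral_const_mul]
  · simp
  · filter_upwards [hae] with y hy
    rw [indicator_of_mem (show y ∈ {y | w y ≠ 0} from hy.1), ENNReal.toReal_ofReal (by positivity),
      Real.log_div (Real.exp_pos _).ne' hHα.ne', Real.log_exp, logHell]

theorem renyiDiv_one_tilted_left {α : ℝ} (h0 : 0 < α) (h1 : α < 1) (h : hell ν α w q ≠ 0) :
    renyiDiv 1 ((suppMeasure ν w q).tilted fun y => α * logRatio w q y) (ν.withDensity w) =
      (((α - 1) * (∫ y, logRatio w q y ∂((suppMeasure ν w q).tilted fun y => α * logRatio w q y)) -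
        logHell ν w q α : ℝ) : EReal) := by
  have hprob := hw.isProbabilityMeasure_tilted hq h0 h1 h
  have := hw.isProbabilityMeasure
  have i2 := hw.integrable_logRatio_tilted hq h0 h1
  have hae := hw.ae_tilted hq h0 h1 h
  have hX := measurable_logRatio hw.1 hq.1
  have hwm := hw.1
  have hqm := hq.1
  have hfin := hw.hell_ne_top h0.le h1.le hq
  have hHα := ENNReal.toReal_pos h hfin
  have hS : MeasurableSet {y | q y ≠ 0} := hq.1 (measurableSet_singleton 0).compl
  have hfm : Measurable ({y | q y ≠ 0}.indicator fun y => ENNReal.ofReal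
      (Real.exp ((α - 1) * logRatio w q y) / (hell ν α w q).toReal)) :=
    Measurable.indicator (by fun_prop) hS
  have hv : (suppMeasure ν w q).tilted (fun y => α * logRatio w q y) =
      (ν.withDensity w).withDensity ({y | q y ≠ 0}.indicator fun y => ENNReal.ofReal
        (Real.exp ((α - 1) * logRatio w q y) / (hell ν α w q).toReal)) := by
    rw [hw.tilted_eq_withDensity hq h0 h1 h, ← withDensity_mul _ hw.1 hfm,
      ← withDensity_smul _ (by fun_prop)]
    refine withDensity_congr_ae ?_
    filter_upwards [ae_lt_top hw.1 hw.lintegral_ne_top, ae_lt_top hq.1 hq.lintegral_ne_top]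
      with y hwy hqy
    rw [Pi.mul_apply, Pi.smul_apply, smul_eq_mul]
    by_cases hw0 : w y = 0
    · simp [hw0, h0]
    by_cases hq0 : q y = 0
    · simp [hq0, h1]
    rw [indicator_of_mem (show y ∈ {y | q y ≠ 0} from hq0), ENNReal.ofReal_div_of_pos hHα,
      ENNReal.ofReal_toReal hfin, logRatio, ofReal_exp_mul_logRatio hw0 hwy.ne hq0 hqy.ne,
      neg_sub, div_eq_mul_inv]
    have e : w y ^ α = w y * w y ^ (α - 1) := by
      nth_rewrite 2 [← ENNReal.rpow_one (w y)]
      rw [← ENNReal.rpow_add _ _ hw0 hwy.ne]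
      ring_nf
    rw [e]
    ring
  rw [renyiDiv_one_withDensity hfm hv (g := fun y => (α - 1) * logRatio w q y - logHell ν w q α)
    ((i2.const_mul (α - 1)).sub (integrable_const _)),
    integral_sub (i2.const_mul (α - 1)) (integrable_const _), integral_const_mul]
  · simp
  · filter_upwards [hae] with y hy
    rw [indicator_of_mem (show y ∈ {y | q y ≠ 0} from hy.2.2.1), ENNReal.toReal_ofReal
      (by positivity), Real.log_div (Real.exp_pos _).ne' hHα.ne', Real.log_exp, logHell]

end IsProbDensity

end Tilting

/-! ### Real analysis of tangents and conjugates -/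

section RealAnalysis

/-- The supergradient inequality, in the variable `1 / β`, for the function `β ↦ -Φ β / β`. -/
theorem neg_div_le_of_tangent {a b D α β : ℝ} (hα : 0 < α) (hβ : 0 < β)
    (h : a + D * (β - α) ≤ b) :
    -b / β ≤ -a / α + (α * D - a) * (1 / β - 1 / α) := by
  have e : -a / α + (α * D - a) * (1 / β - 1 / α) = -(a + D * (β - α)) / β := by
    field_simp; ring
  rw [e]
  gcongr

theorem neg_div_lt_of_tangent {a b D α β : ℝ} (hα : 0 < α) (hβ : 0 < β)
    (h : a + D * (β - α) < b) :
    -b / β < -a / α + (α * D - a) * (1 / β - 1 / α) := by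
  have e : -a / α + (α * D - a) * (1 / β - 1 / α) = -(a + D * (β - α)) / β := by
    field_simp; ring
  rw [e]
  gcongr

/-- The slope `d γ` is bounded, from above for `β > γ` and from below for `β < γ`, by the chord
slope of `Φ γ` from `γ` to a fixed `β`. These chord slopes are continuous in `γ`, and at `γ = α`
they approach `d α` as `β → α`. -/
theorem continuousAt_deriv_of_tangents {Φ : ℝ → ℝ → ℝ} {d : ℝ → ℝ} {I : Set ℝ} (hI : IsOpen I)
    (htan : ∀ α ∈ I, ∀ β ∈ I, Φ α α + d α * (β - α) ≤ Φ α β)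
    (hder : ∀ α ∈ I, HasDerivAt (Φ α) (d α) α)
    (hcont : ∀ α ∈ I, ∀ β ∈ I, Tendsto (fun γ => Φ γ β) (𝓝 α) (𝓝 (Φ α β)))
    (hdiag : ∀ α ∈ I, ContinuousAt (fun γ => Φ γ γ) α) {α : ℝ} (hα : α ∈ I) :
    ContinuousAt d α := by
  have hslope := (hder α hα).tendsto_slope
  have hmem := hI.mem_nhds hα
  have hq : ∀ β ∈ I, β ≠ α → Tendsto (fun γ => (Φ γ β - Φ γ γ) / (β - γ)) (𝓝 α)
      (𝓝 (slope (Φ α) α β)) := by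
    intro β hβ hne
    rw [slope_def_field]
    exact ((hcont α hα β hβ).sub (hdiag α hα)).div (tendsto_const_nhds.sub tendsto_id)
      (sub_ne_zero.2 hne)
  refine tendsto_order.2 ⟨fun l hl => ?_, fun u hu => ?_⟩
  · have h1 := (hslope.mono_left (nhdsLT_le_nhdsNE α)).eventually (lt_mem_nhds hl)
    have h2 : ∀ᶠ β in 𝓝[<] α, β ∈ I := nhdsWithin_le_nhds hmem
    obtain ⟨β, hβ1, hβI, hβ⟩ := (h1.and (h2.and self_mem_nhdsWithin)).exists
    filter_upwards [(hq β hβI (ne_of_lt hβ)).eventually (lt_mem_nhds hβ1), hmem, lt_mem_nhds hβ]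
      with γ h3 hγ h4
    have h5 := htan γ hγ β hβI
    refine h3.trans_le ?_
    rw [div_le_iff_of_neg (by linarith)]
    linarith
  · have h1 := (hslope.mono_left (nhdsGT_le_nhdsNE α)).eventually (gt_mem_nhds hu)
    have h2 : ∀ᶠ β in 𝓝[>] α, β ∈ I := nhdsWithin_le_nhds hmem
    obtain ⟨β, hβ1, hβI, hβ⟩ := (h1.and (h2.and self_mem_nhdsWithin)).exists
    filter_upwards [(hq β hβI (ne_of_gt hβ)).eventually (gt_mem_nhds hβ1), hmem, gt_mem_nhds hβ]
      with γ h3 hγ h4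
    have h5 := htan γ hγ β hβI
    refine lt_of_le_of_lt ?_ h3
    rw [le_div_iff₀ (by linarith)]
    linarith

theorem exists_order_of_tangents {Φ : ℝ → ℝ → ℝ} {c d : ℝ → ℝ} {R M : ℝ}
    (htan : ∀ α ∈ Ioo (0 : ℝ) 1, ∀ β ∈ Ioo (0 : ℝ) 1, Φ α α + d α * (β - α) ≤ Φ α β)
    (hder : ∀ α ∈ Ioo (0 : ℝ) 1, HasDerivAt (Φ α) (d α) α)
    (hcont : ∀ α ∈ Ioo (0 : ℝ) 1, ∀ β ∈ Ioo (0 : ℝ) 1,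
      Tendsto (fun γ => Φ γ β) (𝓝 α) (𝓝 (Φ α β)))
    (hdiag : ∀ α ∈ Ioo (0 : ℝ) 1, -Φ α α = (1 - α) * c α)
    (hle : ∀ α ∈ Ioo (0 : ℝ) 1, ∀ β ∈ Ioo (0 : ℝ) 1, (1 - β) * c β ≤ -Φ α β)
    (hc : ∀ α ∈ Ioo (0 : ℝ) 1, ContinuousAt c α) (hc0 : ∀ α ∈ Ioo (0 : ℝ) 1, 0 ≤ c α)
    (hcM : ∀ α ∈ Ioo (0 : ℝ) 1, c α ≤ M) (hlow : ∃ α ∈ Ioo (0 : ℝ) 1, c α < R)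
    (hhigh : ¬ ∀ α ∈ Ioo (0 : ℝ) 1, c α ≤ R) :
    ∃ α ∈ Ioo (0 : ℝ) 1, α * d α - Φ α α = R := by
  have hdiag' : ∀ α ∈ Ioo (0 : ℝ) 1, Φ α α = -((1 - α) * c α) := fun α hα => by
    linarith [hdiag α hα]
  have hdc : ∀ α ∈ Ioo (0 : ℝ) 1, ContinuousAt (fun γ => Φ γ γ) α := by
    intro α hα
    have : ContinuousAt (fun γ => -((1 - γ) * c γ)) α :=
      ((continuousAt_const.sub continuousAt_id).mul (hc α hα)).neg
    refine this.congr ?_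
    filter_upwards [Ioo_mem_nhds hα.1 hα.2] with γ hγ using (hdiag' γ hγ).symm
  have hd : ∀ α ∈ Ioo (0 : ℝ) 1, ContinuousAt d α := fun α hα =>
    continuousAt_deriv_of_tangents isOpen_Ioo htan hder hcont hdc hα
  have hgcont : ContinuousOn (fun α => α * d α - Φ α α) (Ioo 0 1) := fun α hα =>
    ((continuousAt_id.mul (hd α hα)).sub (hdc α hα)).continuousWithinAt
  -- Evaluate the tangent as `β → 1`, where `Φ α β ≤ 0`. Consequently `α * d α - Φ α α ≤ c α`, which
  -- is below `R` at a small order.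
  have hdle : ∀ α ∈ Ioo (0 : ℝ) 1, d α ≤ c α := by
    intro α hα
    have hlim : Tendsto (fun β : ℝ => d α * (β - α)) (𝓝[<] 1) (𝓝 (d α * (1 - α))) :=
      ((by fun_prop : Continuous fun β : ℝ => d α * (β - α)).tendsto 1).mono_left nhdsWithin_le_nhds
    have : d α * (1 - α) ≤ (1 - α) * c α := by
      refine le_of_tendsto hlim ?_
      filter_upwards [Ioo_mem_nhdsLT (show (0:ℝ) < 1 by norm_num)] with β hβ
      have h1 := htan α hα β hβ
      have h2 := hle α hα β hβ
      have h3 := mul_nonneg (by linarith [hβ.2] : 0 ≤ 1 - β) (hc0 β hβ)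
      linarith [hdiag α hα]
    have h1 : 0 < 1 - α := by linarith [hα.2]
    nlinarith
  obtain ⟨α₀, hα₀, hα₀R⟩ := hlow
  have hg₀ : α₀ * d α₀ - Φ α₀ α₀ ≤ R := by
    have h1 := hdle α₀ hα₀
    have h2 := hdiag α₀ hα₀
    have h3 := mul_le_mul_of_nonneg_left h1 hα₀.1.le
    nlinarith
  -- Otherwise, for fixed `β < α`, the tangent at `α` bounds `(1 - β) * c β / β` using slope `R`; as
  -- `α → 1` this becomes `c β ≤ R`. The bound `M` makes the term `(1 - α) * c α` vanish.
  have hex : ∃ α ∈ Ioo (0 : ℝ) 1, R ≤ α * d α - Φ α α := by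
    by_contra! hcon
    refine hhigh fun β hβ => ?_
    have hlim : Tendsto (fun α : ℝ => (1 - α) * M / α + R * (1 / β - 1 / α)) (𝓝[<] 1)
        (𝓝 ((1 - 1) * M / 1 + R * (1 / β - 1 / 1))) := by
      have hc : ContinuousAt (fun α : ℝ => (1 - α) * M / α + R * (1 / β - 1 / α)) 1 := by
        refine ContinuousAt.add (ContinuousAt.div (by fun_prop) continuousAt_id one_ne_zero) ?_
        exact continuousAt_const.mul (continuousAt_const.sub
          (continuousAt_const.div continuousAt_id one_ne_zero))
      exact hc.tendsto.mono_left nhdsWithin_le_nhds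
    have hkey : (1 - β) * c β / β ≤ (1 - 1) * M / 1 + R * (1 / β - 1 / 1) := by
      refine ge_of_tendsto hlim ?_
      filter_upwards [Ioo_mem_nhdsLT hβ.2] with α hα
      have hαI : α ∈ Ioo (0 : ℝ) 1 := ⟨hβ.1.trans hα.1, hα.2⟩
      have h1 := neg_div_le_of_tangent hαI.1 hβ.1 (htan α hαI β hβ)
      have h2 : (1 - β) * c β / β ≤ -Φ α β / β := by
        have := hβ.1
        gcongr
        exact hle α hαI β hβ
      have h3 : 0 ≤ 1 / β - 1 / α := sub_nonneg.2 (one_div_le_one_div_of_le hβ.1 hα.1.le)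
      have h4 := mul_le_mul_of_nonneg_right (hcon α hαI).le h3
      have h5 : -Φ α α / α ≤ (1 - α) * M / α := by
        rw [hdiag α hαI]
        have := hαI.1
        have := mul_le_mul_of_nonneg_left (hcM α hαI) (by linarith [hα.2] : 0 ≤ 1 - α)
        gcongr
      linarith
    have e : (1 - 1) * M / 1 + R * (1 / β - 1 / 1) = (1 - β) * R / β := by
      have := hβ.1.ne'
      field_simp
      ring
    rw [e, div_le_div_iff_of_pos_right hβ.1] at hkey
    exact le_of_mul_le_mul_left hkey (by linarith [hβ.2])
  obtain ⟨α₁, hα₁, hg₁⟩ := hex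
  obtain ⟨α, hα, hαR⟩ := (ordConnected_Ioo (a := (0:ℝ)) (b := 1)).isPreconnected.intermediate_value
    hα₀ hα₁ hgcont ⟨hg₀, hg₁⟩
  exact ⟨α, hα, hαR⟩

/-- In the variable 1/β the function `-Φ β / β` is concave with supergradient `β * D β - Φ β`.
Strictness at `α` puts `R` strictly between the supergradients at nearby `β₂ < α < β₁`. For `τ`
between them no order outside `[β₂, β₁]` does better than an endpoint, and inside, the tangent at
`α` is off by at most `ε * |τ - R|`. -/
theorem conjugate_le_of_strict_tangent {Φ D : ℝ → ℝ} {α R : ℝ} (hα : α ∈ Ioo (0 : ℝ) 1)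
    (htan : ∀ γ ∈ Ioo (0 : ℝ) 1, ∀ β ∈ Ioo (0 : ℝ) 1, Φ γ + D γ * (β - γ) ≤ Φ β)
    (hstrict : ∀ β ∈ Ioo (0 : ℝ) 1, β ≠ α → Φ α + D α * (β - α) < Φ β)
    (hR : α * D α - Φ α = R) {ε : ℝ} (hε : 0 < ε) :
    ∀ᶠ τ in 𝓝 R, ∀ β ∈ Ioo (0 : ℝ) 1, -Φ β / β - (1 / β - 1) * τ ≤
      -Φ α / α - (1 / α - 1) * τ + ε * |τ - R| := by
  have hcont : ContinuousAt (fun β : ℝ => 1 / β) α :=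
    continuousAt_const.div continuousAt_id hα.1.ne'
  have hmem : Ioo (0 : ℝ) 1 ∈ 𝓝 α := Ioo_mem_nhds hα.1 hα.2
  have hnear : ∀ᶠ β in 𝓝 α, |1 / β - 1 / α| < ε := by
    have := hcont.tendsto.eventually (Metric.ball_mem_nhds (1 / α) hε)
    simpa [Real.dist_eq] using this
  obtain ⟨β₁, ⟨h1I, h1n⟩, h1⟩ : ∃ β, (β ∈ Ioo (0 : ℝ) 1 ∧ |1 / β - 1 / α| < ε) ∧ α < β := by
    have h2 : ∀ᶠ β in 𝓝[>] α, β ∈ Ioo (0 : ℝ) 1 ∧ |1 / β - 1 / α| < ε :=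
      nhdsWithin_le_nhds (Filter.inter_mem hmem hnear)
    exact (h2.and self_mem_nhdsWithin).exists
  obtain ⟨β₂, ⟨h2I, h2n⟩, h2⟩ : ∃ β, (β ∈ Ioo (0 : ℝ) 1 ∧ |1 / β - 1 / α| < ε) ∧ β < α := by
    have h2 : ∀ᶠ β in 𝓝[<] α, β ∈ Ioo (0 : ℝ) 1 ∧ |1 / β - 1 / α| < ε :=
      nhdsWithin_le_nhds (Filter.inter_mem hmem hnear)
    exact (h2.and self_mem_nhdsWithin).exists
  have hs1 := neg_div_lt_of_tangent hα.1 h1I.1 (hstrict β₁ h1I h1.ne')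
  have hs2 := neg_div_lt_of_tangent hα.1 h2I.1 (hstrict β₂ h2I h2.ne)
  have ht1 := neg_div_le_of_tangent h1I.1 hα.1 (htan β₁ h1I α hα)
  have ht2 := neg_div_le_of_tangent h2I.1 hα.1 (htan β₂ h2I α hα)
  rw [hR] at hs1 hs2
  set g₁ := β₁ * D β₁ - Φ β₁ with hg₁def
  set g₂ := β₂ * D β₂ - Φ β₂ with hg₂def
  have hi1 : 1 / β₁ < 1 / α := one_div_lt_one_div_of_lt hα.1 h1
  have hi2 : 1 / α < 1 / β₂ := one_div_lt_one_div_of_lt h2I.1 h2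
  -- Add the strict inequality from `α` to `β₁` and the tangent inequality back from `β₁` to `α`.
  have hg₁ : R < g₁ := by nlinarith
  have hg₂ : g₂ < R := by nlinarith
  filter_upwards [Ioo_mem_nhds hg₂ hg₁] with τ hτ β hβ
  have hbase : ∀ γ : ℝ, |1 / γ - 1 / α| < ε → (R - τ) * (1 / γ - 1 / α) ≤ ε * |τ - R| := by
    intro γ hγ
    calc (R - τ) * (1 / γ - 1 / α) ≤ |(R - τ) * (1 / γ - 1 / α)| := le_abs_self _
      _ = |1 / γ - 1 / α| * |τ - R| := by rw [abs_mul, abs_sub_comm R τ, mul_comm]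
      _ ≤ ε * |τ - R| := by gcongr
  rcases le_or_gt β₁ β with hb1 | hb1
  · have h3 := neg_div_le_of_tangent h1I.1 hβ.1 (htan β₁ h1I β hβ)
    rw [← hg₁def] at h3
    have h4 : 1 / β ≤ 1 / β₁ := one_div_le_one_div_of_le h1I.1 hb1
    have h5 := hbase β₁ h1n
    nlinarith [hτ.2]
  · rcases le_or_gt β β₂ with hb2 | hb2
    · have h3 := neg_div_le_of_tangent h2I.1 hβ.1 (htan β₂ h2I β hβ)
      rw [← hg₂def] at h3
      have h4 : 1 / β₂ ≤ 1 / β := one_div_le_one_div_of_le hβ.1 hb2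
      have h5 := hbase β₂ h2n
      nlinarith [hτ.1]
    · have h3 := neg_div_le_of_tangent hα.1 hβ.1 (htan α hα β hβ)
      rw [hR] at h3
      have h4 : 1 / β₁ < 1 / β := one_div_lt_one_div_of_lt hβ.1 hb1
      have h5 : 1 / β < 1 / β₂ := one_div_lt_one_div_of_lt h2I.1 hb2
      have h6 : |1 / β - 1 / α| < ε := by
        rw [abs_lt] at h1n h2n ⊢
        constructor <;> linarith
      have := hbase β h6
      linarith

theorem hasDerivAt_of_affine_bounds {f : ℝ → EReal} {a b R : ℝ}
    (hlow : ∀ τ : ℝ, ((a + b * τ : ℝ) : EReal) ≤ f τ)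
    (hup : ∀ ε : ℝ, 0 < ε → ∀ᶠ τ in 𝓝 R, f τ ≤ ((a + b * τ + ε * |τ - R| : ℝ) : EReal)) :
    (∀ᶠ τ in 𝓝 R, f τ ≠ ⊥ ∧ f τ ≠ ⊤) ∧ HasDerivAt (fun τ => (f τ).toReal) b R := by
  have hbot : ∀ τ, f τ ≠ ⊥ := fun τ => ((EReal.bot_lt_coe _).trans_le (hlow τ)).ne'
  have hreal : ∀ τ, ∀ u : ℝ, f τ ≤ (u : EReal) → a + b * τ ≤ (f τ).toReal ∧ (f τ).toReal ≤ u := by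
    intro τ u hu
    have htop : f τ ≠ ⊤ := (hu.trans_lt (EReal.coe_lt_top u)).ne
    have e := EReal.coe_toReal htop (hbot τ)
    constructor
    · have := hlow τ
      rw [← e] at this
      exact_mod_cast this
    · rw [← e] at hu
      exact_mod_cast hu
  refine ⟨?_, ?_⟩
  · filter_upwards [hup 1 one_pos] with τ hτ
    exact ⟨hbot τ, (hτ.trans_lt (EReal.coe_lt_top _)).ne⟩
  · rw [hasDerivAt_iff_isLittleO, Asymptotics.isLittleO_iff]
    intro ε hε
    obtain ⟨hR1, hR2⟩ := hreal R _ (hup ε hε).self_of_nhds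
    rw [sub_self, abs_zero, mul_zero, add_zero] at hR2
    filter_upwards [hup ε hε] with τ hτ
    obtain ⟨h1, h2⟩ := hreal τ _ hτ
    rw [Real.norm_eq_abs, Real.norm_eq_abs, smul_eq_mul, abs_le]
    have h3 : 0 ≤ ε * |τ - R| := by positivity
    constructor <;> linarith

end RealAnalysis

/-! ### Arbitrary centers and the role of symmetry -/

section CenterProperties

variable {X Y : Type*} [MeasurableSpace Y] {W : X → ProbabilityMeasure Y} {ν : Measure Y}
  [IsProbabilityMeasure ν]

theorem eq_withDensity_rnDeriv_of_isProbDensity {Q : Measure Y} [IsProbabilityMeasure Q]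
    (h : IsProbDensity ν (Q.rnDeriv ν)) : Q = ν.withDensity (Q.rnDeriv ν) := by
  have hdec := Measure.haveLebesgueDecomposition_add Q ν
  have hmass := congrArg (fun m : Measure Y => m univ) hdec
  have := h.isProbabilityMeasure
  simp only [Measure.add_apply, measure_univ] at hmass
  have h0 : Q.singularPart ν univ = 0 := by
    refine (ENNReal.add_right_inj (a := 1) (by simp)).1 ?_
    rw [add_zero, add_comm]
    exact hmass.symm
  rw [Measure.measure_univ_eq_zero] at h0
  rw [h0, zero_add] at hdec
  exact hdec

theorem exp_mul_renyiDiv {α : ℝ} (h1 : α < 1) {P Q : Measure Y}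
    (h : hellingerIntegral α P Q ≠ 0) (h' : hellingerIntegral α P Q ≠ ∞) :
    EReal.exp (((1 - α : ℝ) : EReal) * renyiDiv α P Q) = (hellingerIntegral α P Q)⁻¹ := by
  have hpos := ENNReal.toReal_pos h h'
  rw [renyiDiv_eq_coe h1 h h', ← EReal.coe_mul, EReal.exp_coe,
    mul_div_cancel₀ _ (by linarith : 1 - α ≠ 0), Real.exp_neg, Real.exp_log hpos,
    ENNReal.ofReal_inv_of_pos hpos, ENNReal.ofReal_toReal h']

theorem tiltedMeasure_eq_tilted {α : ℝ} (h0 : 0 < α) (h1 : α < 1) {P : Measure Y}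
    [IsProbabilityMeasure P] (hP : P ≪ ν) {q : Y → ℝ≥0∞} (hq : IsProbDensity ν q)
    (h : hell ν α (P.rnDeriv ν) q ≠ 0) :
    tiltedMeasure α P (ν.withDensity q) =
      (suppMeasure ν (P.rnDeriv ν) q).tilted fun y => α * logRatio (P.rnDeriv ν) q y := by
  have hw := IsProbDensity.rnDeriv hP
  have hprob := hq.isProbabilityMeasure
  have e := hellingerIntegral_withDensity h0 h1.le P ν hP hq.1 hq.lintegral_ne_top
  rw [hw.tilted_eq_withDensity hq h0 h1 h, tiltedMeasure_eq_withDensity h0 h1.le P _ ν hP,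
    exp_mul_renyiDiv h1 (e ▸ h) (e ▸ hw.hell_ne_top h0.le h1.le hq), e]
  congr 1
  refine withDensity_congr_ae ?_
  filter_upwards [Measure.rnDeriv_withDensity ν hq.1] with y hy
  rw [hy]

namespace IsCenterFamily

variable {c : ℝ → ℝ} {q : ℝ → Y → ℝ≥0∞} (h : IsCenterFamily W ν c q)
include h

theorem isAugustinCenter {α : ℝ} (hα : α ∈ Ioo (0 : ℝ) 1) :
    IsAugustinCenter α W (h.dens α hα).toProb :=
  isAugustinCenter_of_renyiDiv_le (h.cap α hα) fun x =>
    (renyiDiv_toProb_le_iff hα.1 hα.2 (h.ac x) (h.dens α hα)).2 (h.level α hα x)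

/-- A center is not assumed dominated by `ν`. If its absolutely continuous part had mass `Z < 1`,
normalizing that part would give a level below the capacity; so `Z = 1` and the uniqueness of the
density applies. -/
theorem rnDeriv_ae_eq [Nonempty X] {α : ℝ} (hα : α ∈ Ioo (0 : ℝ) 1) {Q : ProbabilityMeasure Y}
    (hQ : IsAugustinCenter α W Q) :
    (Q : Measure Y).rnDeriv ν =ᵐ[ν] q α ∧ (Q : Measure Y) = ν.withDensity (q α) := by
  set m := (Q : Measure Y).rnDeriv ν with hm
  have hmm : Measurable m := Measure.measurable_rnDeriv _ _
  have hw := fun x => IsProbDensity.rnDeriv (ν := ν) (h.ac x)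
  have hlev : ∀ x, ENNReal.ofReal (Real.exp (-((1 - α) * c α))) ≤
      hell ν α ((W x : Measure Y).rnDeriv ν) m := by
    intro x
    have h1 := hQ.renyiDiv_le x
    rw [h.cap α hα, renyiDiv_le_iff hα.2 (ne_top_of_le_ne_top (by simp)
      (hellingerIntegral_le_one hα.1.le hα.2.le _ _)),
      hellingerIntegral_eq_hell hα.1 hα.2.le _ _ ν (h.ac x)] at h1
    exact h1
  obtain ⟨x₀⟩ := ‹Nonempty X›
  set Z := ∫⁻ y, m y ∂ν with hZ
  have hZ1 : Z ≤ 1 := Measure.lintegral_rnDeriv_le.trans (by simp)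
  have hZtop : Z ≠ ∞ := ne_top_of_le_ne_top (by simp) hZ1
  have hZ0 : Z ≠ 0 := lintegral_ne_zero_of_exp_le_hell hα.1.le hα.2 (hw x₀).1 hmm (hlev x₀)
  have hdens : IsProbDensity ν fun y => Z⁻¹ * m y :=
    ⟨hmm.const_mul _, by rw [lintegral_const_mul _ hmm, ← hZ, ENNReal.inv_mul_cancel hZ0 hZtop]⟩
  have hcap := augustinCapacity_le_of_hell_ge h.ac hα.1 hα.2 hdens fun x =>
    exp_le_hell_inv_mul hα.2 (hw x).1 hmm hZ0 hZtop (hlev x)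
  rw [h.cap α hα, EReal.coe_le_coe_iff] at hcap
  have hlog : 0 ≤ Real.log Z.toReal := by linarith
  have hZr := ENNReal.toReal_pos hZ0 hZtop
  have hZge : 1 ≤ Z.toReal := (Real.log_nonneg_iff hZr).1 hlog
  have hZeq : Z = 1 := le_antisymm hZ1 (by
    rw [← ENNReal.ofReal_toReal hZtop, ← ENNReal.ofReal_one]
    exact ENNReal.ofReal_le_ofReal hZge)
  have hmd : IsProbDensity ν m := ⟨hmm, hZeq⟩
  have hae := h.ae_eq_of_level hα hmd hlev
  exact ⟨hae, (eq_withDensity_rnDeriv_of_isProbDensity hmd).trans (withDensity_congr_ae hae)⟩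

omit [IsProbabilityMeasure ν] in
theorem hell_self_ne_zero {α : ℝ} (hα : α ∈ Ioo (0 : ℝ) 1) (x : X) :
    hell ν α ((W x : Measure Y).rnDeriv ν) (q α) ≠ 0 := fun h0 => by
  have := h.level α hα x
  rw [h0, nonpos_iff_eq_zero, ENNReal.ofReal_eq_zero] at this
  exact absurd this (not_le.2 (Real.exp_pos _))

theorem hell_ne_zero {α β : ℝ} (hα : α ∈ Ioo (0 : ℝ) 1) (hβ : β ∈ Ioo (0 : ℝ) 1) (x : X) :
    hell ν β ((W x : Measure Y).rnDeriv ν) (q α) ≠ 0 :=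
  (IsProbDensity.rnDeriv (h.ac x)).hell_pos_iff (h.dens α hα) hα hβ (h.hell_self_ne_zero hα x)

/-- The order `α` center competes at order `β`; by symmetry its divergence from every input is the
same number, so that number bounds the capacity. -/
theorem le_neg_logHell {α β : ℝ} (hα : α ∈ Ioo (0 : ℝ) 1) (hβ : β ∈ Ioo (0 : ℝ) 1) (x : X)
    (hsymm : ∀ x', hell ν β ((W x' : Measure Y).rnDeriv ν) (q α) =
      hell ν β ((W x : Measure Y).rnDeriv ν) (q α)) :
    (1 - β) * c β ≤ -logHell ν ((W x : Measure Y).rnDeriv ν) (q α) β := by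
  have hfin := (IsProbDensity.rnDeriv (h.ac x)).hell_ne_top hβ.1.le hβ.2.le (h.dens α hα)
  have hpos := ENNReal.toReal_pos (h.hell_ne_zero hα hβ x) hfin
  have hb : 1 - β ≠ 0 := by linarith [hβ.2]
  have hcap := augustinCapacity_le_of_hell_ge h.ac hβ.1 hβ.2 (h.dens α hα)
    (c := -logHell ν ((W x : Measure Y).rnDeriv ν) (q α) β / (1 - β)) fun x' => by
      rw [hsymm x', mul_div_cancel₀ _ hb, neg_neg, logHell, Real.exp_log hpos,
        ENNReal.ofReal_toReal hfin]
  rw [h.cap β hβ, EReal.coe_le_coe_iff, le_div_iff₀ (by linarith [hβ.2])] at hcap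
  linarith

theorem neg_logHell_self_le {α : ℝ} (hα : α ∈ Ioo (0 : ℝ) 1) (x : X) :
    -logHell ν ((W x : Measure Y).rnDeriv ν) (q α) α ≤ (1 - α) * c α := by
  have hfin := (IsProbDensity.rnDeriv (h.ac x)).hell_ne_top hα.1.le hα.2.le (h.dens α hα)
  have hpos := ENNReal.toReal_pos (h.hell_self_ne_zero hα x) hfin
  have h1 := (ENNReal.ofReal_le_iff_le_toReal hfin).1 (h.level α hα x)
  rw [← Real.le_log_iff_exp_le hpos] at h1
  rw [logHell]
  linarith

end IsCenterFamily

/-- Symmetry at the single order `α` fixes the whole law of the ratio `q / w`, and every `β` in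
(0,1) only takes a moment of that law. -/
theorem IsRenyiSymmetric.hell_eq {ν : ProbabilityMeasure Y} (hsym : IsRenyiSymmetric W ν)
    {c : ℝ → ℝ} {q : ℝ → Y → ℝ≥0∞} (h : IsCenterFamily W (ν : Measure Y) c q) {α β : ℝ}
    (hα : α ∈ Ioo (0 : ℝ) 1) (hβ : β ∈ Ioo (0 : ℝ) 1) (x x' : X) :
    hell (ν : Measure Y) β ((W x : Measure Y).rnDeriv ν) (q α) =
      hell (ν : Measure Y) β ((W x' : Measure Y).rnDeriv ν) (q α) := by
  have hcen := h.isAugustinCenter hα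
  obtain ⟨G, hG⟩ := hsym.2 α hα.1 hcen.1
  have hae : ((h.dens α hα).toProb : Measure Y).rnDeriv ν =ᵐ[(ν : Measure Y)] q α :=
    Measure.rnDeriv_withDensity _ (h.dens α hα).1
  have e := fun x => (hG _ hcen x)
  rw [← hell_congr (EventuallyEq.refl _ _) hae, ← hell_congr (EventuallyEq.refl _ _) hae]
  exact hell_eq_of_forall_measure_eq hβ.1 hβ.2 (h.ac x) (h.ac x') (Measure.measurable_rnDeriv _ _)
    (ne_top_of_le_ne_top (by simp) Measure.lintegral_rnDeriv_le)
    fun s => (e x s).trans (e x' s).symm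

end CenterProperties

/-! ### The degenerate case and the exponent as a real supremum -/

section Assembly

variable {X Y : Type*} [MeasurableSpace Y] {W : X → ProbabilityMeasure Y}

theorem logHell_eq_affine_of_ae_eq {ν : Measure Y} {w q : Y → ℝ≥0∞} (hw : IsProbDensity ν w)
    (hq : IsProbDensity ν q) {α γ : ℝ} (hα : α ∈ Ioo (0 : ℝ) 1) (hγ : 0 < γ)
    (h : hell ν α w q ≠ 0)
    (hae : ∀ᵐ y ∂((suppMeasure ν w q).tilted fun y => α * logRatio w q y),
      w y = ENNReal.ofReal γ * q y) :
    ∃ b, ∀ β ∈ Ioo (0 : ℝ) 1, logHell ν w q β = β * Real.log γ + b := by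
  have hac := absolutelyContinuous_tilted (hw.integrable_exp_logRatio hq hα.1 hα.2)
  have hX : ∀ᵐ y ∂(suppMeasure ν w q), logRatio w q y = Real.log γ := by
    filter_upwards [hac.ae_le hae, hac.ae_le (hw.ae_tilted hq hα.1 hα.2 h)] with y h1 h2
    have hqr := ENNReal.toReal_pos h2.2.2.1 h2.2.2.2
    rw [logRatio, h1, ENNReal.toReal_mul, ENNReal.toReal_ofReal hγ.le,
      mul_div_cancel_right₀ _ hqr.ne']
  have key : ∀ β ∈ Ioo (0 : ℝ) 1, hell ν β w q =
      ENNReal.ofReal (Real.exp (β * Real.log γ)) * suppMeasure ν w q univ := by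
    intro β hβ
    rw [← hw.lintegral_exp_logRatio hq hβ.1 hβ.2, ← lintegral_const]
    refine lintegral_congr_ae ?_
    filter_upwards [hX] with y hy
    rw [hy]
  have hm0 : suppMeasure ν w q univ ≠ 0 := fun h0 => h (by rw [key α hα, h0, mul_zero])
  have hmtop : suppMeasure ν w q univ ≠ ∞ := fun h0 => hw.hell_ne_top hα.1.le hα.2.le hq (by
    rw [key α hα, h0, ENNReal.mul_top]
    exact (ENNReal.ofReal_pos.2 (Real.exp_pos _)).ne')
  refine ⟨Real.log (suppMeasure ν w q univ).toReal, fun β hβ => ?_⟩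
  rw [logHell, key β hβ, ENNReal.toReal_mul, ENNReal.toReal_ofReal (Real.exp_pos _).le,
    Real.log_mul (Real.exp_pos _).ne' (ENNReal.toReal_pos hm0 hmtop).ne', Real.log_exp]

/-- As `β → 1` the left side tends to zero because `c` is bounded. This forces `b = -l`, and the
factor `1 - β` cancels. -/
theorem eq_of_one_sub_mul_eq_affine {c : ℝ → ℝ} {l b M : ℝ}
    (h : ∀ β ∈ Ioo (0 : ℝ) 1, (1 - β) * c β = -(β * l + b))
    (h0 : ∀ β ∈ Ioo (0 : ℝ) 1, 0 ≤ c β) (hM : ∀ β ∈ Ioo (0 : ℝ) 1, c β ≤ M) :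
    ∀ β ∈ Ioo (0 : ℝ) 1, c β = l := by
  have hev : ∀ᶠ β : ℝ in 𝓝[<] 1, β ∈ Ioo (0 : ℝ) 1 := Ioo_mem_nhdsLT one_pos
  have l1 : Tendsto (fun β : ℝ => -(β * l + b)) (𝓝[<] 1) (𝓝 (-(1 * l + b))) :=
    ((by fun_prop : Continuous fun β : ℝ => -(β * l + b)).tendsto 1).mono_left nhdsWithin_le_nhds
  have l2 : Tendsto (fun β : ℝ => (1 - β) * M) (𝓝[<] 1) (𝓝 ((1 - 1) * M)) :=
    ((by fun_prop : Continuous fun β : ℝ => (1 - β) * M).tendsto 1).mono_left nhdsWithin_le_nhds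
  have hge : 0 ≤ -(1 * l + b) := by
    refine ge_of_tendsto l1 ?_
    filter_upwards [hev] with β hβ
    rw [← h β hβ]
    exact mul_nonneg (by linarith [hβ.2]) (h0 β hβ)
  have hle : -(1 * l + b) ≤ (1 - 1) * M := by
    refine le_of_tendsto_of_tendsto l1 l2 ?_
    filter_upwards [hev] with β hβ
    rw [← h β hβ]
    exact mul_le_mul_of_nonneg_left (hM β hβ) (by linarith [hβ.2])
  intro β hβ
  have h1 := h β hβ
  have h2 : 1 - β ≠ 0 := by linarith [hβ.2]
  have h3 : b = -l := by linarith
  rw [h3] at h1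
  exact mul_left_cancel₀ h2 (by linarith)

theorem spherePackingExponent_eq {c : ℝ → ℝ}
    (hc : ∀ α ∈ Ioo (0 : ℝ) 1, augustinCapacity α W = (c α : EReal)) (τ : ℝ) :
    spherePackingExponent τ W =
      ⨆ α ∈ Ioo (0 : ℝ) 1, (((1 - α) / α * (c α - τ) : ℝ) : EReal) := by
  refine iSup_congr fun α => iSup_congr fun hα => ?_
  rw [hc α hα, EReal.coe_mul, EReal.coe_sub]

end Assembly

/-! ### The main theorem -/

theorem lemma3 {X Y : Type*} [MeasurableSpace Y]
    (W : X → ProbabilityMeasure Y) (ν : ProbabilityMeasure Y)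
    (hsym : IsRenyiSymmetric W ν) (hfin : augustinCapacity 1 W < ⊤)
    (C₀ : EReal) (hC₀ : Tendsto (fun α : ℝ => augustinCapacity α W) (𝓝[>] 0) (𝓝 C₀))
    (R : ℝ) (hR₀ : C₀ < (R : EReal)) (hR₁ : (R : EReal) < augustinCapacity 1 W) :
    (∃ α ∈ Ioo (0 : ℝ) 1, ∃ q : ProbabilityMeasure Y, IsAugustinCenter α W q ∧
      ∀ x, renyiDiv 1 (tiltedMeasure α (W x : Measure Y) (q : Measure Y)) (q : Measure Y)
        = (R : EReal)) ∧
    (∀ α ∈ Ioo (0 : ℝ) 1, ∀ q : ProbabilityMeasure Y, IsAugustinCenter α W q →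
      (∀ x, renyiDiv 1 (tiltedMeasure α (W x : Measure Y) (q : Measure Y)) (q : Measure Y)
        = (R : EReal)) →
      (∀ x, spherePackingExponent R W =
        renyiDiv 1 (tiltedMeasure α (W x : Measure Y) (q : Measure Y)) (W x : Measure Y)) ∧
      (((∃ x, ∀ γ : ℝ, 0 < γ →
            tiltedMeasure α (W x : Measure Y) (q : Measure Y)
              {y | (W x : Measure Y).rnDeriv (ν : Measure Y) y =
                ENNReal.ofReal γ * (q : Measure Y).rnDeriv (ν : Measure Y) y} < 1) ∨
          (∃ Q : ProbabilityMeasure Y, ∀ β ∈ Ioc (0 : ℝ) 1, IsAugustinCenter β W Q)) →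
        (∀ᶠ τ in 𝓝 R, spherePackingExponent τ W ≠ ⊥ ∧ spherePackingExponent τ W ≠ ⊤) ∧
        HasDerivAt (fun τ : ℝ => (spherePackingExponent τ W).toReal) ((α - 1) / α) R)) := by
  -- Without inputs there is no input distribution and the capacity is the empty supremum `⊥`.
  have hX : Nonempty X := by
    by_contra hne
    rw [not_nonempty_iff] at hne
    refine absurd hR₁ (not_lt.2 (le_trans (iSup_le fun p => ?_) bot_le))
    exact hne.elim p.nonempty.some
  obtain ⟨qd, h⟩ := exists_isCenterFamily hsym.1 hfin
  set c : ℝ → ℝ := fun α => (augustinCapacity α W).toReal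
  obtain ⟨x₀⟩ := id hX
  set w : X → Y → ℝ≥0∞ := fun x => (W x : Measure Y).rnDeriv ν with hwdef
  have hw : ∀ x, IsProbDensity (ν : Measure Y) (w x) := fun x => IsProbDensity.rnDeriv (h.ac x)
  set Φ : ℝ → ℝ → ℝ := fun α => logHell (ν : Measure Y) (w x₀) (qd α) with hΦ
  set v : X → ℝ → Measure Y := fun x α =>
    (suppMeasure (ν : Measure Y) (w x) (qd α)).tilted fun y => α * logRatio (w x) (qd α) y with hv
  set d : ℝ → ℝ := fun α => ∫ y, logRatio (w x₀) (qd α) y ∂(v x₀ α) with hd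
  have hΦx : ∀ x, ∀ α ∈ Ioo (0 : ℝ) 1, ∀ β ∈ Ioo (0 : ℝ) 1,
      logHell (ν : Measure Y) (w x) (qd α) β = Φ α β := fun x α hα β hβ => by
    simp only [hΦ, logHell]
    rw [hsym.hell_eq h hα hβ x x₀]
  have hne : ∀ x, ∀ α ∈ Ioo (0 : ℝ) 1, hell (ν : Measure Y) α (w x) (qd α) ≠ 0 :=
    fun x α hα => h.hell_self_ne_zero hα x
  have hder : ∀ α ∈ Ioo (0 : ℝ) 1, HasDerivAt (Φ α) (d α) α := fun α hα =>
    (hw x₀).hasDerivAt_logHell (h.dens α hα) hα.1 hα.2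
  -- The tilted means are derivatives at `α` of one common function of the order, so they do not
  -- depend on `x`.
  have hdx : ∀ x, ∀ α ∈ Ioo (0 : ℝ) 1, ∫ y, logRatio (w x) (qd α) y ∂(v x α) = d α := by
    intro x α hα
    refine ((hw x).hasDerivAt_logHell (h.dens α hα) hα.1 hα.2).unique ((hder α hα).congr_of_eventuallyEq ?_)
    filter_upwards [Ioo_mem_nhds hα.1 hα.2] with β hβ using hΦx x α hα β hβ
  have htan : ∀ α ∈ Ioo (0 : ℝ) 1, ∀ γ ∈ Ioo (0 : ℝ) 1, ∀ β ∈ Ioo (0 : ℝ) 1,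
      Φ α γ + deriv (Φ α) γ * (β - γ) ≤ Φ α β := by
    intro α hα γ hγ β hβ
    rw [((hw x₀).hasDerivAt_logHell (h.dens α hα) hγ.1 hγ.2).deriv]
    exact ((hw x₀).logHell_ge_tangent (h.dens α hα) hγ.1 hγ.2 hβ.1 hβ.2
      (h.hell_ne_zero hα hγ x₀)).1
  have htan' : ∀ α ∈ Ioo (0 : ℝ) 1, ∀ β ∈ Ioo (0 : ℝ) 1, Φ α α + d α * (β - α) ≤ Φ α β :=
    fun α hα β hβ => (hder α hα).deriv ▸ htan α hα α hα β hβ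
  have hle : ∀ α ∈ Ioo (0 : ℝ) 1, ∀ β ∈ Ioo (0 : ℝ) 1, (1 - β) * c β ≤ -Φ α β :=
    fun α hα β hβ => h.le_neg_logHell hα hβ x₀ fun x' => hsym.hell_eq h hα hβ x' x₀
  have hdiag : ∀ α ∈ Ioo (0 : ℝ) 1, -Φ α α = (1 - α) * c α := fun α hα =>
    le_antisymm (h.neg_logHell_self_le hα x₀) (hle α hα α hα)
  have hright : ∀ x, ∀ α ∈ Ioo (0 : ℝ) 1, renyiDiv 1 (v x α) ((ν : Measure Y).withDensity (qd α)) =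
      ((α * d α - Φ α α : ℝ) : EReal) := fun x α hα => by
    have := (hw x).renyiDiv_one_tilted_right (h.dens α hα) hα.1 hα.2 (hne x α hα)
    rwa [hΦx x α hα α hα, hdx x α hα] at this
  have hleft : ∀ x, ∀ α ∈ Ioo (0 : ℝ) 1, renyiDiv 1 (v x α) (W x : Measure Y) =
      (((α - 1) * d α - Φ α α : ℝ) : EReal) := fun x α hα => by
    have := (hw x).renyiDiv_one_tilted_left (h.dens α hα) hα.1 hα.2 (hne x α hα)
    rwa [hΦx x α hα α hα, hdx x α hα, Measure.withDensity_rnDeriv_eq _ _ (h.ac x)] at this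
  have htilt : ∀ x, ∀ α ∈ Ioo (0 : ℝ) 1,
      tiltedMeasure α (W x : Measure Y) ((ν : Measure Y).withDensity (qd α)) = v x α :=
    fun x α hα => tiltedMeasure_eq_tilted hα.1 hα.2 (h.ac x) (h.dens α hα) (hne x α hα)
  have hc0 : ∀ α ∈ Ioo (0 : ℝ) 1, 0 ≤ c α := fun α hα => h.nonneg hα
  have hcM : ∀ α ∈ Ioo (0 : ℝ) 1, c α ≤ (augustinCapacity 1 W).toReal := by
    intro α hα
    have h1 := augustinCapacity_le_augustinCapacity_one (W := W) hα.1 hα.2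
    refine EReal.toReal_le_toReal h1 ?_ hfin.ne
    rw [h.cap α hα]
    exact EReal.coe_ne_bot _
  have hlow : ∃ α ∈ Ioo (0 : ℝ) 1, c α < R := by
    obtain ⟨α, h1, h2⟩ := ((hC₀.eventually (gt_mem_nhds hR₀)).and (Ioo_mem_nhdsGT one_pos)).exists
    rw [h.cap α h2, EReal.coe_lt_coe_iff] at h1
    exact ⟨α, h2, h1⟩
  have hhigh : ¬ ∀ α ∈ Ioo (0 : ℝ) 1, c α ≤ R := fun hcon =>
    absurd hR₁ (not_lt.2 (h.augustinCapacity_one_le hcon))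
  have hcontΦ : ∀ α ∈ Ioo (0 : ℝ) 1, ∀ β ∈ Ioo (0 : ℝ) 1,
      Tendsto (fun γ => Φ γ β) (𝓝 α) (𝓝 (Φ α β)) := by
    intro α hα β hβ
    have hfin' := (hw x₀).hell_ne_top hβ.1.le hβ.2.le (h.dens α hα)
    have hpos := ENNReal.toReal_pos (h.hell_ne_zero hα hβ x₀) hfin'
    exact ((Real.continuousAt_log hpos.ne').tendsto).comp
      ((ENNReal.tendsto_toReal hfin').comp (h.tendsto_hell hα hβ (hw x₀)))
  refine ⟨?_, ?_⟩
  · obtain ⟨α, hα, hαR⟩ := exists_order_of_tangents htan' hder hcontΦ hdiag hle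
      (fun α hα => h.continuousAt hα) hc0 hcM hlow hhigh
    refine ⟨α, hα, (h.dens α hα).toProb, h.isAugustinCenter hα, fun x => ?_⟩
    change renyiDiv 1 (tiltedMeasure α (W x : Measure Y) ((ν : Measure Y).withDensity (qd α)))
      ((ν : Measure Y).withDensity (qd α)) = R
    rw [htilt x α hα, hright x α hα, hαR]
  intro α hα q hq hqR
  obtain ⟨hqae, hqeq⟩ := h.rnDeriv_ae_eq hα hq
  rw [hqeq] at hqR ⊢
  simp only [htilt _ α hα] at hqR ⊢
  have hR : α * d α - Φ α α = R := by
    have := hqR x₀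
    rw [hright x₀ α hα] at this
    exact_mod_cast this
  have hα0 := hα.1
  have hval : ∀ τ : ℝ, (1 - α) / α * (c α - τ) = -Φ α α / α - (1 / α - 1) * τ := by
    intro τ
    rw [hdiag α hα]
    field_simp
  have hEge : ∀ τ : ℝ, ((-Φ α α / α - (1 / α - 1) * τ : ℝ) : EReal) ≤ spherePackingExponent τ W := by
    intro τ
    rw [spherePackingExponent_eq h.cap, ← hval]
    exact le_iSup₂_of_le α hα le_rfl
  -- The exponent is bounded using the single convex function `Φ α` with the center frozen at order
  -- `α`; `hEge` shows that nothing is lost at `β = α`.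
  have hEle : ∀ τ u : ℝ, (∀ β ∈ Ioo (0 : ℝ) 1, -Φ α β / β - (1 / β - 1) * τ ≤ u) →
      spherePackingExponent τ W ≤ (u : EReal) := by
    intro τ u hu
    rw [spherePackingExponent_eq h.cap]
    refine iSup₂_le fun β hβ => EReal.coe_le_coe_iff.2 (le_trans ?_ (hu β hβ))
    have hβ0 := hβ.1
    have h1 : (1 - β) * c β / β ≤ -Φ α β / β := by
      gcongr
      exact hle α hα β hβ
    calc (1 - β) / β * (c β - τ) = (1 - β) * c β / β - (1 / β - 1) * τ := by field_simp
      _ ≤ _ := by linarith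
  refine ⟨fun x => ?_, fun hab => ?_⟩
  · rw [hleft x α hα]
    have e : (α - 1) * d α - Φ α α = -Φ α α / α - (1 / α - 1) * R := by
      rw [← hR]; field_simp; ring
    rw [e]
    refine le_antisymm (hEle R _ fun β hβ => ?_) (hEge R)
    have h1 := neg_div_le_of_tangent hα.1 hβ.1 (htan' α hα β hβ)
    rw [hR] at h1
    linarith
  have hA : ∃ x, ∀ γ : ℝ, 0 < γ → v x α {y | w x y = ENNReal.ofReal γ * qd α y} < 1 := by
    have hset : ∀ x γ, v x α {y | w x y = ENNReal.ofReal γ * (q : Measure Y).rnDeriv ν y} =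
        v x α {y | w x y = ENNReal.ofReal γ * qd α y} := by
      intro x γ
      have hvac : v x α ≪ (ν : Measure Y) :=
        (tilted_absolutelyContinuous _ _).trans (withDensity_absolutelyContinuous _ _)
      refine measure_congr ?_
      filter_upwards [hvac.ae_le hqae] with y hy
      refine propext ?_
      change w x y = ENNReal.ofReal γ * (q : Measure Y).rnDeriv ν y ↔ w x y = ENNReal.ofReal γ * qd α y
      rw [hy]
    rcases hab with ⟨x, hx⟩ | ⟨Q, hQ⟩
    · refine ⟨x, fun γ hγ => ?_⟩
      rw [← hset]
      have := hx γ hγ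
      rwa [← hqeq] at this
    -- With a common center `Φ α β = Φ β β`. If `w` were almost surely a multiple of `q`, this would
    -- be affine in `β` and the capacity constant on (0,1), against `hlow` and `hhigh`.
    · by_contra! hcon
      obtain ⟨γ, hγ, hγ1⟩ := hcon x₀
      have hprob := (hw x₀).isProbabilityMeasure_tilted (h.dens α hα) hα.1 hα.2 (hne x₀ α hα)
      have hms : MeasurableSet {y | w x₀ y = ENNReal.ofReal γ * qd α y} :=
        measurableSet_eq_fun (hw x₀).1 ((h.dens α hα).1.const_mul _)
      have hae : ∀ᵐ y ∂(v x₀ α), w x₀ y = ENNReal.ofReal γ * qd α y :=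
        (mem_ae_iff_prob_eq_one hms).2 (le_antisymm prob_le_one hγ1)
      obtain ⟨b, hb⟩ := logHell_eq_affine_of_ae_eq (hw x₀) (h.dens α hα) hα hγ (hne x₀ α hα) hae
      have hconst := eq_of_one_sub_mul_eq_affine (c := c) (l := Real.log γ) (b := b)
        (fun β hβ => by
          rw [← hb β hβ, ← hdiag β hβ]
          have h1 := (h.rnDeriv_ae_eq hβ (hQ β ⟨hβ.1, hβ.2.le⟩)).1
          have h2 := (h.rnDeriv_ae_eq hα (hQ α ⟨hα.1, hα.2.le⟩)).1
          simp only [hΦ, logHell]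
          rw [hell_congr (EventuallyEq.refl _ _) (h1.symm.trans h2)]) hc0 hcM
      obtain ⟨α₁, hα₁, hα₁R⟩ := hlow
      rw [hconst α₁ hα₁] at hα₁R
      exact hhigh fun β hβ => (hconst β hβ).trans_le hα₁R.le
  obtain ⟨x, hx⟩ := hA
  -- Equality would make the log-ratio equal to `d α` almost surely under the tilt, that is `w = exp
  -- (d α) * q`, which `hx` excludes with `γ = exp (d α)`.
  have hstrict : ∀ β ∈ Ioo (0 : ℝ) 1, β ≠ α → Φ α α + deriv (Φ α) α * (β - α) < Φ α β := by
    intro β hβ hβα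
    refine lt_of_le_of_ne (htan α hα α hα β hβ) fun heq => ?_
    rw [(hder α hα).deriv] at heq
    have hprob := (hw x).isProbabilityMeasure_tilted (h.dens α hα) hα.1 hα.2 (hne x α hα)
    have hae := ((hw x).logHell_ge_tangent (h.dens α hα) hα.1 hα.2 hβ.1 hβ.2 (hne x α hα)).2 hβα
      (by rw [hΦx x α hα α hα, hΦx x α hα β hβ]; exact (hdx x α hα).symm ▸ heq)
    refine absurd (hx (Real.exp (d α)) (Real.exp_pos _)) (not_lt.2 (le_of_eq ?_))
    have huniv : {y | w x y = ENNReal.ofReal (Real.exp (d α)) * qd α y} =ᵐ[v x α] univ := by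
      refine eventuallyEq_univ.2 ?_
      filter_upwards [hae, (hw x).ae_tilted (h.dens α hα) hα.1 hα.2 (hne x α hα)] with y h1 h2
      have hwr := ENNReal.toReal_pos h2.1 h2.2.1
      have hqr := ENNReal.toReal_pos h2.2.2.1 h2.2.2.2
      have h3 : logRatio (w x) (qd α) y = d α := h1.trans (hdx x α hα)
      change w x y = ENNReal.ofReal (Real.exp (d α)) * qd α y
      rw [← h3, logRatio, Real.exp_log (div_pos hwr hqr), ENNReal.ofReal_div_of_pos hqr,
        ENNReal.ofReal_toReal h2.2.1, ENNReal.ofReal_toReal h2.2.2.2,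
        ENNReal.div_mul_cancel h2.2.2.1 h2.2.2.2]
    rw [measure_congr huniv]
    exact (hprob.measure_univ).symm
  have hslope : (α - 1) / α = -(1 / α - 1) := by field_simp; ring
  rw [hslope]
  refine hasDerivAt_of_affine_bounds (a := -Φ α α / α) (fun τ => ?_) fun ε hε => ?_
  · refine le_trans (le_of_eq ?_) (hEge τ)
    congr 1
    ring
  · have hconj := conjugate_le_of_strict_tangent (R := R) hα (htan α hα) hstrict
      (by rw [(hder α hα).deriv]; exact hR) hε
    filter_upwards [hconj] with τ hτ
    refine hEle τ _ fun β hβ => (hτ β hβ).trans (le_of_eq ?_)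
    ring
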